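/- Let $S^3$ be the unit sphere in $\mathbb{R}^4$, regarded as the group of unit quaternions, let $dg$ be its invariant probability measure and $\Delta$ its Laplace--Beltrami operator. Functions and distributions take values in $\mathbb{K}=\mathbb{R}$ or $\mathbb{C}$. For $f\in C^\infty(S^3\times S^3)$ put $$Tf(x,y)=\int_{S^3} f(xg,gy)\,dg .$$ For $s\in\mathbb{R}$ let $H^s=H^s(S^3\times S^3)$ be the Sobolev space of all distributions $u$ on $S^3\times S^3$ with $(1-\Delta_x-\Delta_y)^{s/2}u\in L^2(S^3\times S^3)$, with the Hilbert norm $\|u\|_s=\|(1-\Delta_x-\Delta_y)^{s/2}u\|_{L^2}$; smooth functions $f$ are regarded as distributions through $\varphi\mapsto\int f\varphi$, and $T$ acts on distributions in the weak sense, $(Tu)(\varphi)=u(T\varphi)$ for $\varphi\in C^\infty(S^3\times S^3)$ (this agrees with the integral above on smooth functions). Let $\mathscr{H}_k$ be the space of harmonic polynomials on $\mathbb{R}^4$ that are homogeneous of degree $k$, restricted to $S^3$, and let $\mathscr{H}_k\otimes\mathscr{H}_\ell\subset C^\infty(S^3\times S^3)$ be the span of the functions $(x,y)\mapsto P(x)Q(y)$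 with $P\in\mathscr{H}_k$ and $Q\in\mathscr{H}_\ell$. Let $E_{k,\ell}:H^s\to\mathscr{H}_k\otimes\mathscr{H}_\ell$ be the orthogonal projection. Theorem. There are linear maps $R_k:\mathscr{H}_k\otimes\mathscr{H}_k\to\mathscr{H}_k\otimes\mathscr{H}_k$, $k=0,1,2,\dots$, with $R_k^2=\mathrm{Id}$ and $R_k$ self-adjoint for the $L^2$ inner product, such that for every $s\in\mathbb{R}$ the following hold. 1. $T$ is a bounded operator from $H^s$ to $H^{s+1}$. 2. The kernel of $T$ in $H^s$ is the closure in $H^s$ of $\bigoplus_{k\neq\ell}\mathscr{H}_k\otimes\mathscr{H}_\ell$. 3. The image of $T$ in $H^{s+1}$ is the closure in $H^{s+1}$ of $\bigoplus_{k}\mathscr{H}_k\otimes\mathscr{H}_k$. 4. For every $u\in H^s$, $$Tu=\sum_{k=0}^\infty\frac{1}{k+1}\,R_kE_{k,k}u,$$ where the series converges in $H^{s+1}$. -/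

import Mathlib

open MeasureTheory Metric Quaternion
open scoped Manifold ContDiff InnerProductSpace

noncomputable section

namespace XiTransform

/-! ### The group of unit quaternions -/

instance factFinrankQuaternion : Fact (Module.finrank ℝ ℍ = 3 + 1) :=
  ⟨Quaternion.finrank_eq_four⟩

/-- The three-sphere, realised as the (compact Lie) group of unit quaternions. -/
abbrev S3 : Type := sphere (0 : ℍ) 1

instance measurableSpaceS3 : MeasurableSpace S3 := borel S3

instance borelSpaceS3 : BorelSpace S3 := ⟨rfl⟩

/-- The invariant probability measure on `S3` (the Haar measure giving mass one to `S3`). -/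
def haarS3 : Measure S3 := Measure.haarMeasure ⊤

instance isProbabilityMeasureHaarS3 : IsProbabilityMeasure haarS3 :=
  ⟨by simpa [haarS3] using Measure.haarMeasure_self (K₀ := (⊤ : TopologicalSpace.PositiveCompacts S3))⟩

/-- The compact manifold `S³ × S³`. -/
abbrev M : Type := S3 × S3

/-- The product of the two invariant probability measures. -/
def vol : Measure M := haarS3.prod haarS3

instance isProbabilityMeasureVol : IsProbabilityMeasure vol := by
  unfold vol; infer_instance

/-! ### Smooth functions -/

variable (𝕜 : Type*) [RCLike 𝕜]

/-- The space `C^∞(S³ × S³)` of smooth `𝕜`-valued functions. -/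
def Smooth : Submodule 𝕜 (M → 𝕜) where
  carrier := {f | ContMDiff ((𝓡 3).prod (𝓡 3)) 𝓘(ℝ, 𝕜) ∞ f}
  add_mem' hf hg := ContMDiff.add hf hg
  zero_mem' := contMDiff_const
  smul_mem' c _ hf := by
    have h : ContMDiff 𝓘(ℝ, 𝕜) 𝓘(ℝ, 𝕜) ∞ (fun z : 𝕜 => c * z) :=
      (contDiff_const.mul contDiff_id).contMDiff
    exact h.comp hf

variable {𝕜}

/-! ### The Laplace-Beltrami operator and the topology of `C^∞` -/

/-- The unit quaternions `exp (t e) = cos t + (sin t) e`, where `e` is `i`, `j` or `k`. -/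
def circ (a : Fin 3) (t : ℝ) : S3 :=
  ⟨⟨Real.cos t, if a = 0 then Real.sin t else 0, if a = 1 then Real.sin t else 0,
      if a = 2 then Real.sin t else 0⟩, by
    have h : ∀ q : ℍ, q.re ^ 2 + q.imI ^ 2 + q.imJ ^ 2 + q.imK ^ 2 = 1 →
        q ∈ sphere (0 : ℍ) 1 := fun q hq => by
      rw [← Quaternion.normSq_def', Quaternion.normSq_eq_norm_mul_self] at hq
      rw [mem_sphere_zero_iff_norm]
      nlinarith [norm_nonneg q]
    apply h
    have := Real.cos_sq_add_sin_sq t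
    fin_cases a <;> simp⟩

/-- Six one-parameter groups of isometries of `S³ × S³`: left multiplications on the first
factor, right multiplications on the second. -/
def flow : Fin 3 ⊕ Fin 3 → ℝ → M → M
  | .inl a, t, p => (circ a t * p.1, p.2)
  | .inr a, t, p => (p.1, p.2 * circ a t)

/-- Differentiation along the vector field that generates `flow a`. At each point the six fields
form an orthonormal basis of the tangent space for the product of the round metrics, and their
integral curves are unit speed geodesics. -/
def vf (a : Fin 3 ⊕ Fin 3) (f : M → 𝕜) (p : M) : 𝕜 :=
  deriv (fun t : ℝ => f (flow a t p)) 0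

/-- The Laplace-Beltrami operator `Δ_x + Δ_y` of `S³ × S³` (unit round spheres): the sum of the
second derivatives along six orthonormal geodesics. -/
def lap (f : M → 𝕜) (p : M) : 𝕜 := ∑ a, vf a (vf a f) p

/-- Iterated derivative along a word of vector fields. -/
def vfs (w : List (Fin 3 ⊕ Fin 3)) (f : M → 𝕜) : M → 𝕜 := w.foldr vf f

variable (𝕜)

/-- The space of distributions on `S³ × S³`: the linear functionals on `C^∞(S³ × S³)` that are
bounded by a multiple of some `C^N` norm, i.e. continuous for the topology of `C^∞`. -/
def Dist : Submodule 𝕜 (Smooth 𝕜 →ₗ[𝕜] 𝕜) where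
  carrier := {u | ∃ (N : ℕ) (C : ℝ), 0 ≤ C ∧ ∀ (φ : Smooth 𝕜) (B : ℝ),
    (∀ w : List (Fin 3 ⊕ Fin 3), w.length ≤ N → ∀ p, ‖vfs w φ.1 p‖ ≤ B) → ‖u φ‖ ≤ C * B}
  add_mem' := by
    rintro u v ⟨N, C, hC, hu⟩ ⟨N', C', hC', hv⟩
    refine ⟨max N N', C + C', by positivity, fun φ B hB => ?_⟩
    have h1 := hu φ B fun w hw => hB w (hw.trans (le_max_left _ _))
    have h2 := hv φ B fun w hw => hB w (hw.trans (le_max_right _ _))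
    calc ‖(u + v) φ‖ ≤ ‖u φ‖ + ‖v φ‖ := norm_add_le _ _
      _ ≤ (C + C') * B := by linarith
  zero_mem' := ⟨0, 0, le_rfl, fun φ B _ => by simp⟩
  smul_mem' := by
    rintro c u ⟨N, C, hC, hu⟩
    refine ⟨N, ‖c‖ * C, by positivity, fun φ B hB => ?_⟩
    rw [LinearMap.smul_apply, norm_smul, mul_assoc]
    exact mul_le_mul_of_nonneg_left (hu φ B hB) (norm_nonneg c)

/-! ### Sobolev spaces -/

theorem memLp_smooth (φ : Smooth 𝕜) : MemLp φ.1 2 vol := by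
  have hc : Continuous φ.1 := (show ContMDiff _ _ _ _ from φ.2).continuous
  exact hc.memLp_of_hasCompactSupport (HasCompactSupport.of_compactSpace _)

theorem integrable_mul_smooth (v : Lp 𝕜 2 vol) (φ : Smooth 𝕜) :
    Integrable (fun p => v p * φ.1 p) vol :=
  (Lp.memLp v).integrable_mul (memLp_smooth 𝕜 φ)

/-- Pairs of a distribution and a square integrable function. -/
def DistL2 : Type _ := Dist 𝕜 × Lp 𝕜 2 vol

instance instAddCommGroupDistL2 : AddCommGroup (DistL2 𝕜) :=
  inferInstanceAs (AddCommGroup (Dist 𝕜 × Lp 𝕜 2 vol))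

instance instModuleDistL2 : Module 𝕜 (DistL2 𝕜) :=
  inferInstanceAs (Module 𝕜 (Dist 𝕜 × Lp 𝕜 2 vol))

variable {𝕜} in
/-- The distribution component of a pair. -/
def DistL2.fst : DistL2 𝕜 →ₗ[𝕜] Dist 𝕜 := LinearMap.fst 𝕜 (Dist 𝕜) (Lp 𝕜 2 vol)

variable {𝕜} in
/-- The function component of a pair. -/
def DistL2.snd : DistL2 𝕜 →ₗ[𝕜] Lp 𝕜 2 vol := LinearMap.snd 𝕜 (Dist 𝕜) (Lp 𝕜 2 vol)

/-- The pairs `(u, v)` of a distribution `u` and `v ∈ L²(S³ × S³)` such that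
`(1 - Δ)^{s/2} u = v` in the weak sense: since `(1 - Δ)^{s/2}` is symmetric and multiplies an
eigenfunction `φ` with `Δ φ = -μ φ` by `(1 + μ)^{s/2}`, this says that
`(1 + μ)^{s/2} u(φ) = ∫ v φ` for all such `φ`. -/
def sobGraph (s : ℝ) : Submodule 𝕜 (DistL2 𝕜) where
  carrier := {w | ∀ (μ : ℝ) (φ : Smooth 𝕜), 0 ≤ μ → (∀ p, lap φ.1 p = -(μ : 𝕜) * φ.1 p) →
    (((1 + μ) ^ (s / 2) : ℝ) : 𝕜) * (DistL2.fst w).1 φ = ∫ p, DistL2.snd w p * φ.1 p ∂vol}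
  add_mem' := by
    intro w w' h h' μ φ hμ hφ
    have e : ∫ p, DistL2.snd (w + w') p * φ.1 p ∂vol
        = ∫ p, DistL2.snd w p * φ.1 p + DistL2.snd w' p * φ.1 p ∂vol := by
      rw [map_add]
      refine integral_congr_ae ?_
      filter_upwards [Lp.coeFn_add (DistL2.snd w) (DistL2.snd w')] with p hp
      rw [hp, Pi.add_apply, add_mul]
    rw [e, integral_add (integrable_mul_smooth 𝕜 _ _) (integrable_mul_smooth 𝕜 _ _),
      ← h μ φ hμ hφ, ← h' μ φ hμ hφ, map_add, Submodule.coe_add, LinearMap.add_apply, mul_add]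
  zero_mem' := by
    intro μ φ hμ hφ
    have e : ∫ p, DistL2.snd (0 : DistL2 𝕜) p * φ.1 p ∂vol = ∫ p, (0 : 𝕜) ∂vol := by
      rw [map_zero]
      refine integral_congr_ae ?_
      filter_upwards [Lp.coeFn_zero 𝕜 2 vol] with p hp
      rw [hp, Pi.zero_apply, zero_mul]
    rw [e, map_zero]
    simp
  smul_mem' := by
    intro c w h μ φ hμ hφ
    have e : ∫ p, DistL2.snd (c • w) p * φ.1 p ∂vol
        = ∫ p, c * (DistL2.snd w p * φ.1 p) ∂vol := by
      rw [map_smul]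
      refine integral_congr_ae ?_
      filter_upwards [Lp.coeFn_smul c (DistL2.snd w)] with p hp
      rw [hp, Pi.smul_apply, smul_eq_mul, mul_assoc]
    rw [e, integral_const_mul, ← h μ φ hμ hφ, map_smul, Submodule.coe_smul,
      LinearMap.smul_apply, smul_eq_mul, mul_left_comm]

/-- The Sobolev space `H^s(S³ × S³)`, for real `s`: the distributions `u` with
`(1 - Δ)^{s/2} u ∈ L²`. An element is recorded as the pair `(u, (1 - Δ)^{s/2} u)`. -/
def Sob (s : ℝ) : Type _ := sobGraph 𝕜 s

variable {𝕜}

instance Sob.instAddCommGroup (s : ℝ) : AddCommGroup (Sob 𝕜 s) :=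
  inferInstanceAs (AddCommGroup (sobGraph 𝕜 s))

instance Sob.instModule (s : ℝ) : Module 𝕜 (Sob 𝕜 s) :=
  inferInstanceAs (Module 𝕜 (sobGraph 𝕜 s))

/-- The underlying distribution of an element of `H^s`. -/
def Sob.dist {s : ℝ} : Sob 𝕜 s →ₗ[𝕜] Dist 𝕜 :=
  DistL2.fst.comp (sobGraph 𝕜 s).subtype

/-- The map `u ↦ (1 - Δ)^{s/2} u` from `H^s` to `L²`. -/
def Sob.bessel {s : ℝ} : Sob 𝕜 s →ₗ[𝕜] Lp 𝕜 2 vol :=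
  DistL2.snd.comp (sobGraph 𝕜 s).subtype

/-- The norm `‖u‖_s = ‖(1 - Δ)^{s/2} u‖_{L²}`. -/
instance Sob.instSeminormedAddCommGroup (s : ℝ) : SeminormedAddCommGroup (Sob 𝕜 s) :=
  SeminormedAddCommGroup.induced (Sob 𝕜 s) (Lp 𝕜 2 vol) Sob.bessel

/-- The inner product `⟪u, v⟫_s = ⟪(1 - Δ)^{s/2} u, (1 - Δ)^{s/2} v⟫_{L²}`. -/
instance Sob.instInnerProductSpace (s : ℝ) : InnerProductSpace 𝕜 (Sob 𝕜 s) where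
  norm_smul_le c u := by
    change ‖Sob.bessel (c • u)‖ ≤ ‖c‖ * ‖Sob.bessel u‖
    rw [map_smul, norm_smul]
  inner u v := ⟪Sob.bessel u, Sob.bessel v⟫_𝕜
  norm_sq_eq_re_inner u := norm_sq_eq_re_inner (𝕜 := 𝕜) (Sob.bessel u)
  conj_inner_symm u v := inner_conj_symm (𝕜 := 𝕜) (Sob.bessel u) (Sob.bessel v)
  add_left u v w := by
    rw [map_add, inner_add_left]
  smul_left u v c := by
    rw [map_smul, inner_smul_left]


/-! ### The operator `T` -/

theorem exists_local_proj (z₀ : ℍ) (h₀ : z₀ ≠ 0) :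
    ∃ N : ℍ → S3, ContMDiff 𝓘(ℝ, ℍ) (𝓡 3) ∞ N ∧ ∀ᶠ z in nhds z₀, (N z : ℍ) = ‖z‖⁻¹ • z := by
  have hn : 0 < ‖z₀‖ := norm_pos_iff.2 h₀
  let c : ContDiffBump z₀ := ⟨‖z₀‖ / 4, ‖z₀‖ / 2, by positivity, by linarith⟩
  let h : ℍ → ℍ := fun z => z₀ + c z • (z - z₀)
  have hh : ContDiff ℝ ∞ h := contDiff_const.add (c.contDiff.smul (contDiff_id.sub contDiff_const))
  have h0 : ∀ z, h z ≠ 0 := by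
    intro z hz
    have h1 : ‖c z • (z - z₀)‖ = ‖z₀‖ := by
      have : c z • (z - z₀) = -z₀ := by
        rw [eq_neg_iff_add_eq_zero, add_comm]; exact hz
      rw [this, norm_neg]
    by_cases hm : z ∈ ball z₀ (‖z₀‖ / 2)
    · have h2 : ‖c z • (z - z₀)‖ ≤ 1 * (‖z₀‖ / 2) := by
        rw [norm_smul]
        refine mul_le_mul ?_ (mem_ball_iff_norm.1 hm).le (norm_nonneg _) zero_le_one
        rw [Real.norm_of_nonneg c.nonneg]
        exact c.le_one
      linarith
    · have h2 : c z = 0 := by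
        by_contra h3
        exact hm (c.support_eq ▸ (Function.mem_support.2 h3))
      rw [h2, zero_smul, norm_zero] at h1
      linarith
  have hs : ContDiff ℝ ∞ (fun z => ‖h z‖⁻¹ • h z) :=
    ((hh.norm ℝ h0).inv (fun z => norm_ne_zero_iff.2 (h0 z))).smul hh
  have hmem : ∀ z, ‖h z‖⁻¹ • h z ∈ sphere (0 : ℍ) 1 := by
    intro z
    rw [mem_sphere_zero_iff_norm, norm_smul, norm_inv, norm_norm,
      inv_mul_cancel₀ (norm_ne_zero_iff.2 (h0 z))]
  refine ⟨fun z => ⟨_, hmem z⟩, hs.contMDiff.codRestrict_sphere hmem, ?_⟩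
  filter_upwards [c.eventuallyEq_one] with z hz
  have : h z = z := by simp [h, hz]
  simp only [this]

/-- A smooth function on `S³ × S³` is the restriction of a smooth function on the ambient space. -/
theorem exists_extension (f : Smooth 𝕜) :
    ∃ F : ℍ × ℍ → 𝕜, ContDiff ℝ ∞ F ∧ ∀ p : M, F (p.1, p.2) = f.1 p := by
  classical
  have hf : ContMDiff ((𝓡 3).prod (𝓡 3)) 𝓘(ℝ, 𝕜) ∞ f.1 := f.2
  let b : ContDiffBump (0 : ℍ) := ⟨1 / 4, 1 / 2, by norm_num, by norm_num⟩
  let χ : ℍ → ℝ := fun z => 1 - b z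
  have hχ : ContDiff ℝ ∞ χ := contDiff_const.sub b.contDiff
  have hχ0 : ∀ᶠ z in nhds (0 : ℍ), χ z = 0 := by
    filter_upwards [b.eventuallyEq_one] with z hz
    simp [χ, hz]
  have hχ1 : ∀ z : S3, χ z = 1 := by
    intro z
    have : b (z : ℍ) = 0 := by
      by_contra h
      have h2 : (z : ℍ) ∈ ball (0 : ℍ) (1 / 2) := b.support_eq ▸ (Function.mem_support.2 h)
      rw [mem_ball_zero_iff, norm_eq_of_mem_sphere z] at h2
      norm_num at h2
    simp [χ, this]
  let P : ℍ → S3 := fun z =>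
    if h : z = 0 then 1 else ⟨‖z‖⁻¹ • z, by
      rw [mem_sphere_zero_iff_norm, norm_smul, norm_inv, norm_norm,
        inv_mul_cancel₀ (norm_ne_zero_iff.2 h)]⟩
  have hP : ∀ z₀ : ℍ, z₀ ≠ 0 → ContMDiffAt 𝓘(ℝ, ℍ) (𝓡 3) ∞ P z₀ := by
    intro z₀ h₀
    obtain ⟨N, hN, hN'⟩ := exists_local_proj z₀ h₀
    refine hN.contMDiffAt.congr_of_eventuallyEq ?_
    filter_upwards [hN', isOpen_ne.mem_nhds h₀] with z hz hz0
    apply Subtype.ext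
    rw [hz]
    simp only [P]
    rw [dif_neg hz0]
  have hP1 : ∀ z : S3, P z = z := by
    intro z
    have hz : (z : ℍ) ≠ 0 := ne_zero_of_mem_unit_sphere z
    apply Subtype.ext
    simp only [P]
    rw [dif_neg hz]
    simp
  refine ⟨fun q => (χ q.1 * χ q.2) • f.1 (P q.1, P q.2), ?_, ?_⟩
  · rw [contDiff_iff_contDiffAt]
    rintro ⟨z, w⟩
    by_cases hz : z = 0
    · subst hz
      refine (contDiffAt_const (c := (0 : 𝕜))).congr_of_eventuallyEq ?_
      filter_upwards [continuousAt_fst.eventually hχ0] with q hq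
      simp [hq]
    by_cases hw : w = 0
    · subst hw
      refine (contDiffAt_const (c := (0 : 𝕜))).congr_of_eventuallyEq ?_
      filter_upwards [continuousAt_snd.eventually hχ0] with q hq
      simp [hq]
    · have h1 : ContDiffAt ℝ ∞ (fun q : ℍ × ℍ => χ q.1 * χ q.2) (z, w) :=
        ((hχ.comp contDiff_fst).mul (hχ.comp contDiff_snd)).contDiffAt
      refine h1.smul ?_
      rw [← contMDiffAt_iff_contDiffAt]
      have hPz : ContMDiffAt 𝓘(ℝ, ℍ × ℍ) (𝓡 3) ∞ (fun q : ℍ × ℍ => P q.1) (z, w) :=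
        ContMDiffAt.comp (z, w) (hP z hz) contDiff_fst.contMDiff.contMDiffAt
      have hPw : ContMDiffAt 𝓘(ℝ, ℍ × ℍ) (𝓡 3) ∞ (fun q : ℍ × ℍ => P q.2) (z, w) :=
        ContMDiffAt.comp (z, w) (hP w hw) contDiff_snd.contMDiff.contMDiffAt
      exact ContMDiffAt.comp (z, w) hf.contMDiffAt (hPz.prodMk hPw)
  · intro p
    simp [hχ1, hP1]

theorem contDiff_average (F : ℍ × ℍ → 𝕜) (hF : ContDiff ℝ ∞ F) :
    ContDiff ℝ ∞ (fun q : ℍ × ℍ => ∫ g : S3, F (q.1 * g, g * q.2) ∂haarS3) := by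
  borelize ℍ
  let b : ContDiffBump (0 : ℍ) := ⟨1, 2, by norm_num, by norm_num⟩
  let ν : Measure ℍ := haarS3.map (fun g : S3 => (g : ℍ))
  have hmeas : Measurable (fun g : S3 => (g : ℍ)) := continuous_subtype_val.measurable
  have : IsFiniteMeasure ν := by
    refine ⟨?_⟩
    rw [Measure.map_apply hmeas MeasurableSet.univ]
    exact measure_lt_top _ _
  let G : ℍ × ℍ → ℍ → 𝕜 := fun q x => b x • F (q.1 * (-x), (-x) * q.2)
  have hG : ContDiff ℝ ∞ (fun r : (ℍ × ℍ) × ℍ => G r.1 r.2) := by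
    have h1 : ContDiff ℝ ∞ (fun r : (ℍ × ℍ) × ℍ => b r.2) := b.contDiff.comp contDiff_snd
    have h2 : ContDiff ℝ ∞ (fun r : (ℍ × ℍ) × ℍ => (r.1.1 * (-r.2), (-r.2) * r.1.2)) := by
      fun_prop
    exact h1.smul (hF.comp h2)
  have key := contDiffOn_convolution_right_with_param (μ := ν) (f := fun _ : ℍ => (1 : ℝ))
    (n := ⊤) (ContinuousLinearMap.lsmul ℝ ℝ : ℝ →L[ℝ] 𝕜 →L[ℝ] 𝕜) (g := G) (s := Set.univ)
    (k := closedBall 0 2) isOpen_univ (isCompact_closedBall _ _)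
    (fun q x _ hx => by
      have : b x = 0 := by
        by_contra h
        exact hx (ball_subset_closedBall (b.support_eq ▸ (Function.mem_support.2 h)))
      simp [G, this])
    (integrable_const (1 : ℝ)).locallyIntegrable hG.contDiffOn
  rw [Set.univ_prod_univ, contDiffOn_univ] at key
  have h3 := key.comp (contDiff_prodMk_left (0 : ℍ) : ContDiff ℝ ∞ (fun q : ℍ × ℍ => (q, (0 : ℍ))))
  convert h3 using 1
  funext q
  change _ = ∫ t, (1 : ℝ) • G q (0 - t) ∂ν
  rw [integral_map hmeas.aemeasurable]
  · refine integral_congr_ae (Filter.Eventually.of_forall fun g => ?_)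
    have : b (0 - (g : ℍ)) = 1 := by
      apply b.one_of_mem_closedBall
      simp
      rfl
    simp only [G, this, one_smul]
    simp
  · refine Continuous.aestronglyMeasurable ?_
    have := hG.continuous
    fun_prop

variable (𝕜) in
/-- The operator `T f (x, y) = ∫ f (x g, g y) dg` on smooth functions. -/
def opT : Smooth 𝕜 →ₗ[𝕜] Smooth 𝕜 where
  toFun f := ⟨fun p => ∫ g : S3, f.1 (p.1 * g, g * p.2) ∂haarS3, by
    obtain ⟨F, hF, hFf⟩ := exists_extension f
    have h1 : ContMDiff ((𝓡 3).prod (𝓡 3)) 𝓘(ℝ, ℍ × ℍ) ∞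
        (fun p : M => ((p.1 : ℍ), (p.2 : ℍ))) :=
      (contMDiff_coe_sphere.comp contMDiff_fst).prodMk_space
        (contMDiff_coe_sphere.comp contMDiff_snd)
    have h2 := (contDiff_average F hF).contMDiff.comp h1
    refine h2.congr fun p => ?_
    refine integral_congr_ae (Filter.Eventually.of_forall fun g => ?_)
    exact (hFf (p.1 * g, g * p.2)).symm⟩
  map_add' f h := by
    apply Subtype.ext
    funext p
    have hi : ∀ f : Smooth 𝕜, Integrable (fun g : S3 => f.1 (p.1 * g, g * p.2)) haarS3 := by
      intro f
      have hc : Continuous f.1 := (show ContMDiff _ _ _ _ from f.2).continuous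
      have hc' : Continuous (fun g : S3 => f.1 (p.1 * g, g * p.2)) := by fun_prop
      exact hc'.integrable_of_hasCompactSupport (HasCompactSupport.of_compactSpace _)
    exact integral_add (hi f) (hi h)
  map_smul' c f := by
    apply Subtype.ext
    funext p
    exact integral_const_mul c _

/-! ### Spherical harmonics -/

variable (𝕜)

/-- The four Euclidean coordinates of a point of `S3`. -/
def coord (x : S3) : Fin 4 → 𝕜 :=
  ![((x : ℍ).re : 𝕜), ((x : ℍ).imI : 𝕜), ((x : ℍ).imJ : 𝕜), ((x : ℍ).imK : 𝕜)]

/-- The space `ℋ_k` of harmonic polynomials on `ℝ⁴` that are homogeneous of degree `k`. -/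
def harmonicPoly (k : ℕ) : Submodule 𝕜 (MvPolynomial (Fin 4) 𝕜) where
  carrier := {P | P.IsHomogeneous k ∧ ∑ i, MvPolynomial.pderiv i (MvPolynomial.pderiv i P) = 0}
  add_mem' hP hQ := ⟨hP.1.add hQ.1, by
    simp only [map_add, Finset.sum_add_distrib, hP.2, hQ.2, add_zero]⟩
  zero_mem' := ⟨MvPolynomial.isHomogeneous_zero _ _ _, by simp⟩
  smul_mem' c P hP := ⟨(MvPolynomial.homogeneousSubmodule (Fin 4) 𝕜 k).smul_mem c hP.1, by
    simp only [Derivation.map_smul, ← Finset.smul_sum, hP.2, smul_zero]⟩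

/-- The space `ℋ_k ⊗ ℋ_ℓ`, as a space of smooth functions on `S³ × S³`: it is spanned by the
functions `(x, y) ↦ P(x) Q(y)` with `P ∈ ℋ_k` and `Q ∈ ℋ_ℓ`. -/
def tensorHarm (k l : ℕ) : Submodule 𝕜 (Smooth 𝕜) :=
  Submodule.comap (Smooth 𝕜).subtype (Submodule.span 𝕜
    {f : M → 𝕜 | ∃ P ∈ harmonicPoly 𝕜 k, ∃ Q ∈ harmonicPoly 𝕜 l,
      f = fun p => MvPolynomial.eval (coord 𝕜 p.1) P * MvPolynomial.eval (coord 𝕜 p.2) Q})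

variable {𝕜}

/-- The `L²` inner product of smooth functions, with respect to the invariant probability
measure. -/
def innerL2 (f h : Smooth 𝕜) : 𝕜 := ∫ p, (starRingEnd 𝕜) (f.1 p) * h.1 p ∂vol

/-- `ι` is the natural inclusion of `C^∞` in `H^s`, which regards a function `f` as the
distribution `φ ↦ ∫ f φ`. -/
def IsInclusion {s : ℝ} (ι : Smooth 𝕜 →ₗ[𝕜] Sob 𝕜 s) : Prop :=
  ∀ f φ : Smooth 𝕜, (Sob.dist (ι f)).1 φ = ∫ p, f.1 p * φ.1 p ∂vol

/-- `S` is the operator `T` acting from `H^s` to `H^r` in the weak sense: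
`(T u)(φ) = u(T φ)` for all test functions `φ`. -/
def IsWeakT {s r : ℝ} (S : Sob 𝕜 s →L[𝕜] Sob 𝕜 r) : Prop :=
  ∀ (u : Sob 𝕜 s) (φ : Smooth 𝕜), (Sob.dist (S u)).1 φ = (Sob.dist u).1 (opT 𝕜 φ)

end XiTransform

end

/-!
Write `χ_k` for the Chebyshev polynomial `U_k` of the real part of a unit quaternion, the character
of the `(k+1)`-dimensional representation of `SU(2)`. Everything is derived from these functions;
no representation theory is used.

*Harmonics.* On `ℋ_k ⊗ ℋ_ℓ` the Laplacians of the two factors are the scalars `-k(k+2)` and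
`-ℓ(ℓ+2)` (`lapSide_inl_of_mem`, `lapSide_inr_of_mem`), and both are symmetric since the vector
fields `vf a` generate measure preserving flows (`innerL2_vfS`). Hence these spaces are pairwise
orthogonal in `L²`. The translates `χ_k(a⁻¹ x)` are zonal harmonics of degree `k` (`eval_zonal`),
and every polynomial in the real part is a combination of characters. So suitably normalised powers
of `((1 + Re x)/2) ((1 + Re y)/2)` form an approximate identity consisting of combinations of
products `χ_k ⊗ χ_ℓ`, and averaging with it over translations commutes with the fields `vf a`.
This shows that the sums of harmonics are dense in `C^∞` (`exists_harmonic_near`) and in `L²`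
(`dense_allHarm`), that `(k+1)(ℓ+1) χ_k(a⁻¹ x) χ_ℓ(b⁻¹ y)` is the reproducing kernel of
`ℋ_k ⊗ ℋ_ℓ` (`reproducing`), and that `ℋ_k ⊗ ℋ_ℓ` is the full joint eigenspace of the two
Laplacians (`mem_tensorHarm_of_lapSide`).

*The operator on harmonics.* `T` commutes with both Laplacians and therefore preserves every
`ℋ_k ⊗ ℋ_ℓ`. Its action is determined by that on the reproducing kernels. For `k ≠ ℓ` these are
sent to `0` by orthogonality. For `k = ℓ`, the identities
`∫ χ_k(a g) χ_k(b g) dg = χ_k(a b⁻¹)/(k+1)` and `∫ χ_k(x g y g⁻¹) dg = χ_k(x) χ_k(y)/(k+1)` show that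
`T² = (k+1)⁻²` on the kernels, and so on `ℋ_k ⊗ ℋ_k` (`opT_opT_of_mem`). As `T` is
symmetric (`inner_opT`), the operators `R_k = (k+1) T` are self-adjoint involutions.

*Sobolev spaces.* The map `(1 - Δ)^{s/2}` is an isometry of `H^s` onto `L²`: it is surjective since
its inverse can be written down (`distOf`), and injective since a distribution is determined by its
values on harmonics (`dist_eq_zero`). Under these isometries `T : H^s → H^{s+1}` becomes the
operator `∑ c_k R_k E_{k,k}` on `L²` with `c_k = (1 + 2k(k+2))^{1/2}/(k+1)`, which is bounded
because the `c_k` are, and has closed range because the `c_k⁻¹` are as well (`gain_le`, `gain_inv_le`). Kernel,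
image and the series can be read off from this form.
-/

noncomputable section

namespace XiTransform

variable {𝕜 : Type*} [RCLike 𝕜]

/-! ### Traces and conjugacy classes of unit quaternions -/

instance : haarS3.IsHaarMeasure := by unfold haarS3; infer_instance

instance : haarS3.IsMulRightInvariant := by
  -- a right translate of Haar measure is a left invariant probability measure
  refine ⟨fun g => ?_⟩
  have : IsProbabilityMeasure (Measure.map (· * g) haarS3) :=
    Measure.isProbabilityMeasure_map (by fun_prop)
  exact Measure.isHaarMeasure_eq_of_isProbabilityMeasure _ _

instance : haarS3.IsInvInvariant := by
  -- the image of Haar measure under inversion is left invariant, by right invariance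
  refine ⟨?_⟩
  have : IsProbabilityMeasure haarS3.inv := Measure.isProbabilityMeasure_map (by fun_prop)
  have h := Measure.haarMeasure_unique haarS3.inv (⊤ : TopologicalSpace.PositiveCompacts S3)
  have h1 : haarS3.inv ((⊤ : TopologicalSpace.PositiveCompacts S3) : Set S3) = 1 := by simp
  rw [h1, one_smul] at h
  exact h

instance : vol.IsOpenPosMeasure := by unfold vol; infer_instance

theorem S3.normSq_eq (x : S3) :
    (x : ℍ).re ^ 2 + (x : ℍ).imI ^ 2 + (x : ℍ).imJ ^ 2 + (x : ℍ).imK ^ 2 = 1 := by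
  rw [← Quaternion.normSq_def', Quaternion.normSq_eq_norm_mul_self,
    norm_eq_of_mem_sphere x, mul_one]

theorem S3.coe_inv (x : S3) : ((x⁻¹ : S3) : ℍ) = star (x : ℍ) := by
  have h : (x : ℍ) ≠ 0 := ne_zero_of_mem_unit_sphere x
  have h2 : ((x⁻¹ : S3) : ℍ) = (x : ℍ)⁻¹ := rfl
  rw [h2, Quaternion.instInv]
  simp [Quaternion.normSq_eq_norm_mul_self]

/-- The real part of a unit quaternion, which is half of its trace in `SU(2)`. -/
def re (x : S3) : ℝ := (x : ℍ).re

theorem continuous_re : Continuous re := by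
  unfold re
  have := Quaternion.continuous_re
  fun_prop

theorem re_mul_comm (x y : S3) : re (x * y) = re (y * x) := by
  simp only [re, Metric.unitSphere.coe_mul, Quaternion.re_mul]
  ring

theorem re_inv (x : S3) : re x⁻¹ = re x := by
  unfold re
  rw [S3.coe_inv, Quaternion.re_star]

theorem re_one : re 1 = 1 := by simp [re]

theorem re_le_one (x : S3) : re x ≤ 1 := by
  have := S3.normSq_eq x
  unfold re
  nlinarith [sq_nonneg (x : ℍ).imI, sq_nonneg (x : ℍ).imJ, sq_nonneg (x : ℍ).imK,
    sq_nonneg ((x : ℍ).re - 1)]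

theorem neg_one_le_re (x : S3) : -1 ≤ re x := by
  have := S3.normSq_eq x
  unfold re
  nlinarith [sq_nonneg (x : ℍ).imI, sq_nonneg (x : ℍ).imJ, sq_nonneg (x : ℍ).imK,
    sq_nonneg ((x : ℍ).re + 1)]

theorem eq_one_of_re {x : S3} (h : re x = 1) : x = 1 := by
  have h1 := S3.normSq_eq x
  unfold re at h
  rw [h] at h1
  apply Subtype.ext
  apply Quaternion.ext <;> simp <;>
    nlinarith [sq_nonneg (x : ℍ).imI, sq_nonneg (x : ℍ).imJ, sq_nonneg (x : ℍ).imK]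

/-- Two unit quaternions with the same real part are conjugate. -/
theorem exists_conj_of_re_eq {x y : S3} (h : re x = re y) : ∃ g : S3, y = g * x * g⁻¹ := by
  -- it suffices to find a nonzero quaternion `q` with `q x = y q`; the quaternion `y - star x` has
  -- this property because `x` and `y` satisfy the same quadratic equation
  suffices H : ∃ q : ℍ, q ≠ 0 ∧ q * x = y * q by
    obtain ⟨q, hq, e⟩ := H
    have hm : ‖q‖⁻¹ • q ∈ sphere (0 : ℍ) 1 := by
      rw [mem_sphere_zero_iff_norm, norm_smul, norm_inv, norm_norm,
        inv_mul_cancel₀ (norm_ne_zero_iff.2 hq)]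
    refine ⟨⟨_, hm⟩, ?_⟩
    rw [eq_mul_inv_iff_mul_eq]
    apply Subtype.ext
    simp [e]
  have hx := S3.normSq_eq x
  have hy := S3.normSq_eq y
  unfold re at h
  by_cases hv : (y : ℍ) - star (x : ℍ) = 0
  · -- here `y` is the conjugate of `x`, and any imaginary `q` orthogonal to `x` will do
    have hy' : (y : ℍ) = star (x : ℍ) := sub_eq_zero.1 hv
    rw [hy']
    by_cases h2 : (x : ℍ).imI = 0 ∧ (x : ℍ).imJ = 0
    · obtain ⟨q, h0, hi, hj, hk⟩ : ∃ q : ℍ, q.re = 0 ∧ q.imI = 1 ∧ q.imJ = 0 ∧ q.imK = 0 :=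
        ⟨⟨0, 1, 0, 0⟩, rfl, rfl, rfl, rfl⟩
      refine ⟨q, fun h => by simp [h] at hi, ?_⟩
      apply Quaternion.ext <;> simp [h2.1, h2.2, h0, hi, hj, hk]
    · obtain ⟨q, h0, hi, hj, hk⟩ :
          ∃ q : ℍ, q.re = 0 ∧ q.imI = -(x : ℍ).imJ ∧ q.imJ = (x : ℍ).imI ∧ q.imK = 0 :=
        ⟨⟨0, -(x : ℍ).imJ, (x : ℍ).imI, 0⟩, rfl, rfl, rfl, rfl⟩
      refine ⟨q, fun h => h2 ⟨?_, ?_⟩, ?_⟩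
      · rw [h] at hj; exact hj.symm
      · rw [h] at hi; simpa using hi.symm
      · apply Quaternion.ext <;> simp [h0, hi, hj, hk] <;> ring
  · refine ⟨_, hv, ?_⟩
    apply Quaternion.ext <;> simp [h] <;>
      first
      | ring1
      | linear_combination hy - hx + ((x : ℍ).re + (y : ℍ).re) * h

/-! ### Characters -/

/-- The character of the `(k+1)`-dimensional irreducible representation of `SU(2)`, which is the
Chebyshev polynomial of the second kind `U_k` of the real part. -/
def chi (k : ℕ) (x : S3) : ℝ := (Polynomial.Chebyshev.U ℝ (k : ℤ)).eval (re x)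

theorem continuous_chi (k : ℕ) : Continuous (chi k) :=
  (Polynomial.continuous _).comp continuous_re

@[simp] theorem chi_zero (x : S3) : chi 0 x = 1 := by simp [chi]

theorem chi_one (x : S3) : chi 1 x = 2 * re x := by simp [chi]

theorem chi_add_two (k : ℕ) (x : S3) : chi (k + 2) x = 2 * re x * chi (k + 1) x - chi k x := by
  simp [chi, Polynomial.Chebyshev.U_add_two]

theorem chi_apply_one (k : ℕ) : chi k 1 = k + 1 := by
  simp [chi, re_one]

theorem chi_mul_comm (k : ℕ) (x y : S3) : chi k (x * y) = chi k (y * x) := by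
  rw [chi, re_mul_comm]; rfl

theorem chi_inv (k : ℕ) (x : S3) : chi k x⁻¹ = chi k x := by
  rw [chi, re_inv]; rfl

theorem re_mul_chi_mem (k : ℕ) :
    (fun x => re x * chi k x) ∈ Submodule.span ℝ (Set.range chi) := by
  have hm : ∀ k, chi k ∈ Submodule.span ℝ (Set.range chi) :=
    fun k => Submodule.subset_span ⟨k, rfl⟩
  cases k with
  | zero =>
    have e : (fun x => re x * chi 0 x) = (1 / 2 : ℝ) • chi 1 := by
      funext x; simp [chi_one]
    rw [e]; exact Submodule.smul_mem _ _ (hm 1)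
  | succ k =>
    have e : (fun x => re x * chi (k + 1) x) = (1 / 2 : ℝ) • (chi (k + 2) + chi k) := by
      funext x; simp [chi_add_two]; ring
    rw [e]; exact Submodule.smul_mem _ _ (Submodule.add_mem _ (hm _) (hm _))

/-- Every polynomial in the real part is a linear combination of characters. -/
theorem eval_re_mem_span_chi (q : Polynomial ℝ) :
    (fun x => q.eval (re x)) ∈ Submodule.span ℝ (Set.range chi) := by
  have hX : ∀ f ∈ Submodule.span ℝ (Set.range chi),
      (fun x => re x * f x) ∈ Submodule.span ℝ (Set.range chi) := by
    intro f hf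
    induction hf using Submodule.span_induction with
    | mem f hf => obtain ⟨k, rfl⟩ := hf; exact re_mul_chi_mem k
    | zero =>
      convert Submodule.zero_mem _ using 1
      funext x; simp
    | add f g _ _ hf hg =>
      convert Submodule.add_mem _ hf hg using 1
      funext x; simp [mul_add]
    | smul c f _ hf =>
      convert Submodule.smul_mem _ c hf using 1
      funext x; simp; ring
  have hn : ∀ n : ℕ, (fun x => re x ^ n) ∈ Submodule.span ℝ (Set.range chi) := by
    intro n
    induction n with
    | zero =>
      have e : (fun x => re x ^ 0) = chi 0 := by funext x; simp
      rw [e]; exact Submodule.subset_span ⟨0, rfl⟩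
    | succ n ih =>
      convert hX _ ih using 1
      funext x; ring
  induction q using Polynomial.induction_on' with
  | add p q hp hq =>
    convert Submodule.add_mem _ hp hq using 1
    funext x; simp
  | monomial n a =>
    convert Submodule.smul_mem _ a (hn n) using 1
    funext x; simp

/-! ### Vector fields on smooth functions -/

theorem smooth_continuous (f : Smooth 𝕜) : Continuous f.1 :=
  (show ContMDiff _ _ _ _ from f.2).continuous

/-- The quaternion `i`, `j` or `k`. -/
def unitIm (a : Fin 3) : ℍ :=
  ⟨0, if a = 0 then 1 else 0, if a = 1 then 1 else 0, if a = 2 then 1 else 0⟩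

@[simp] theorem unitIm_re (a : Fin 3) : (unitIm a).re = 0 := rfl
@[simp] theorem unitIm_imI (a : Fin 3) : (unitIm a).imI = if a = 0 then 1 else 0 := rfl
@[simp] theorem unitIm_imJ (a : Fin 3) : (unitIm a).imJ = if a = 1 then 1 else 0 := rfl
@[simp] theorem unitIm_imK (a : Fin 3) : (unitIm a).imK = if a = 2 then 1 else 0 := rfl

theorem coe_circ (a : Fin 3) (t : ℝ) :
    (circ a t : ℍ) = (Real.cos t : ℝ) • (1 : ℍ) + (Real.sin t : ℝ) • unitIm a := by
  have h0 : (circ a t : ℍ).re = Real.cos t := rfl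
  have h1 : (circ a t : ℍ).imI = if a = 0 then Real.sin t else 0 := rfl
  have h2 : (circ a t : ℍ).imJ = if a = 1 then Real.sin t else 0 := rfl
  have h3 : (circ a t : ℍ).imK = if a = 2 then Real.sin t else 0 := rfl
  apply Quaternion.ext <;> simp [h0, h1, h2, h3]

theorem unitIm_mul_self (a : Fin 3) : unitIm a * unitIm a = -1 := by
  apply Quaternion.ext <;> fin_cases a <;> simp

theorem circ_add (a : Fin 3) (s t : ℝ) : circ a (s + t) = circ a s * circ a t := by
  apply Subtype.ext
  rw [Metric.unitSphere.coe_mul]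
  simp only [coe_circ, Real.cos_add, Real.sin_add, add_mul, mul_add, smul_mul_assoc,
    mul_smul_comm, one_mul, mul_one, unitIm_mul_self]
  module

theorem circ_zero (a : Fin 3) : circ a 0 = 1 := by
  apply Subtype.ext
  rw [coe_circ]; simp

theorem hasDerivAt_circ (a : Fin 3) : HasDerivAt (fun t => (circ a t : ℍ)) (unitIm a) 0 := by
  have h := ((Real.hasDerivAt_cos 0).smul_const (1 : ℍ)).add
    ((Real.hasDerivAt_sin 0).smul_const (unitIm a))
  simp only [Real.sin_zero, Real.cos_zero, neg_zero, zero_smul, one_smul, zero_add] at h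
  exact h.congr_of_eventuallyEq (Filter.Eventually.of_forall fun t => coe_circ a t)

theorem flow_add (a : Fin 3 ⊕ Fin 3) (s t : ℝ) (p : M) :
    flow a (s + t) p = flow a s (flow a t p) := by
  rcases a with a | a
  · simp only [flow, circ_add, mul_assoc]
  · simp only [flow, add_comm s t, circ_add, mul_assoc]

theorem flow_zero (a : Fin 3 ⊕ Fin 3) (p : M) : flow a 0 p = p := by
  rcases a with a | a <;> simp [flow, circ_zero]

/-- The velocity at `p` of the curve `t ↦ flow a t p`, as a vector of the ambient space. -/
def flowVec : Fin 3 ⊕ Fin 3 → ℍ × ℍ → ℍ × ℍ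
  | .inl a, p => (unitIm a * p.1, 0)
  | .inr a, p => (0, p.2 * unitIm a)

theorem hasDerivAt_flow (a : Fin 3 ⊕ Fin 3) (p : M) :
    HasDerivAt (fun t => (((flow a t p).1 : ℍ), ((flow a t p).2 : ℍ)))
      (flowVec a (p.1, p.2)) 0 := by
  rcases a with a | a
  · exact ((hasDerivAt_circ a).mul_const (p.1 : ℍ)).prodMk (hasDerivAt_const 0 (p.2 : ℍ))
  · exact (hasDerivAt_const 0 (p.1 : ℍ)).prodMk ((hasDerivAt_circ a).const_mul (p.2 : ℍ))

theorem hasDerivAt_comp_flow {F : ℍ × ℍ → 𝕜} {p : M} (hF : DifferentiableAt ℝ F (p.1, p.2))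
    (a : Fin 3 ⊕ Fin 3) :
    HasDerivAt (fun t => F ((flow a t p).1, (flow a t p).2))
      (fderiv ℝ F (p.1, p.2) (flowVec a (p.1, p.2))) 0 := by
  have h := hasDerivAt_flow a p
  have h2 : HasFDerivAt F (fderiv ℝ F (p.1, p.2))
      ((((flow a 0 p).1 : ℍ), ((flow a 0 p).2 : ℍ))) := by
    rw [flow_zero]; exact hF.hasFDerivAt
  exact h2.comp_hasDerivAt (0 : ℝ) h

theorem contMDiff_coe_prod : ContMDiff ((𝓡 3).prod (𝓡 3)) 𝓘(ℝ, ℍ × ℍ) ∞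
    (fun p : M => ((p.1 : ℍ), (p.2 : ℍ))) :=
  (contMDiff_coe_sphere.comp contMDiff_fst).prodMk_space
    (contMDiff_coe_sphere.comp contMDiff_snd)

/-- The restriction of a smooth function on the ambient space. -/
def Smooth.ofAmbient (F : ℍ × ℍ → 𝕜) (hF : ContDiff ℝ ∞ F) : Smooth 𝕜 :=
  ⟨fun p => F (p.1, p.2), hF.contMDiff.comp contMDiff_coe_prod⟩

theorem contDiff_flowVec (a : Fin 3 ⊕ Fin 3) : ContDiff ℝ ∞ (flowVec a) := by
  rcases a with a | a
  · exact (contDiff_const.mul contDiff_fst).prodMk contDiff_const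
  · exact contDiff_const.prodMk (contDiff_snd.mul contDiff_const)

theorem vf_mem (a : Fin 3 ⊕ Fin 3) (f : Smooth 𝕜) : vf a f.1 ∈ Smooth 𝕜 := by
  obtain ⟨F, hF, hFf⟩ := exists_extension f
  have h1 : ContDiff ℝ ∞ (fun q => fderiv ℝ F q (flowVec a q)) :=
    (hF.fderiv_right (m := ∞) (by simp)).clm_apply (contDiff_flowVec a)
  convert (Smooth.ofAmbient _ h1).2 using 1
  funext p
  have h2 := hasDerivAt_comp_flow (p := p) (hF.differentiable (by simp)).differentiableAt a
  simp only [hFf] at h2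
  exact h2.deriv

theorem hasDerivAt_flow_zero (a : Fin 3 ⊕ Fin 3) (f : Smooth 𝕜) (p : M) :
    HasDerivAt (fun t => f.1 (flow a t p)) (vf a f.1 p) 0 := by
  obtain ⟨F, hF, hFf⟩ := exists_extension f
  have h2 := hasDerivAt_comp_flow (p := p) (hF.differentiable (by simp)).differentiableAt a
  simp only [hFf] at h2
  exact h2.differentiableAt.hasDerivAt

theorem hasDerivAt_flow_apply (a : Fin 3 ⊕ Fin 3) (f : Smooth 𝕜) (p : M) (t : ℝ) :
    HasDerivAt (fun t => f.1 (flow a t p)) (vf a f.1 (flow a t p)) t := by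
  have h := hasDerivAt_flow_zero a f (flow a t p)
  have h2 : HasDerivAt (fun s => f.1 (flow a (s - t) (flow a t p))) (vf a f.1 (flow a t p)) t := by
    have := HasDerivAt.comp_sub_const (f := fun s => f.1 (flow a s (flow a t p))) t t
      (by simpa using h)
    exact this
  refine h2.congr_of_eventuallyEq (Filter.Eventually.of_forall fun s => ?_)
  change f.1 (flow a s p) = _
  beta_reduce
  rw [← flow_add, sub_add_cancel]

/-- Differentiation along `flow a`, as an operator on smooth functions. -/
def vfS (a : Fin 3 ⊕ Fin 3) : Smooth 𝕜 →ₗ[𝕜] Smooth 𝕜 where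
  toFun f := ⟨vf a f.1, vf_mem a f⟩
  map_add' f g := by
    apply Subtype.ext
    funext p
    exact ((hasDerivAt_flow_zero a f p).add (hasDerivAt_flow_zero a g p)).deriv
  map_smul' c f := by
    apply Subtype.ext
    funext p
    exact ((hasDerivAt_flow_zero a f p).const_mul c).deriv

@[simp] theorem vfS_coe (a : Fin 3 ⊕ Fin 3) (f : Smooth 𝕜) : (vfS a f).1 = vf a f.1 := rfl

/-- The product of two smooth functions. -/
def smoothMul (f g : Smooth 𝕜) : Smooth 𝕜 := ⟨fun p => f.1 p * g.1 p, by
  obtain ⟨F, hF, hFf⟩ := exists_extension f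
  obtain ⟨G, hG, hGg⟩ := exists_extension g
  convert (Smooth.ofAmbient _ (hF.mul hG)).2 using 1
  funext p
  simp [Smooth.ofAmbient, hFf, hGg]⟩

/-- The complex conjugate of a smooth function. -/
def smoothConj (f : Smooth 𝕜) : Smooth 𝕜 := ⟨fun p => (starRingEnd 𝕜) (f.1 p), by
  obtain ⟨F, hF, hFf⟩ := exists_extension f
  convert (Smooth.ofAmbient _ ((RCLike.conjCLE (K := 𝕜)).contDiff.comp hF)).2 using 1
  funext p
  simp [Smooth.ofAmbient, hFf]⟩

theorem vfS_mul (a : Fin 3 ⊕ Fin 3) (f g : Smooth 𝕜) :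
    vfS a (smoothMul f g) = smoothMul (vfS a f) g + smoothMul f (vfS a g) := by
  apply Subtype.ext
  funext p
  have h := ((hasDerivAt_flow_zero a f p).mul (hasDerivAt_flow_zero a g p)).deriv
  simp only [flow_zero] at h
  exact h

theorem vfS_conj (a : Fin 3 ⊕ Fin 3) (f : Smooth 𝕜) :
    vfS a (smoothConj f) = smoothConj (vfS a f) := by
  apply Subtype.ext
  funext p
  exact ((RCLike.conjCLE (K := 𝕜)).hasFDerivAt.comp_hasDerivAt (0 : ℝ)
    (hasDerivAt_flow_zero a f p)).deriv

theorem smooth_integrable (f : Smooth 𝕜) : Integrable f.1 vol :=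
  (smooth_continuous f).integrable_of_hasCompactSupport (HasCompactSupport.of_compactSpace _)

/-- The flows commute with translations from the other side. -/
theorem flow_translate (a : Fin 3 ⊕ Fin 3) (t : ℝ) (p q : M) :
    ((flow a t p).1 * q.1, q.2 * (flow a t p).2) = flow a t (p.1 * q.1, q.2 * p.2) := by
  rcases a with a | a <;> simp [flow, mul_assoc]

/-- Differentiation along the flows commutes with averaging over translations. -/
theorem hasDerivAt_average {Ω : Type*} [TopologicalSpace Ω] [CompactSpace Ω]
    [SecondCountableTopology Ω] [MeasurableSpace Ω]
    [BorelSpace Ω] (m : Measure Ω) [IsFiniteMeasure m] {ρ : Ω → 𝕜} (hρ : Continuous ρ)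
    {τ : Ω → M} (hτ : Continuous τ) (f : Smooth 𝕜) (a : Fin 3 ⊕ Fin 3) (p : M) (t : ℝ) :
    HasDerivAt (fun t => ∫ q, ρ q * f.1 (flow a t (p.1 * (τ q).1, (τ q).2 * p.2)) ∂m)
      (∫ q, ρ q * vf a f.1 (flow a t (p.1 * (τ q).1, (τ q).2 * p.2)) ∂m) t := by
  have hf := (smooth_continuous f)
  have hv : Continuous (vf a f.1) := smooth_continuous (vfS a f)
  have hfl : ∀ t, Continuous fun q => flow a t (p.1 * (τ q).1, (τ q).2 * p.2) := by
    intro t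
    rcases a with a | a <;> simp only [flow] <;> fun_prop
  obtain ⟨C, hC⟩ := (isCompact_range hv).isBounded.exists_norm_le
  obtain ⟨D, hD⟩ := (isCompact_range hρ).isBounded.exists_norm_le
  have hint : ∀ g : Ω → 𝕜, Continuous g → Integrable g m := fun g hg =>
    hg.integrable_of_hasCompactSupport (HasCompactSupport.of_compactSpace _)
  refine (hasDerivAt_integral_of_dominated_loc_of_deriv_le (bound := fun _ => D * C)
    (s := Set.univ) Filter.univ_mem
    (F := fun t q => ρ q * f.1 (flow a t (p.1 * (τ q).1, (τ q).2 * p.2)))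
    (F' := fun t q => ρ q * vf a f.1 (flow a t (p.1 * (τ q).1, (τ q).2 * p.2)))
    ?_ ?_ ?_ ?_ ?_ ?_).2
  · exact Filter.Eventually.of_forall fun s =>
      (hint _ (hρ.mul (hf.comp (hfl s)))).aestronglyMeasurable
  · exact hint _ (hρ.mul (hf.comp (hfl t)))
  · exact (hint _ (hρ.mul (hv.comp (hfl t)))).aestronglyMeasurable
  · refine Filter.Eventually.of_forall fun q s _ => ?_
    rw [norm_mul]
    exact mul_le_mul (hD _ ⟨q, rfl⟩) (hC _ ⟨_, rfl⟩) (norm_nonneg _)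
      ((norm_nonneg _).trans (hD _ ⟨q, rfl⟩))
  · exact integrable_const _
  · exact Filter.Eventually.of_forall fun q s _ => (hasDerivAt_flow_apply a f _ s).const_mul _

/-- The fields `vf a`, which come from left translations in `x` and right translations in `y`,
commute with averages over right translations in `x` and left translations in `y`. This applies to
convolutions as well as to `T`. -/
theorem vf_average {Ω : Type*} [TopologicalSpace Ω] [CompactSpace Ω]
    [SecondCountableTopology Ω] [MeasurableSpace Ω]
    [BorelSpace Ω] (m : Measure Ω) [IsFiniteMeasure m] {ρ : Ω → 𝕜} (hρ : Continuous ρ)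
    {τ : Ω → M} (hτ : Continuous τ) (f : Smooth 𝕜) (a : Fin 3 ⊕ Fin 3) (p : M) :
    vf a (fun p => ∫ q, ρ q * f.1 (p.1 * (τ q).1, (τ q).2 * p.2) ∂m) p
      = ∫ q, ρ q * vf a f.1 (p.1 * (τ q).1, (τ q).2 * p.2) ∂m := by
  have h := (hasDerivAt_average m hρ hτ f a p 0).deriv
  simp only [flow_zero] at h
  rw [← h, vf]
  simp only [flow_translate]

theorem continuous_flow (a : Fin 3 ⊕ Fin 3) (t : ℝ) : Continuous (flow a t) := by
  rcases a with a | a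
  · exact (continuous_const.mul continuous_fst).prodMk continuous_snd
  · exact continuous_fst.prodMk (continuous_snd.mul continuous_const)

theorem measurePreserving_flow (a : Fin 3 ⊕ Fin 3) (t : ℝ) :
    MeasurePreserving (flow a t) vol vol := by
  rcases a with a | a
  · exact (measurePreserving_mul_left haarS3 (circ a t)).prod (MeasurePreserving.id haarS3)
  · exact (MeasurePreserving.id haarS3).prod (measurePreserving_mul_right haarS3 (circ a t))

/-- The divergence of `vf a` vanishes, because its flow preserves the measure. -/
theorem integral_vf (a : Fin 3 ⊕ Fin 3) (f : Smooth 𝕜) : ∫ p, vf a f.1 p ∂vol = 0 := by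
  have h := hasDerivAt_average vol (ρ := fun _ => (1 : 𝕜)) continuous_const
    (τ := fun q : M => q) continuous_id f a 1 0
  simp only [flow_zero, Prod.fst_one, Prod.snd_one, one_mul, mul_one] at h
  have h2 : (fun t => ∫ q : M, f.1 (flow a t (q.1, q.2)) ∂vol) = fun _ => ∫ q, f.1 q ∂vol := by
    funext t
    have := integral_map (μ := vol) (continuous_flow a t).aemeasurable (f := f.1)
      (by rw [(measurePreserving_flow a t).map_eq]
          exact (smooth_integrable f).aestronglyMeasurable)
    rw [(measurePreserving_flow a t).map_eq] at this
    exact this.symm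
  rw [h2] at h
  exact h.unique (hasDerivAt_const _ _)

/-- The fields `vf a` are antisymmetric for the `L²` inner product. -/
theorem innerL2_vfS (a : Fin 3 ⊕ Fin 3) (f g : Smooth 𝕜) :
    innerL2 (vfS a f) g = -innerL2 f (vfS a g) := by
  have h := integral_vf a (smoothMul (smoothConj f) g)
  have h2 : vf a (smoothMul (smoothConj f) g).1
      = fun p => (smoothMul (smoothConj (vfS a f)) g).1 p +
        (smoothMul (smoothConj f) (vfS a g)).1 p := by
    rw [← vfS_coe, vfS_mul, vfS_conj]; rfl
  rw [h2, integral_add (smooth_integrable _) (smooth_integrable _)] at h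
  exact eq_neg_of_add_eq_zero_left h

section Polynomials

open MvPolynomial (pderiv X C)

/-! ### The Laplacian of harmonic polynomials -/

theorem pderiv_comm (i j : Fin 4) (P : MvPolynomial (Fin 4) 𝕜) :
    pderiv i (pderiv j P) = pderiv j (pderiv i P) := by
  have h : ⁅(pderiv i : Derivation 𝕜 (MvPolynomial (Fin 4) 𝕜) (MvPolynomial (Fin 4) 𝕜)),
      (pderiv j : Derivation 𝕜 (MvPolynomial (Fin 4) 𝕜) (MvPolynomial (Fin 4) 𝕜))⁆ = 0 := by
    apply MvPolynomial.derivation_ext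
    intro k
    rw [Derivation.commutator_apply]
    simp only [MvPolynomial.pderiv_X, Pi.single_apply]
    split_ifs <;> simp
  have h2 := congrArg (fun D => D P) h
  simp only [Derivation.commutator_apply, Derivation.zero_apply] at h2
  exact sub_eq_zero.1 h2

/-- The Euclidean Laplacian on polynomials. -/
def polyLap (P : MvPolynomial (Fin 4) 𝕜) : MvPolynomial (Fin 4) 𝕜 :=
  ∑ i, pderiv i (pderiv i P)

/-- The linear vector field with components `ℓ`. -/
def polyField (ℓ : Fin 4 → MvPolynomial (Fin 4) 𝕜) (P : MvPolynomial (Fin 4) 𝕜) :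
    MvPolynomial (Fin 4) 𝕜 :=
  ∑ i, ℓ i * pderiv i P

/-- The components of the linear vector fields `x ↦ i x`, `x ↦ j x`, `x ↦ k x` on `ℍ = ℝ⁴`. -/
def leftField : Fin 3 → Fin 4 → MvPolynomial (Fin 4) 𝕜 :=
  ![![-X 1, X 0, -X 3, X 2], ![-X 2, X 3, X 0, -X 1], ![-X 3, -X 2, X 1, X 0]]

/-- The components of the linear vector fields `x ↦ x i`, `x ↦ x j`, `x ↦ x k` on `ℍ = ℝ⁴`. -/
def rightField : Fin 3 → Fin 4 → MvPolynomial (Fin 4) 𝕜 :=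
  ![![-X 1, X 0, X 3, -X 2], ![-X 2, -X 3, X 0, X 1], ![-X 3, X 2, -X 1, X 0]]

/-- The polar decomposition of the Laplacian, in the frame of left translates of the position
vector. -/
theorem sum_leftField (P : MvPolynomial (Fin 4) 𝕜) :
    ∑ a, polyField (leftField a) (polyField (leftField a) P)
      = (∑ i, X i ^ 2) * polyLap P - ∑ i, X i * pderiv i (∑ j, X j * pderiv j P)
        - 2 * ∑ i, X i * pderiv i P := by
  simp only [polyField, leftField, polyLap, Fin.sum_univ_four, Fin.sum_univ_three,
    Matrix.cons_val, map_add, map_neg, Derivation.leibniz, MvPolynomial.pderiv_X,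
    Pi.single_apply, smul_eq_mul]
  simp only [pderiv_comm 1 0, pderiv_comm 2 0, pderiv_comm 3 0, pderiv_comm 2 1, pderiv_comm 3 1,
    pderiv_comm 3 2, Fin.reduceEq, if_true, if_false]
  ring

theorem sum_rightField (P : MvPolynomial (Fin 4) 𝕜) :
    ∑ a, polyField (rightField a) (polyField (rightField a) P)
      = (∑ i, X i ^ 2) * polyLap P - ∑ i, X i * pderiv i (∑ j, X j * pderiv j P)
        - 2 * ∑ i, X i * pderiv i P := by
  simp only [polyField, rightField, polyLap, Fin.sum_univ_four, Fin.sum_univ_three,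
    Matrix.cons_val, map_add, map_neg, Derivation.leibniz, MvPolynomial.pderiv_X,
    Pi.single_apply, smul_eq_mul]
  simp only [pderiv_comm 1 0, pderiv_comm 2 0, pderiv_comm 3 0, pderiv_comm 2 1, pderiv_comm 3 1,
    pderiv_comm 3 2, Fin.reduceEq, if_true, if_false]
  ring

theorem sum_X_mul_pderiv_harmonic {k : ℕ} {P : MvPolynomial (Fin 4) 𝕜}
    (hP : P ∈ harmonicPoly 𝕜 k) : ∑ i, X i * pderiv i P = k * P := by
  rw [MvPolynomial.IsHomogeneous.sum_X_mul_pderiv hP.1, nsmul_eq_mul]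

/-- The eigenvalue of the spherical Laplacian on harmonics of degree `k`, up to sign. -/
def eig (k : ℕ) : ℝ := k * (k + 2)

/-- The right hand side of the polar decomposition of the Laplacian, on harmonic polynomials. -/
theorem polar_harmonic {k : ℕ} {P : MvPolynomial (Fin 4) 𝕜} (hP : P ∈ harmonicPoly 𝕜 k) :
    (∑ i, X i ^ 2) * polyLap P - ∑ i, X i * pderiv i (∑ j, X j * pderiv j P)
        - 2 * ∑ i, X i * pderiv i P = (-(eig k : ℝ) : 𝕜) • P := by
  have h0 : polyLap P = 0 := hP.2
  have h1 : ∀ i : Fin 4, pderiv i ((k : MvPolynomial (Fin 4) 𝕜) * P) = k * pderiv i P := by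
    intro i
    rw [Derivation.leibniz, Derivation.map_natCast]
    simp
  have h2 : ∑ i : Fin 4,
      (X i : MvPolynomial (Fin 4) 𝕜) * ((k : MvPolynomial (Fin 4) 𝕜) * pderiv i P) =
      k * ∑ i, X i * pderiv i P := by
    rw [Finset.mul_sum]
    exact Finset.sum_congr rfl fun i _ => by ring
  simp only [h0, sum_X_mul_pderiv_harmonic hP, h1, h2]
  rw [MvPolynomial.smul_eq_C_mul]
  simp only [eig]
  push_cast
  simp only [map_neg, map_mul, map_add, map_natCast, map_ofNat]
  ring

theorem sum_leftField_harmonic {k : ℕ} {P : MvPolynomial (Fin 4) 𝕜} (hP : P ∈ harmonicPoly 𝕜 k) :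
    ∑ a, polyField (leftField a) (polyField (leftField a) P) = (-(eig k : ℝ) : 𝕜) • P := by
  rw [sum_leftField, polar_harmonic hP]

theorem sum_rightField_harmonic {k : ℕ} {P : MvPolynomial (Fin 4) 𝕜} (hP : P ∈ harmonicPoly 𝕜 k) :
    ∑ a, polyField (rightField a) (polyField (rightField a) P) = (-(eig k : ℝ) : 𝕜) • P := by
  rw [sum_rightField, polar_harmonic hP]

/-! ### Zonal harmonics -/

/-- The linear form with coefficients `v`. -/
def linForm (v : Fin 4 → 𝕜) : MvPolynomial (Fin 4) 𝕜 := ∑ i, C (v i) * X i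

/-- The zonal harmonic polynomial of degree `k` with pole `v`: the homogeneous form of the
Chebyshev polynomial `U_k`. -/
def zonal (v : Fin 4 → 𝕜) : ℕ → MvPolynomial (Fin 4) 𝕜
  | 0 => 1
  | 1 => 2 * linForm v
  | k + 2 => 2 * linForm v * zonal v (k + 1) - (∑ i, X i ^ 2) * zonal v k

theorem pderiv_linForm (v : Fin 4 → 𝕜) (i : Fin 4) : pderiv i (linForm v) = C (v i) := by
  simp [linForm, MvPolynomial.pderiv_X, Pi.single_apply]

theorem pderiv_sq (i : Fin 4) : pderiv i (∑ j, X j ^ 2 : MvPolynomial (Fin 4) 𝕜) = 2 * X i := by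
  simp [Derivation.leibniz_pow, MvPolynomial.pderiv_X, Pi.single_apply]

theorem pderiv_two (i : Fin 4) : pderiv i (2 : MvPolynomial (Fin 4) 𝕜) = 0 := by
  simpa using Derivation.map_natCast (pderiv (R := 𝕜) i) 2

theorem isHomogeneous_linForm (v : Fin 4 → 𝕜) : (linForm v).IsHomogeneous 1 :=
  MvPolynomial.IsHomogeneous.sum _ _ _ fun i _ => by
    simpa using (MvPolynomial.isHomogeneous_C (Fin 4) (v i)).mul (MvPolynomial.isHomogeneous_X 𝕜 i)

theorem isHomogeneous_two_linForm (v : Fin 4 → 𝕜) : (2 * linForm v).IsHomogeneous 1 := by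
  have h := (MvPolynomial.isHomogeneous_C (Fin 4) (2 : 𝕜)).mul (isHomogeneous_linForm v)
  rw [zero_add] at h
  exact h

theorem isHomogeneous_sq : (∑ i, X i ^ 2 : MvPolynomial (Fin 4) 𝕜).IsHomogeneous 2 :=
  MvPolynomial.IsHomogeneous.sum _ _ _ fun i _ => MvPolynomial.isHomogeneous_X_pow i 2

theorem isHomogeneous_zonal (v : Fin 4 → 𝕜) : ∀ k, (zonal v k).IsHomogeneous k
  | 0 => MvPolynomial.isHomogeneous_one _ _
  | 1 => isHomogeneous_two_linForm v
  | k + 2 => by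
    have h1 := (isHomogeneous_two_linForm v).mul (isHomogeneous_zonal v (k + 1))
    have h2 := (isHomogeneous_sq (𝕜 := 𝕜)).mul (isHomogeneous_zonal v k)
    rw [show 1 + (k + 1) = k + 2 by ring] at h1
    rw [add_comm] at h2
    exact h1.sub h2

theorem sum_C_mul_C {v : Fin 4 → 𝕜} (hv : ∑ i, v i ^ 2 = 1) :
    ∑ i, C (v i) * C (v i) = (1 : MvPolynomial (Fin 4) 𝕜) := by
  simp only [← C.map_mul, ← map_sum, ← sq, hv, map_one]

/-- The derivative of a zonal harmonic in the direction of its pole is a multiple of the preceding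
zonal harmonic. -/
theorem deriv_zonal {v : Fin 4 → 𝕜} (hv : ∑ i, v i ^ 2 = 1) :
    ∀ k : ℕ, ∑ i, C (v i) * pderiv i (zonal v (k + 1)) = (k + 2) * zonal v k
  | 0 => by
    have hv' := sum_C_mul_C hv
    have : ∀ i, C (v i) * pderiv i (2 * linForm v) = 2 * (C (v i) * C (v i)) := by
      intro i
      simp only [Derivation.leibniz, pderiv_two, pderiv_linForm, smul_eq_mul]
      ring
    simp only [zonal, this, ← Finset.mul_sum, hv']
    norm_num
  | 1 => by
    have hv' := sum_C_mul_C hv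
    have h : ∀ i, C (v i) * pderiv i (zonal v 2)
        = 8 * linForm v * (C (v i) * C (v i)) - 2 * (C (v i) * X i) := by
      intro i
      simp only [zonal, map_sub, Derivation.leibniz, pderiv_two, pderiv_linForm, smul_eq_mul,
        pderiv_sq, MvPolynomial.pderiv_one]
      ring
    simp only [Nat.reduceAdd, h, Finset.sum_sub_distrib, ← Finset.mul_sum, hv']
    rw [← linForm]
    simp only [zonal]
    push_cast
    ring
  | k + 2 => by
    have hv' := sum_C_mul_C hv
    have h : ∀ i, C (v i) * pderiv i (zonal v (k + 2 + 1))
        = 2 * zonal v (k + 2) * (C (v i) * C (v i))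
          + 2 * linForm v * (C (v i) * pderiv i (zonal v (k + 1 + 1)))
          - 2 * zonal v (k + 1) * (C (v i) * X i)
          - (∑ i, X i ^ 2) * (C (v i) * pderiv i (zonal v (k + 1))) := by
      intro i
      rw [zonal]
      simp only [map_sub, Derivation.leibniz, pderiv_two, pderiv_linForm, smul_eq_mul,
        pderiv_sq]
      ring
    simp only [h, Finset.sum_sub_distrib, Finset.sum_add_distrib, ← Finset.mul_sum, hv',
      deriv_zonal hv k, deriv_zonal hv (k + 1)]
    rw [← linForm, zonal]
    push_cast
    ring

theorem polyLap_zonal {v : Fin 4 → 𝕜} (hv : ∑ i, v i ^ 2 = 1) :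
    ∀ k : ℕ, polyLap (zonal v k) = 0
  | 0 => by simp [polyLap, zonal]
  | 1 => by simp [polyLap, zonal, Derivation.leibniz, pderiv_two, pderiv_linForm]
  | k + 2 => by
    have h : ∀ i, pderiv i (pderiv i (zonal v (k + 2)))
        = 4 * (C (v i) * pderiv i (zonal v (k + 1)))
          + 2 * linForm v * pderiv i (pderiv i (zonal v (k + 1)))
          - 4 * (X i * pderiv i (zonal v k))
          - (∑ i, X i ^ 2) * pderiv i (pderiv i (zonal v k)) - 2 * zonal v k := by
      intro i
      rw [zonal]
      simp only [map_sub, map_add, Derivation.leibniz, pderiv_two, pderiv_linForm, smul_eq_mul,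
        pderiv_sq, MvPolynomial.pderiv_C, map_zero, MvPolynomial.pderiv_X_self]
      ring
    have h1 : ∑ i, pderiv i (pderiv i (zonal v (k + 1))) = 0 := polyLap_zonal hv (k + 1)
    have h2 : ∑ i, pderiv i (pderiv i (zonal v k)) = 0 := polyLap_zonal hv k
    simp only [polyLap, h, Finset.sum_sub_distrib, Finset.sum_add_distrib, ← Finset.mul_sum, h1, h2,
      deriv_zonal hv k, (isHomogeneous_zonal v k).sum_X_mul_pderiv]
    simp only [Finset.sum_const, Finset.card_univ, Fintype.card_fin, nsmul_eq_mul, mul_zero]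
    push_cast
    ring

theorem zonal_mem {v : Fin 4 → 𝕜} (hv : ∑ i, v i ^ 2 = 1) (k : ℕ) :
    zonal v k ∈ harmonicPoly 𝕜 k :=
  ⟨isHomogeneous_zonal v k, polyLap_zonal hv k⟩

theorem sum_coord_sq (x : S3) : ∑ i, coord 𝕜 x i ^ 2 = 1 := by
  have h := S3.normSq_eq x
  simp only [Fin.sum_univ_four, coord, Matrix.cons_val]
  exact_mod_cast congrArg (fun r : ℝ => (r : 𝕜)) h

theorem sum_coord_mul (a x : S3) : ∑ i, coord 𝕜 a i * coord 𝕜 x i = (re (a⁻¹ * x) : ℝ) := by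
  have h : re (a⁻¹ * x) = (a : ℍ).re * (x : ℍ).re + (a : ℍ).imI * (x : ℍ).imI
      + (a : ℍ).imJ * (x : ℍ).imJ + (a : ℍ).imK * (x : ℍ).imK := by
    unfold re
    rw [Metric.unitSphere.coe_mul, S3.coe_inv, Quaternion.re_mul]
    simp
  rw [h]
  simp only [Fin.sum_univ_four, coord, Matrix.cons_val]
  push_cast
  ring

/-- On the sphere, the zonal harmonic with pole `a` is a translate of the character. -/
theorem eval_zonal (a x : S3) : ∀ k : ℕ,
    MvPolynomial.eval (coord 𝕜 x) (zonal (coord 𝕜 a) k) = (chi k (a⁻¹ * x) : ℝ)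
  | 0 => by simp [zonal]
  | 1 => by
    simp only [zonal, linForm, chi_one, map_mul, map_sum, MvPolynomial.eval_X,
      MvPolynomial.eval_C, sum_coord_mul, map_ofNat]
  | k + 2 => by
    rw [zonal, chi_add_two]
    simp only [map_sub, map_mul, map_sum, map_pow, MvPolynomial.eval_X, sum_coord_sq,
      eval_zonal a x k, eval_zonal a x (k + 1), linForm, MvPolynomial.eval_C, sum_coord_mul,
      map_ofNat]
    norm_num

/-! ### Products of harmonic polynomials as smooth functions -/

variable (𝕜) in
/-- The Euclidean coordinates of a quaternion, as real-linear maps. -/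
def coordL : Fin 4 → ℍ →L[ℝ] 𝕜 := fun i =>
  (RCLike.ofRealCLM (K := 𝕜)).comp ((EuclideanSpace.proj i).comp
    (Quaternion.linearIsometryEquivTuple : ℍ →L[ℝ] EuclideanSpace ℝ (Fin 4)))

theorem coordL_apply (q : ℍ) :
    (fun i => coordL 𝕜 i q) = ![(q.re : 𝕜), (q.imI : 𝕜), (q.imJ : 𝕜), (q.imK : 𝕜)] := by
  funext i
  fin_cases i <;> rfl

theorem coordL_coe (x : S3) : (fun i => coordL 𝕜 i x) = coord 𝕜 x := coordL_apply _

/-- The chain rule for polynomials along curves of quaternions. -/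
theorem hasDerivAt_eval (P : MvPolynomial (Fin 4) 𝕜) {c : ℝ → ℍ} {c' : ℍ} {t : ℝ}
    (h : HasDerivAt c c' t) :
    HasDerivAt (fun t => MvPolynomial.eval (fun i => coordL 𝕜 i (c t)) P)
      (∑ i, coordL 𝕜 i c' * MvPolynomial.eval (fun i => coordL 𝕜 i (c t)) (pderiv i P)) t := by
  induction P using MvPolynomial.induction_on with
  | C a => simpa using hasDerivAt_const t a
  | add P Q hP hQ =>
    simp only [map_add, mul_add, Finset.sum_add_distrib]
    exact hP.add hQ
  | mul_X P j hP =>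
    have hj : HasDerivAt (fun t => coordL 𝕜 j (c t)) (coordL 𝕜 j c') t :=
      (coordL 𝕜 j).hasFDerivAt.comp_hasDerivAt t h
    have := hP.mul hj
    refine (this.congr_deriv ?_).congr_of_eventuallyEq (Filter.Eventually.of_forall fun t => ?_)
    swap
    · simp
    simp only [Derivation.leibniz, MvPolynomial.pderiv_X, Pi.single_apply, smul_eq_mul, map_add,
      map_mul, MvPolynomial.eval_X, mul_add, Finset.sum_add_distrib, Finset.sum_mul]
    rw [add_comm]
    congr 1
    · simp [apply_ite, mul_comm]
    · exact Finset.sum_congr rfl fun i _ => by ring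

theorem contDiff_eval (P : MvPolynomial (Fin 4) 𝕜) :
    ContDiff ℝ ∞ (fun q : ℍ => MvPolynomial.eval (fun i => coordL 𝕜 i q) P) := by
  induction P using MvPolynomial.induction_on with
  | C a => simpa using contDiff_const
  | add P Q hP hQ => simpa using hP.add hQ
  | mul_X P j hP => simpa using hP.mul (coordL 𝕜 j).contDiff

/-- The smooth function `(x, y) ↦ P(x) Q(y)` on `S³ × S³`, for polynomials `P` and `Q`. -/
def polyProd : MvPolynomial (Fin 4) 𝕜 →ₗ[𝕜] MvPolynomial (Fin 4) 𝕜 →ₗ[𝕜] Smooth 𝕜 :=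
  LinearMap.mk₂ 𝕜 (fun P Q => ⟨fun p => MvPolynomial.eval (coord 𝕜 p.1) P *
      MvPolynomial.eval (coord 𝕜 p.2) Q, by
        have h := ((contDiff_eval P).comp contDiff_fst).mul ((contDiff_eval Q).comp contDiff_snd)
        simp only [← coordL_coe]
        exact (Smooth.ofAmbient _ h).2⟩)
    (fun P P' Q => Subtype.ext (by funext p; simp [add_mul]))
    (fun c P Q => Subtype.ext (by funext p; simp [mul_assoc]))
    (fun P Q Q' => Subtype.ext (by funext p; simp [mul_add]))
    (fun c P Q => Subtype.ext (by funext p; simp [mul_left_comm]))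

theorem polyProd_apply (P Q : MvPolynomial (Fin 4) 𝕜) (p : M) : (polyProd P Q).1 p
    = MvPolynomial.eval (coord 𝕜 p.1) P * MvPolynomial.eval (coord 𝕜 p.2) Q := rfl

/-- The space `ℋ_k ⊗ ℋ_ℓ` as the image of a bilinear map, which makes `Submodule.map₂` available. -/
theorem tensorHarm_eq_map₂ (k l : ℕ) :
    tensorHarm 𝕜 k l = Submodule.map₂ polyProd (harmonicPoly 𝕜 k) (harmonicPoly 𝕜 l) := by
  have hinj : Function.Injective (Smooth 𝕜).subtype := Subtype.val_injective
  rw [← Submodule.comap_map_eq_of_injective hinj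
    (Submodule.map₂ polyProd (harmonicPoly 𝕜 k) (harmonicPoly 𝕜 l)), tensorHarm]
  congr 1
  rw [Submodule.map₂_eq_span_image2, Submodule.map_span]
  congr 1
  ext f
  constructor
  · rintro ⟨P, hP, Q, hQ, rfl⟩
    exact ⟨polyProd P Q, ⟨P, hP, Q, hQ, rfl⟩, rfl⟩
  · rintro ⟨_, ⟨P, hP, Q, hQ, rfl⟩, rfl⟩
    exact ⟨P, hP, Q, hQ, rfl⟩

theorem polyProd_mem {k l : ℕ} {P Q : MvPolynomial (Fin 4) 𝕜} (hP : P ∈ harmonicPoly 𝕜 k)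
    (hQ : Q ∈ harmonicPoly 𝕜 l) : polyProd P Q ∈ tensorHarm 𝕜 k l := by
  rw [tensorHarm_eq_map₂]
  exact Submodule.apply_mem_map₂ _ hP hQ

theorem tensorHarm_le {k l : ℕ} {S : Submodule 𝕜 (Smooth 𝕜)}
    (h : ∀ P ∈ harmonicPoly 𝕜 k, ∀ Q ∈ harmonicPoly 𝕜 l, polyProd P Q ∈ S) :
    tensorHarm 𝕜 k l ≤ S := by
  rw [tensorHarm_eq_map₂]
  exact Submodule.map₂_le.2 h

/-- Homogeneous polynomials of degree `k` lie in the finite-dimensional space of polynomials of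
total degree at most `k`. -/
theorem finite_harmonicPoly (k : ℕ) : (harmonicPoly 𝕜 k).FG := by
  have h : harmonicPoly 𝕜 k ≤ MvPolynomial.restrictTotalDegree (Fin 4) 𝕜 k := fun P hP =>
    (MvPolynomial.mem_restrictTotalDegree _ _ _).2 hP.1.totalDegree_le
  have := Submodule.finiteDimensional_of_le h
  exact Module.Finite.iff_fg.1 this

instance finite_tensorHarm (k l : ℕ) : FiniteDimensional 𝕜 (tensorHarm 𝕜 k l) := by
  rw [tensorHarm_eq_map₂]
  exact Module.Finite.iff_fg.2 ((finite_harmonicPoly k).map₂ _ (finite_harmonicPoly l))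

/-! ### The Laplacians of the two factors -/

theorem eval_polyField {ℓ : Fin 4 → MvPolynomial (Fin 4) 𝕜} {x : S3} {q : ℍ}
    (h : ∀ i, MvPolynomial.eval (coord 𝕜 x) (ℓ i) = coordL 𝕜 i q) (P : MvPolynomial (Fin 4) 𝕜) :
    ∑ i, coordL 𝕜 i q * MvPolynomial.eval (coord 𝕜 x) (pderiv i P)
      = MvPolynomial.eval (coord 𝕜 x) (polyField ℓ P) := by
  simp [polyField, h]

theorem eval_leftField (a : Fin 3) (x : S3) (i : Fin 4) :
    MvPolynomial.eval (coord 𝕜 x) (leftField a i) = coordL 𝕜 i (unitIm a * x) := by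
  rw [show coordL 𝕜 i (unitIm a * x) = (fun i => coordL 𝕜 i (unitIm a * x)) i from rfl,
    coordL_apply]
  fin_cases a <;> fin_cases i <;> simp [leftField, coord]

theorem eval_rightField (a : Fin 3) (x : S3) (i : Fin 4) :
    MvPolynomial.eval (coord 𝕜 x) (rightField a i) = coordL 𝕜 i (x * unitIm a) := by
  rw [show coordL 𝕜 i (x * unitIm a) = (fun i => coordL 𝕜 i (x * unitIm a)) i from rfl,
    coordL_apply]
  fin_cases a <;> fin_cases i <;> simp [rightField, coord]

theorem vfS_inl_polyProd (a : Fin 3) (P Q : MvPolynomial (Fin 4) 𝕜) :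
    vfS (.inl a) (polyProd P Q) = polyProd (polyField (leftField a) P) Q := by
  apply Subtype.ext
  funext p
  have h := (hasDerivAt_eval P ((hasDerivAt_circ a).mul_const (p.1 : ℍ))).mul_const
    (MvPolynomial.eval (coord 𝕜 p.2) Q)
  simp only [← Metric.unitSphere.coe_mul, circ_zero, Metric.unitSphere.coe_one, one_mul, coordL_coe,
    eval_polyField (eval_leftField a p.1)] at h
  exact h.deriv

theorem vfS_inr_polyProd (a : Fin 3) (P Q : MvPolynomial (Fin 4) 𝕜) :
    vfS (.inr a) (polyProd P Q) = polyProd P (polyField (rightField a) Q) := by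
  apply Subtype.ext
  funext p
  have h := (hasDerivAt_eval Q ((hasDerivAt_circ a).const_mul (p.2 : ℍ))).const_mul
    (MvPolynomial.eval (coord 𝕜 p.1) P)
  simp only [← Metric.unitSphere.coe_mul, circ_zero, Metric.unitSphere.coe_one, mul_one, coordL_coe,
    eval_polyField (eval_rightField a p.2)] at h
  exact h.deriv

/-- The Laplacian in one of the two variables: the sum of the squares of the three fields
`vf (s a)`, where `s` is one of the two injections `Fin 3 → Fin 3 ⊕ Fin 3`. -/
def lapSide (s : Fin 3 → Fin 3 ⊕ Fin 3) : Smooth 𝕜 →ₗ[𝕜] Smooth 𝕜 :=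
  ∑ a, vfS (s a) ∘ₗ vfS (s a)

theorem lap_eq (f : Smooth 𝕜) :
    lap f.1 = (lapSide Sum.inl f + lapSide Sum.inr f).1 := by
  funext p
  simp [lap, lapSide]

theorem lapSide_inl_of_mem {k l : ℕ} {f : Smooth 𝕜} (hf : f ∈ tensorHarm 𝕜 k l) :
    lapSide Sum.inl f = (-(eig k : ℝ) : 𝕜) • f := by
  have h : tensorHarm 𝕜 k l
      ≤ LinearMap.ker (lapSide Sum.inl - (-(eig k : ℝ) : 𝕜) • LinearMap.id) := by
    refine tensorHarm_le fun P hP Q hQ => ?_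
    rw [LinearMap.mem_ker, LinearMap.sub_apply, sub_eq_zero]
    simp only [lapSide, LinearMap.sum_apply, LinearMap.comp_apply, vfS_inl_polyProd]
    rw [← LinearMap.sum_apply, ← map_sum, sum_leftField_harmonic hP]
    simp
  exact sub_eq_zero.1 (h hf)

theorem lapSide_inr_of_mem {k l : ℕ} {f : Smooth 𝕜} (hf : f ∈ tensorHarm 𝕜 k l) :
    lapSide Sum.inr f = (-(eig l : ℝ) : 𝕜) • f := by
  have h : tensorHarm 𝕜 k l
      ≤ LinearMap.ker (lapSide Sum.inr - (-(eig l : ℝ) : 𝕜) • LinearMap.id) := by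
    refine tensorHarm_le fun P hP Q hQ => ?_
    rw [LinearMap.mem_ker, LinearMap.sub_apply, sub_eq_zero]
    simp only [lapSide, LinearMap.sum_apply, LinearMap.comp_apply, vfS_inr_polyProd]
    rw [← map_sum, sum_rightField_harmonic hQ]
    simp
  exact sub_eq_zero.1 (h hf)

end Polynomials

/-! ### Square integrable functions -/

/-- The inclusion of `C^∞` in `L²`. -/
def toL2 : Smooth 𝕜 →ₗ[𝕜] Lp 𝕜 2 vol where
  toFun f := (memLp_smooth 𝕜 f).toLp f.1
  map_add' _ _ := rfl
  map_smul' _ _ := rfl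

theorem coeFn_toL2 (f : Smooth 𝕜) : toL2 f =ᵐ[vol] f.1 :=
  (memLp_smooth 𝕜 f).coeFn_toLp

theorem inner_toL2 (f : Smooth 𝕜) (w : Lp 𝕜 2 vol) :
    ⟪toL2 f, w⟫_𝕜 = ∫ p, w p * (starRingEnd 𝕜) (f.1 p) ∂vol := by
  rw [L2.inner_def]
  refine integral_congr_ae ?_
  filter_upwards [coeFn_toL2 f] with p hp
  rw [hp, RCLike.inner_apply]

theorem inner_toL2_toL2 (f g : Smooth 𝕜) : ⟪toL2 f, toL2 g⟫_𝕜 = innerL2 f g := by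
  rw [inner_toL2]
  refine integral_congr_ae ?_
  filter_upwards [coeFn_toL2 g] with p hp
  rw [hp, mul_comm]

theorem integral_mul_smooth (w : Lp 𝕜 2 vol) (φ : Smooth 𝕜) :
    ∫ p, w p * φ.1 p ∂vol = ⟪toL2 (smoothConj φ), w⟫_𝕜 := by
  rw [inner_toL2]
  simp [smoothConj]

theorem toL2_injective : Function.Injective (toL2 (𝕜 := 𝕜)) := by
  intro f g h
  have h1 : f.1 =ᵐ[vol] g.1 := (coeFn_toL2 f).symm.trans (h ▸ coeFn_toL2 g)
  exact Subtype.ext ((smooth_continuous f).ae_eq_iff_eq vol (smooth_continuous g) |>.1 h1)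

theorem norm_toL2_le (f : Smooth 𝕜) {B : ℝ} (hB : ∀ p, ‖f.1 p‖ ≤ B) : ‖toL2 f‖ ≤ B := by
  have h0 : 0 ≤ B := (norm_nonneg _).trans (hB 1)
  have h := Lp.norm_le_of_ae_bound (f := toL2 f) (p := 2) h0 (by
    filter_upwards [coeFn_toL2 f] with p hp
    rw [hp]; exact hB p)
  simpa [measureUnivNNReal] using h

theorem inner_lapSide (s : Fin 3 → Fin 3 ⊕ Fin 3) (f g : Smooth 𝕜) :
    ⟪toL2 (lapSide s f), toL2 g⟫_𝕜 = ⟪toL2 f, toL2 (lapSide s g)⟫_𝕜 := by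
  simp only [lapSide, LinearMap.sum_apply, LinearMap.comp_apply, map_sum, sum_inner, inner_sum]
  refine Finset.sum_congr rfl fun a _ => ?_
  rw [inner_toL2_toL2, inner_toL2_toL2, innerL2_vfS, innerL2_vfS, neg_neg]

/-- Eigenfunctions of a symmetric operator with different eigenvalues are orthogonal. -/
theorem inner_eq_zero_of_eigen {A : Smooth 𝕜 →ₗ[𝕜] Smooth 𝕜}
    (hA : ∀ f g, ⟪toL2 (A f), toL2 g⟫_𝕜 = ⟪toL2 f, toL2 (A g)⟫_𝕜) {f g : Smooth 𝕜} {μ ν : ℝ}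
    (hf : A f = (-(μ : ℝ) : 𝕜) • f) (hg : A g = (-(ν : ℝ) : 𝕜) • g) (h : μ ≠ ν) :
    ⟪toL2 f, toL2 g⟫_𝕜 = 0 := by
  have e := hA f g
  rw [hf, hg, map_smul, map_smul, inner_smul_left, inner_smul_right, map_neg,
    RCLike.conj_ofReal] at e
  have e2 : ((μ - ν : ℝ) : 𝕜) * ⟪toL2 f, toL2 g⟫_𝕜 = 0 := by
    push_cast
    linear_combination -e
  rcases mul_eq_zero.1 e2 with h3 | h3
  · exact absurd (sub_eq_zero.1 (RCLike.ofReal_eq_zero.1 h3)) h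
  · exact h3

theorem eig_injective : Function.Injective eig := by
  intro k l h
  simp only [eig] at h
  have h2 : ((k : ℝ) - l) * (k + l + 2) = 0 := by linear_combination h
  rcases mul_eq_zero.1 h2 with h3 | h3
  · exact_mod_cast sub_eq_zero.1 h3
  · have : (0 : ℝ) < k + l + 2 := by positivity
    exact absurd h3 this.ne'

theorem eig_nonneg (k : ℕ) : 0 ≤ eig k := by unfold eig; positivity

/-- A smooth function with the joint eigenvalues of `ℋ_k ⊗ ℋ_ℓ`, not yet known to lie in that space,
is orthogonal to all other `ℋ_k' ⊗ ℋ_ℓ'`. -/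
theorem inner_eq_zero_of_lapSide {f g : Smooth 𝕜} {k l k' l' : ℕ}
    (hf : lapSide Sum.inl f = (-(eig k : ℝ) : 𝕜) • f)
    (hf' : lapSide Sum.inr f = (-(eig l : ℝ) : 𝕜) • f)
    (hg : g ∈ tensorHarm 𝕜 k' l') (h : (k, l) ≠ (k', l')) :
    ⟪toL2 f, toL2 g⟫_𝕜 = 0 := by
  by_cases hk : k = k'
  · have hl : l ≠ l' := fun hl => h (by rw [hk, hl])
    exact inner_eq_zero_of_eigen (inner_lapSide _) hf' (lapSide_inr_of_mem hg)
      (eig_injective.ne hl)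
  · exact inner_eq_zero_of_eigen (inner_lapSide _) hf (lapSide_inl_of_mem hg)
      (eig_injective.ne hk)

theorem inner_tensorHarm {f g : Smooth 𝕜} {k l k' l' : ℕ}
    (hf : f ∈ tensorHarm 𝕜 k l) (hg : g ∈ tensorHarm 𝕜 k' l') (h : (k, l) ≠ (k', l')) :
    ⟪toL2 f, toL2 g⟫_𝕜 = 0 :=
  inner_eq_zero_of_lapSide (lapSide_inl_of_mem hf) (lapSide_inr_of_mem hf) hg h

/-! ### Orthogonality relations for the characters -/

/-- The reproducing kernel of `ℋ_k ⊗ ℋ_ℓ` at the point `a`, up to the factor `(k+1)(ℓ+1)`: the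
function `(x, y) ↦ χ_k(a₁⁻¹ x) χ_ℓ(a₂⁻¹ y)`. -/
def kerS (k l : ℕ) (a : M) : Smooth 𝕜 :=
  polyProd (zonal (coord 𝕜 a.1) k) (zonal (coord 𝕜 a.2) l)

theorem kerS_apply (k l : ℕ) (a p : M) :
    (kerS k l a : Smooth 𝕜).1 p = ((chi k (a.1⁻¹ * p.1) * chi l (a.2⁻¹ * p.2) : ℝ) : 𝕜) := by
  rw [kerS, polyProd_apply, eval_zonal, eval_zonal, RCLike.ofReal_mul]

theorem kerS_mem (k l : ℕ) (a : M) : (kerS k l a : Smooth 𝕜) ∈ tensorHarm 𝕜 k l :=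
  polyProd_mem (zonal_mem (sum_coord_sq _) _) (zonal_mem (sum_coord_sq _) _)

theorem integrable_S3 {E : Type*} [NormedAddCommGroup E] {f : S3 → E} (hf : Continuous f) :
    Integrable f haarS3 :=
  hf.integrable_of_hasCompactSupport (HasCompactSupport.of_compactSpace _)

theorem integrable_M {E : Type*} [NormedAddCommGroup E] {f : M → E} (hf : Continuous f) :
    Integrable f vol :=
  hf.integrable_of_hasCompactSupport (HasCompactSupport.of_compactSpace _)

theorem integral_chi_mul_chi_of_ne {k l : ℕ} (h : k ≠ l) (a b : S3) :
    ∫ x, chi k (a * x) * chi l (b * x) ∂haarS3 = 0 := by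
  have h1 := inner_tensorHarm (kerS_mem (𝕜 := ℝ) k 0 (a⁻¹, 1)) (kerS_mem l 0 (b⁻¹, 1))
    (by simpa using h)
  rw [inner_toL2_toL2, innerL2] at h1
  simp only [kerS_apply, chi_zero, mul_one, inv_inv] at h1
  have h2 := integral_fun_fst (μ := haarS3) (ν := haarS3)
    (fun x : S3 => chi k (a * x) * chi l (b * x))
  simp only [probReal_univ, one_smul] at h2
  rw [← h2]
  exact h1

/-- The characters are normalised in `L²`, by induction with the three-term recursion. -/
theorem integral_chi_sq (k : ℕ) : ∫ x, chi k x * chi k x ∂haarS3 = 1 := by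
  have hc := continuous_chi
  have ho : ∀ {k l : ℕ}, k ≠ l → ∫ x, chi k x * chi l x ∂haarS3 = 0 := fun {k l} h => by
    simpa using integral_chi_mul_chi_of_ne h 1 1
  have hi : ∀ k l, Integrable (fun x => chi k x * chi l x) haarS3 := fun k l =>
    integrable_S3 ((hc k).mul (hc l))
  induction k with
  | zero => simp
  | succ k ih =>
    -- both norms equal the integral of `χ_1 χ_k χ_{k+1}`
    have h1 : ∫ x, 2 * re x * chi k x * chi (k + 1) x ∂haarS3 = 1 := by
      have e : ∀ x, 2 * re x * chi k x * chi (k + 1) x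
          = chi k x * chi (k + 2) x + chi k x * chi k x := fun x => by
        rw [chi_add_two]; ring
      simp only [e]
      rw [integral_add (hi _ _) (hi _ _), ih, ho (by omega), zero_add]
    rw [← h1]
    cases k with
    | zero => simp [chi_one]
    | succ k =>
      have e : ∀ x, 2 * re x * chi (k + 1) x * chi (k + 1 + 1) x
          = chi (k + 2) x * chi (k + 2) x + chi k x * chi (k + 2) x := fun x => by
        rw [chi_add_two]; ring
      simp only [e]
      rw [integral_add (hi _ _) (hi _ _), ho (by omega : k ≠ k + 2), add_zero]

/-! ### Averages over translations -/

/-- The average of `f` over translations from the inner side, with weight `ρ`. -/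
def conv (ρ : M → ℝ) (f : M → 𝕜) (p : M) : 𝕜 :=
  ∫ q, (ρ q : 𝕜) * f (p.1 * q.1, q.2 * p.2) ∂vol

theorem integral_translate {E : Type*} [NormedAddCommGroup E] [NormedSpace ℝ E] (a b : S3)
    {f : M → E} (hf : Continuous f) : ∫ q : M, f (a * q.1, q.2 * b) ∂vol = ∫ q, f q ∂vol := by
  have h : MeasurePreserving (fun q : M => (a * q.1, q.2 * b)) vol vol :=
    (measurePreserving_mul_left haarS3 a).prod (measurePreserving_mul_right haarS3 b)
  have h2 := integral_map (μ := vol) h.measurable.aemeasurable (f := f)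
    (by rw [h.map_eq]; exact (integrable_M hf).aestronglyMeasurable)
  rw [h.map_eq] at h2
  exact h2.symm

/-- The kernels that are finite linear combinations of products of characters. -/
def charSpan : Submodule ℝ (M → ℝ) :=
  Submodule.span ℝ (Set.range fun i : ℕ × ℕ => fun q : M => chi i.1 q.1 * chi i.2 q.2)

theorem continuous_chi_mul_chi (k l : ℕ) : Continuous fun q : M => chi k q.1 * chi l q.2 :=
  ((continuous_chi k).comp continuous_fst).mul ((continuous_chi l).comp continuous_snd)

theorem continuous_of_mem_charSpan {ρ : M → ℝ} (hρ : ρ ∈ charSpan) : Continuous ρ := by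
  induction hρ using Submodule.span_induction with
  | mem f hf => obtain ⟨i, rfl⟩ := hf; exact continuous_chi_mul_chi _ _
  | zero => exact continuous_const
  | add f g _ _ hf hg => exact hf.add hg
  | smul c f _ hf => exact hf.const_smul c

theorem mul_mem_charSpan {f g : S3 → ℝ} (hf : f ∈ Submodule.span ℝ (Set.range chi))
    (hg : g ∈ Submodule.span ℝ (Set.range chi)) : (fun q : M => f q.1 * g q.2) ∈ charSpan := by
  induction hf using Submodule.span_induction with
  | mem f hf =>
    obtain ⟨k, rfl⟩ := hf
    induction hg using Submodule.span_induction with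
    | mem g hg => obtain ⟨l, rfl⟩ := hg; exact Submodule.subset_span ⟨(k, l), rfl⟩
    | zero =>
      convert Submodule.zero_mem charSpan using 1
      funext q; simp
    | add f g _ _ hf hg =>
      convert Submodule.add_mem _ hf hg using 1
      funext q; simp [mul_add]
    | smul c f _ hf =>
      convert Submodule.smul_mem _ c hf using 1
      funext q; simp; ring
  | zero =>
    convert Submodule.zero_mem charSpan using 1
    funext q; simp
  | add f g _ _ hf hg =>
    convert Submodule.add_mem _ hf hg using 1
    funext q; simp [add_mul]
  | smul c f _ hf =>
    convert Submodule.smul_mem _ c hf using 1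
    funext q; simp; ring

theorem continuous_translate {f : M → 𝕜} (hf : Continuous f) :
    Continuous fun r : M × M => f (r.2.1 * r.1.1, r.1.2 * r.2.2) := by fun_prop

theorem conv_integrable {ρ : M → ℝ} (hρ : Continuous ρ) {f : M → 𝕜} (hf : Continuous f) (p : M) :
    Integrable (fun q => (ρ q : 𝕜) * f (p.1 * q.1, q.2 * p.2)) vol :=
  integrable_M ((RCLike.continuous_ofReal.comp hρ).mul
    ((continuous_translate hf).comp (continuous_id.prodMk continuous_const)))

theorem conv_add {ρ σ : M → ℝ} (hρ : Continuous ρ) (hσ : Continuous σ) {f : M → 𝕜}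
    (hf : Continuous f) : conv (ρ + σ) f = conv ρ f + conv σ f := by
  funext p
  simp only [conv, Pi.add_apply, RCLike.ofReal_add, add_mul]
  exact integral_add (conv_integrable hρ hf p) (conv_integrable hσ hf p)

theorem conv_smul (c : ℝ) (ρ : M → ℝ) (f : M → 𝕜) : conv (c • ρ) f = (c : 𝕜) • conv ρ f := by
  funext p
  simp only [conv, Pi.smul_apply, smul_eq_mul, RCLike.ofReal_mul, mul_assoc]
  exact integral_const_mul _ _

theorem conv_zero (f : M → 𝕜) : conv 0 f = 0 := by
  funext p; simp [conv]

/-- Averaging with a product of characters is integration against the kernels `kerS`. -/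
theorem conv_chi_eq_integral (k l : ℕ) {f : M → 𝕜} (hf : Continuous f) (p : M) :
    conv (fun q => chi k q.1 * chi l q.2) f p = ∫ q, (kerS k l p : Smooth 𝕜).1 q * f q ∂vol := by
  have h := integral_translate p.1 p.2 (f := fun q => (kerS k l p : Smooth 𝕜).1 q * f q)
    ((smooth_continuous (kerS k l p : Smooth 𝕜)).mul hf)
  rw [← h, conv]
  simp only [kerS_apply, inv_mul_cancel_left]
  refine integral_congr_ae (Filter.Eventually.of_forall fun q => ?_)
  beta_reduce
  rw [chi_mul_comm l p.2⁻¹, mul_inv_cancel_right]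

theorem conv_chi_eq_inner (k l : ℕ) (f : Smooth 𝕜) (p : M) :
    conv (fun q => chi k q.1 * chi l q.2) f.1 p = ⟪toL2 (kerS k l p), toL2 f⟫_𝕜 := by
  rw [conv_chi_eq_integral k l (smooth_continuous f), inner_toL2_toL2, innerL2]
  simp only [kerS_apply, RCLike.conj_ofReal]

/-- The kernel `kerS k l` is symmetric. -/
theorem kerS_comm (k l : ℕ) (p q : M) : (kerS k l p : Smooth 𝕜).1 q = (kerS k l q).1 p := by
  rw [kerS_apply, kerS_apply, ← chi_inv k, ← chi_inv l]
  simp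

/-- The inclusion of smooth functions in the Banach space of continuous functions. -/
def toC : Smooth 𝕜 →ₗ[𝕜] C(M, 𝕜) where
  toFun f := ⟨f.1, smooth_continuous f⟩
  map_add' _ _ := rfl
  map_smul' _ _ := rfl

/-- Averages with a product of characters are harmonics: they are integrals of functions with values
in `ℋ_k ⊗ ℋ_ℓ`, a finite-dimensional, hence closed, subspace of the continuous functions. -/
theorem conv_chi_mem (k l : ℕ) {f : M → 𝕜} (hf : Continuous f) :
    ∃ h ∈ tensorHarm 𝕜 k l, h.1 = conv (fun q => chi k q.1 * chi l q.2) f := by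
  -- the integrand, as a continuous function with values in a finite-dimensional space
  have hg : Continuous fun r : M × M => f r.1 * (kerS k l r.1 : Smooth 𝕜).1 r.2 := by
    simp only [kerS_apply]
    have h1 := continuous_chi k
    have h2 := continuous_chi l
    have h3 : Continuous fun r : M × M =>
        chi k (r.1.1⁻¹ * r.2.1) * chi l (r.1.2⁻¹ * r.2.2) := by fun_prop
    exact (hf.comp continuous_fst).mul (RCLike.continuous_ofReal.comp h3)
  let G : C(M, C(M, 𝕜)) := ContinuousMap.curry ⟨_, hg⟩
  have hG : ∀ q p, G q p = f q * (kerS k l q : Smooth 𝕜).1 p := fun q p => rfl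
  let W : Submodule 𝕜 C(M, 𝕜) := (tensorHarm 𝕜 k l).map toC
  have hW : FiniteDimensional 𝕜 W := inferInstance
  have hGW : ∀ q, G q ∈ W := fun q =>
    ⟨f q • kerS k l q, Submodule.smul_mem _ _ (kerS_mem k l q), rfl⟩
  have hint : Integrable G vol := integrable_M G.continuous
  have hmem : ∫ q, G q ∂vol ∈ (W : Set C(M, 𝕜)) :=
    Convex.integral_mem (W.restrictScalars ℝ).convex W.closed_of_finiteDimensional
      (Filter.Eventually.of_forall hGW) hint
  obtain ⟨h, hh, e⟩ := hmem
  refine ⟨h, hh, ?_⟩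
  funext p
  have e2 : h.1 p = (∫ q, G q ∂vol) p := congrArg (fun g : C(M, 𝕜) => g p) e
  rw [e2, ContinuousMap.integral_apply hint, conv_chi_eq_integral k l hf]
  refine integral_congr_ae (Filter.Eventually.of_forall fun q => ?_)
  beta_reduce
  rw [hG, kerS_comm, mul_comm]

/-- The algebraic direct sum of the spaces `ℋ_k ⊗ ℋ_ℓ`. -/
def allHarm : Submodule 𝕜 (Smooth 𝕜) := ⨆ i : ℕ × ℕ, tensorHarm 𝕜 i.1 i.2

theorem conv_mem {ρ : M → ℝ} (hρ : ρ ∈ charSpan) {f : M → 𝕜} (hf : Continuous f) :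
    ∃ h ∈ (allHarm : Submodule 𝕜 (Smooth 𝕜)), h.1 = conv ρ f := by
  induction hρ using Submodule.span_induction with
  | mem ρ h =>
    obtain ⟨i, rfl⟩ := h
    obtain ⟨h, hh, e⟩ := conv_chi_mem i.1 i.2 hf
    exact ⟨h, Submodule.mem_iSup_of_mem i hh, e⟩
  | zero => exact ⟨0, Submodule.zero_mem _, (conv_zero f).symm⟩
  | add ρ σ hρ hσ h1 h2 =>
    obtain ⟨g, hg, e⟩ := h1
    obtain ⟨h, hh, e'⟩ := h2
    refine ⟨g + h, Submodule.add_mem _ hg hh, ?_⟩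
    rw [conv_add (continuous_of_mem_charSpan hρ) (continuous_of_mem_charSpan hσ) hf, ← e, ← e']
    rfl
  | smul c ρ _ h1 =>
    obtain ⟨g, hg, e⟩ := h1
    refine ⟨(c : 𝕜) • g, Submodule.smul_mem _ _ hg, ?_⟩
    rw [conv_smul, ← e]
    rfl

/-! ### An approximate identity -/

/-- The function whose powers, suitably normalised, form an approximate identity. -/
def peak (q : M) : ℝ := ((1 + re q.1) / 2) * ((1 + re q.2) / 2)

/-- The approximate identity. -/
def approxId (n : ℕ) : M → ℝ := (∫ q, peak q ^ n ∂vol)⁻¹ • fun q => peak q ^ n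

theorem continuous_peak : Continuous peak := by
  have := continuous_re
  unfold peak
  fun_prop

theorem approxId_mem (n : ℕ) : approxId n ∈ charSpan := by
  refine Submodule.smul_mem _ _ ?_
  have h := eval_re_mem_span_chi (((1 + Polynomial.X) * Polynomial.C (1 / 2)) ^ n)
  convert mul_mem_charSpan h h using 1
  funext q
  simp only [peak, Polynomial.eval_pow, Polynomial.eval_mul, Polynomial.eval_add,
    Polynomial.eval_one, Polynomial.eval_X, Polynomial.eval_C, ← mul_pow]
  ring

/-- The averages `conv (approxId n) f` converge to `f` uniformly. -/
theorem conv_approxId (f : M → 𝕜) (hf : Continuous f) {ε : ℝ} (hε : 0 < ε) :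
    ∀ᶠ n in Filter.atTop, ∀ p, ‖conv (approxId n) f p - f p‖ ≤ ε := by
  let G : C(M, C(M, 𝕜)) := ContinuousMap.curry ⟨_, continuous_translate hf⟩
  have hG : ∀ q p, G q p = f (p.1 * q.1, q.2 * p.2) := fun q p => rfl
  have hb : ∀ q : M, 0 ≤ (1 + re q.1) / 2 ∧ (1 + re q.1) / 2 ≤ 1 ∧ 0 ≤ (1 + re q.2) / 2 ∧
      (1 + re q.2) / 2 ≤ 1 := fun q => by
    refine ⟨?_, ?_, ?_, ?_⟩ <;>
      linarith [re_le_one q.1, re_le_one q.2, neg_one_le_re q.1, neg_one_le_re q.2]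
  have h1 : peak 1 = 1 := by simp [peak, re_one]
  have h := tendsto_setIntegral_pow_smul_of_unique_maximum_of_isCompact_of_continuousOn
    (μ := vol) (x₀ := (1 : M)) (g := G) isCompact_univ (c := peak)
    continuous_peak.continuousOn
    (fun q _ hq => by
      obtain ⟨h2, h3, h4, h5⟩ := hb q
      rw [h1]
      by_contra hlt
      have h6 : 1 ≤ ((1 + re q.1) / 2) * ((1 + re q.2) / 2) := not_lt.1 hlt
      have h7 : (1 + re q.1) / 2 = 1 := by nlinarith
      have h8 : (1 + re q.2) / 2 = 1 := by nlinarith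
      exact hq (Prod.ext (eq_one_of_re (by linarith)) (eq_one_of_re (by linarith))))
    (fun q _ => mul_nonneg (hb q).1 (hb q).2.2.1) (by rw [h1]; exact one_pos) (by simp)
    G.continuous.continuousOn
  simp only [Measure.restrict_univ] at h
  have h2 := Metric.tendsto_atTop'.1 h ε hε
  obtain ⟨N, hN⟩ := h2
  filter_upwards [Filter.eventually_gt_atTop N] with n hn p
  have h3 := hN n hn
  rw [dist_eq_norm] at h3
  have hint : Integrable (fun q => peak q ^ n • G q) vol :=
    integrable_M ((continuous_peak.pow n).smul G.continuous)
  refine le_trans (le_of_eq ?_) ((ContinuousMap.norm_coe_le_norm _ p).trans h3.le)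
  congr 1
  rw [ContinuousMap.sub_apply, ContinuousMap.smul_apply, ContinuousMap.integral_apply hint, hG,
    approxId, conv_smul]
  simp only [Prod.fst_one, Prod.snd_one, mul_one, one_mul, ContinuousMap.smul_apply, hG,
    Pi.smul_apply, conv, RCLike.real_smul_eq_coe_mul, smul_eq_mul]

theorem tendsto_conv_approxId (f : M → 𝕜) (hf : Continuous f) (p : M) :
    Filter.Tendsto (fun n => conv (approxId n) f p) Filter.atTop (nhds (f p)) := by
  rw [Metric.tendsto_atTop]
  intro ε hε
  obtain ⟨N, hN⟩ := Filter.eventually_atTop.1 (conv_approxId f hf (half_pos hε))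
  refine ⟨N, fun n hn => ?_⟩
  rw [dist_eq_norm]
  linarith [hN n hn p]

/-! ### Density of the harmonics in `C^∞` -/

/-- Iterated derivatives, as operators on smooth functions. -/
def vfsS (w : List (Fin 3 ⊕ Fin 3)) : Smooth 𝕜 →ₗ[𝕜] Smooth 𝕜 :=
  w.foldr (fun a A => vfS a ∘ₗ A) LinearMap.id

@[simp] theorem vfsS_coe (w : List (Fin 3 ⊕ Fin 3)) (f : Smooth 𝕜) : (vfsS w f).1 = vfs w f.1 := by
  induction w with
  | nil => rfl
  | cons a w ih => exact congrArg (vf a) ih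

/-- Averages commute with differentiation, so uniform convergence of `conv (approxId n)` implies
convergence in the topology of `C^∞`. -/
theorem vfs_conv {ρ : M → ℝ} (hρ : Continuous ρ) (f : Smooth 𝕜) (w : List (Fin 3 ⊕ Fin 3)) :
    vfs w (conv ρ f.1) = conv ρ (vfs w f.1) := by
  induction w with
  | nil => rfl
  | cons a w ih =>
    change vf a (vfs w (conv ρ f.1)) = conv ρ (vf a (vfs w f.1))
    rw [ih, ← vfsS_coe]
    funext p
    exact vf_average vol (RCLike.continuous_ofReal.comp hρ) (τ := fun q => q) continuous_id
      (vfsS w f) a p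

/-- Every smooth function is a limit of finite sums of harmonics in the topology of `C^∞`. -/
theorem exists_harmonic_near (f : Smooth 𝕜) (N : ℕ) {ε : ℝ} (hε : 0 < ε) :
    ∃ h ∈ (allHarm : Submodule 𝕜 (Smooth 𝕜)),
      ∀ w : List (Fin 3 ⊕ Fin 3), w.length ≤ N → ∀ p, ‖vfs w (f - h).1 p‖ ≤ ε := by
  have hfin : {w : List (Fin 3 ⊕ Fin 3) | w.length ≤ N}.Finite := List.finite_length_le _ _
  have h := (Filter.eventually_all_finite hfin).2 fun w _ =>
    conv_approxId (vfsS w f).1 (smooth_continuous _) hε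
  obtain ⟨n, hn⟩ := h.exists
  obtain ⟨h, hh, e⟩ := conv_mem (approxId_mem n) (smooth_continuous f)
  refine ⟨h, hh, fun w hw p => ?_⟩
  have h2 := hn w hw p
  rw [vfsS_coe, ← vfs_conv (continuous_of_mem_charSpan (approxId_mem n)), ← e] at h2
  rw [← vfsS_coe, map_sub, ← neg_sub]
  rw [Submodule.coe_neg, Pi.neg_apply, norm_neg]
  simpa using h2

/-! ### The reproducing property -/

theorem integral_chi_mul_chi (i j k l : ℕ) :
    ∫ q : M, (chi i q.1 * chi j q.2) * (chi k q.1 * chi l q.2) ∂vol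
      = if (i, j) = (k, l) then 1 else 0 := by
  have e : ∀ q : M, (chi i q.1 * chi j q.2) * (chi k q.1 * chi l q.2)
      = (chi i q.1 * chi k q.1) * (chi j q.2 * chi l q.2) := fun q => by ring
  simp only [e]
  have h := integral_prod_mul (μ := haarS3) (ν := haarS3) (fun x => chi i x * chi k x)
    (fun y => chi j y * chi l y)
  rw [vol, h]
  have ho : ∀ {k l : ℕ}, k ≠ l → ∫ x, chi k x * chi l x ∂haarS3 = 0 := fun {k l} h => by
    simpa using integral_chi_mul_chi_of_ne h 1 1
  split_ifs with h2
  · obtain ⟨rfl, rfl⟩ := Prod.mk.inj h2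
    rw [integral_chi_sq, integral_chi_sq, one_mul]
  · by_cases hk : i = k
    · rw [ho (fun hl : j = l => h2 (by rw [hk, hl])), mul_zero]
    · rw [ho hk, zero_mul]

/-- On `ℋ_k ⊗ ℋ_ℓ`, averaging with a kernel in `charSpan` only depends on the component of the
kernel along `χ_k ⊗ χ_ℓ`. -/
theorem conv_of_mem {k l : ℕ} {f : Smooth 𝕜} (hf : f ∈ tensorHarm 𝕜 k l) {ρ : M → ℝ}
    (hρ : ρ ∈ charSpan) : conv ρ f.1
      = ((∫ q : M, ρ q * (chi k q.1 * chi l q.2) ∂vol : ℝ) : 𝕜)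
        • conv (fun q => chi k q.1 * chi l q.2) f.1 := by
  have hc := continuous_chi_mul_chi k l
  induction hρ using Submodule.span_induction with
  | mem ρ h =>
    obtain ⟨i, rfl⟩ := h
    beta_reduce
    rw [integral_chi_mul_chi]
    split_ifs with hi
    · obtain ⟨rfl, rfl⟩ := Prod.mk.inj hi
      simp
    · funext p
      rw [conv_chi_eq_inner, inner_tensorHarm (kerS_mem _ _ p) hf hi]
      simp
  | zero => simp [conv_zero]
  | add ρ σ hρ hσ h1 h2 =>
    have hρ := continuous_of_mem_charSpan hρ
    have hσ := continuous_of_mem_charSpan hσ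
    have e : ∫ q : M, (ρ + σ) q * (chi k q.1 * chi l q.2) ∂vol
        = ∫ q : M, ρ q * (chi k q.1 * chi l q.2) ∂vol
          + ∫ q : M, σ q * (chi k q.1 * chi l q.2) ∂vol := by
      simp only [Pi.add_apply, add_mul]
      exact integral_add (integrable_M (hρ.mul hc)) (integrable_M (hσ.mul hc))
    rw [conv_add hρ hσ (smooth_continuous f), h1, h2, ← add_smul, ← RCLike.ofReal_add, e]
  | smul c ρ _ h1 =>
    rw [conv_smul, h1, smul_smul, ← RCLike.ofReal_mul, ← integral_const_mul]
    simp only [Pi.smul_apply, smul_eq_mul, mul_assoc]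

/-- The reproducing property of `kerS`. -/
theorem reproducing {k l : ℕ} {f : Smooth 𝕜} (hf : f ∈ tensorHarm 𝕜 k l) (p : M) :
    f.1 p = ((k + 1) * (l + 1) : 𝕜) * ⟪toL2 (kerS k l p), toL2 f⟫_𝕜 := by
  have h1 := tendsto_conv_approxId f.1 (smooth_continuous f) p
  have h2 : Filter.Tendsto
      (fun n => ∫ q : M, approxId n q * (chi k q.1 * chi l q.2) ∂vol)
      Filter.atTop (nhds ((k + 1) * (l + 1))) := by
    have := tendsto_conv_approxId (fun q : M => chi k q.1 * chi l q.2)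
      (continuous_chi_mul_chi k l) 1
    simpa [conv, chi_apply_one] using this
  have h3 := ((RCLike.continuous_ofReal (K := 𝕜)).tendsto _).comp h2
  have h4 := h3.mul_const (conv (fun q : M => chi k q.1 * chi l q.2) f.1 p)
  rw [← conv_chi_eq_inner]
  refine tendsto_nhds_unique h1 ?_
  have e : ∀ n, conv (approxId n) f.1 p
      = ((∫ q : M, approxId n q * (chi k q.1 * chi l q.2) ∂vol : ℝ) : 𝕜)
        * conv (fun q => chi k q.1 * chi l q.2) f.1 p := fun n => by
    rw [conv_of_mem hf (approxId_mem n)]; rfl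
  simp only [e]
  simpa using h4

/-! ### Integral identities for the characters -/

/-- The convolution identity for characters: the reproducing property, applied to a kernel. -/
theorem integral_chi_mul_chi_self (k : ℕ) (a b : S3) :
    ∫ x, chi k (a * x) * chi k (b * x) ∂haarS3 = chi k (a * b⁻¹) / (k + 1) := by
  have h1 := reproducing (kerS_mem (𝕜 := ℝ) k 0 (a⁻¹, 1)) (b⁻¹, 1)
  rw [inner_toL2_toL2, innerL2] at h1
  simp only [kerS_apply, chi_zero, mul_one, inv_inv, Nat.cast_zero, zero_add] at h1
  have h2 := integral_fun_fst (μ := haarS3) (ν := haarS3)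
    (fun x : S3 => chi k (a * x) * chi k (b * x))
  simp only [probReal_univ, one_smul] at h2
  have h3 : chi k (a * b⁻¹) = (k + 1) * ∫ q : M, chi k (a * q.1) * chi k (b * q.1) ∂vol := by
    simp only [mul_comm (chi k (a * _))]
    exact h1
  rw [h3, ← h2, mul_div_cancel_left₀ _ (by positivity)]
  rfl

/-- A continuous class function that is orthogonal to all characters vanishes: it is a function of
the real part, and polynomials in the real part are combinations of characters. -/
theorem classFunction_eq_zero {f : S3 → ℝ} (hf : Continuous f) (hc : ∀ g x, f (g * x * g⁻¹) = f x)
    (ho : ∀ k, ∫ x, f x * chi k x ∂haarS3 = 0) : f = 0 := by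
  have hre : ∀ {x y}, re x = re y → f x = f y := fun {x y} h => by
    obtain ⟨g, rfl⟩ := exists_conj_of_re_eq h
    exact (hc g x).symm
  -- `f` is a continuous function `F` of the real part
  let F : ℝ → ℝ := fun t => f (circ 0 (Real.arccos t))
  have hcirc : Continuous (circ 0) := by
    have h : Continuous fun t : ℝ => (Real.cos t : ℝ) • (1 : ℍ) + (Real.sin t : ℝ) • unitIm 0 := by
      fun_prop
    exact continuous_induced_rng.2 (h.congr fun t => (coe_circ 0 t).symm)
  have hF : Continuous F := hf.comp (hcirc.comp Real.continuous_arccos)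
  have hFf : ∀ x, F (re x) = f x := fun x => by
    refine hre ?_
    rw [re]
    exact Real.cos_arccos (neg_one_le_re x) (re_le_one x)
  have hpoly : ∀ q : Polynomial ℝ, ∫ x, f x * q.eval (re x) ∂haarS3 = 0 := by
    intro q
    have hq := eval_re_mem_span_chi q
    have key : ∀ g ∈ Submodule.span ℝ (Set.range chi),
        Continuous g ∧ ∫ x, f x * g x ∂haarS3 = 0 := by
      intro g hg
      induction hg using Submodule.span_induction with
      | mem g hg => obtain ⟨k, rfl⟩ := hg; exact ⟨continuous_chi k, ho k⟩
      | zero => exact ⟨continuous_const, by simp⟩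
      | add g h _ _ hg hh =>
        refine ⟨hg.1.add hh.1, ?_⟩
        simp only [Pi.add_apply, mul_add]
        have := integral_add (integrable_S3 (hf.mul hg.1)) (integrable_S3 (hf.mul hh.1))
        exact this.trans (by simp [hg.2, hh.2])
      | smul c g _ hg =>
        refine ⟨hg.1.const_smul c, ?_⟩
        simp only [Pi.smul_apply, smul_eq_mul, mul_left_comm]
        rw [integral_const_mul, hg.2, mul_zero]
    exact (key _ hq).2
  have hcre := continuous_re
  -- by Weierstrass `f` is close to a polynomial in `re`, to which it is orthogonal
  have hsq : ∫ x, f x * f x ∂haarS3 = 0 := by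
    refine le_antisymm (le_of_forall_pos_le_add fun ε hε => ?_)
      (integral_nonneg fun x => mul_self_nonneg _)
    obtain ⟨D, hD⟩ := (isCompact_range hf).isBounded.exists_norm_le
    have hD' : ∀ x, |f x| ≤ |D| + 1 := fun x => by
      have := hD _ ⟨x, rfl⟩
      rw [Real.norm_eq_abs] at this
      linarith [le_abs_self D]
    have hDpos : 0 < |D| + 1 := by positivity
    obtain ⟨q, hq⟩ := exists_polynomial_near_of_continuousOn (-1) 1 F hF.continuousOn
      (ε / (|D| + 1)) (by positivity)
    have hqc : Continuous fun x => q.eval (re x) := q.continuous.comp hcre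
    have e : ∫ x, f x * f x ∂haarS3 = ∫ x, f x * (f x - q.eval (re x)) ∂haarS3 := by
      simp only [mul_sub]
      have := integral_sub (integrable_S3 (hf.mul hf)) (integrable_S3 (hf.mul hqc))
      exact (this.trans (by simp [hpoly])).symm
    rw [e, zero_add]
    have hb := norm_integral_le_of_norm_le_const (μ := haarS3)
      (f := fun x => f x * (f x - q.eval (re x))) (C := ε)
      (Filter.Eventually.of_forall fun x => by
        have h1 := hq (re x) ⟨neg_one_le_re x, re_le_one x⟩
        rw [hFf, abs_sub_comm] at h1
        rw [Real.norm_eq_abs, abs_mul]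
        calc |f x| * |f x - q.eval (re x)| ≤ (|D| + 1) * (ε / (|D| + 1)) :=
              mul_le_mul (hD' x) h1.le (abs_nonneg _) hDpos.le
          _ = ε := mul_div_cancel₀ _ hDpos.ne')
    rw [probReal_univ, mul_one] at hb
    exact (le_abs_self _).trans hb
  have h0 := (integral_eq_zero_iff_of_nonneg (fun x => mul_self_nonneg (f x))
    (integrable_S3 (hf.mul hf))).1 hsq
  have h1 : (fun x => f x * f x) = 0 :=
    ((hf.mul hf).ae_eq_iff_eq haarS3 continuous_const).1 h0
  funext x
  simpa using congrFun h1 x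

/-- Averaging `χ_k(x y)` over the conjugates of `y`. -/
theorem integral_chi_conj (k : ℕ) (x y : S3) :
    ∫ g, chi k (x * g * y * g⁻¹) ∂haarS3 = chi k x * chi k y / (k + 1) := by
  have hchi := continuous_chi
  -- the average is a class function `F` of `x`, which is compared with the multiple of `χ_k` that
  -- has the same integrals against characters
  let F : S3 → ℝ := fun x => ∫ g, chi k (x * g * y * g⁻¹) ∂haarS3
  have hcont : Continuous fun r : S3 × S3 => chi k (r.1 * r.2 * y * r.2⁻¹) := by
    have := hchi k
    fun_prop
  have hF : Continuous F := by
    have := continuous_parametric_integral_of_continuous (μ := haarS3)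
      (f := fun x g => chi k (x * g * y * g⁻¹)) hcont isCompact_univ
    simpa using this
  have hcl : ∀ h x, F (h * x * h⁻¹) = F x := by
    intro h x
    have := integral_mul_left_eq_self (μ := haarS3)
      (fun g => chi k (h * x * h⁻¹ * g * y * g⁻¹)) h
    change ∫ g, chi k (h * x * h⁻¹ * g * y * g⁻¹) ∂haarS3 = _
    rw [← this]
    refine integral_congr_ae (Filter.Eventually.of_forall fun g => ?_)
    beta_reduce
    rw [show h * x * h⁻¹ * (h * g) * y * (h * g)⁻¹ = h * (x * g * y * g⁻¹ * h⁻¹) by group,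
      chi_mul_comm]
    group
  have hswap : ∀ l, ∫ x, F x * chi l x ∂haarS3
      = ∫ g, ∫ x, chi k (x * g * y * g⁻¹) * chi l x ∂haarS3 ∂haarS3 := by
    intro l
    have h := integral_integral_swap_of_hasCompactSupport (μ := haarS3) (ν := haarS3)
      (f := fun x g : S3 => chi k (x * g * y * g⁻¹) * chi l x)
      (hcont.mul ((hchi l).comp continuous_fst)) (HasCompactSupport.of_compactSpace _)
    rw [← h]
    refine integral_congr_ae (Filter.Eventually.of_forall fun x => ?_)
    exact (integral_mul_const _ _).symm
  have hne : ∀ l, l ≠ k → ∫ x, F x * chi l x ∂haarS3 = 0 := by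
    intro l hl
    rw [hswap]
    have : ∀ g, ∫ x, chi k (x * g * y * g⁻¹) * chi l x ∂haarS3 = 0 := fun g => by
      have := integral_chi_mul_chi_of_ne hl.symm (g * y * g⁻¹) 1
      rw [← this]
      refine integral_congr_ae (Filter.Eventually.of_forall fun x => ?_)
      beta_reduce
      rw [one_mul, chi_mul_comm k (g * y * g⁻¹) x]
      simp only [mul_assoc]
    simp [this]
  have hsame : ∫ x, F x * chi k x ∂haarS3 = chi k y / (k + 1) := by
    rw [hswap]
    have : ∀ g, ∫ x, chi k (x * g * y * g⁻¹) * chi k x ∂haarS3 = chi k y / (k + 1) := fun g => by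
      have := integral_chi_mul_chi_self k (g * y * g⁻¹) 1
      rw [inv_one, mul_one, chi_mul_comm k (g * y), inv_mul_cancel_left] at this
      rw [← this]
      refine integral_congr_ae (Filter.Eventually.of_forall fun x => ?_)
      beta_reduce
      rw [one_mul, chi_mul_comm k (g * y * g⁻¹) x]
      simp only [mul_assoc]
    simp [this]
  have hsub := classFunction_eq_zero (f := fun x => F x - chi k y / (k + 1) * chi k x)
    (hF.sub ((hchi k).const_mul _))
    (fun g x => by
      rw [hcl, chi_mul_comm k (g * x), inv_mul_cancel_left])
    (fun l => by
      simp only [sub_mul, mul_assoc]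
      have hs := integral_sub (integrable_S3 (hF.mul (hchi l)))
        (integrable_S3 (((hchi k).mul (hchi l)).const_mul (chi k y / (k + 1))))
      refine hs.trans ?_
      simp only [Pi.mul_apply]
      rw [integral_const_mul]
      by_cases hl : l = k
      · subst hl
        rw [hsame, integral_chi_sq, mul_one, sub_self]
      · have := integral_chi_mul_chi_of_ne (Ne.symm hl) 1 1
        simp only [one_mul] at this
        rw [hne l hl, this, mul_zero, sub_zero])
  have := congrFun hsub x
  have h2 : F x = chi k y / (k + 1) * chi k x := sub_eq_zero.1 this
  change F x = _
  rw [h2]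
  ring

/-! ### Completeness of the harmonics -/

theorem exists_harmonic_near_continuous (f : C(M, 𝕜)) {ε : ℝ} (hε : 0 < ε) :
    ∃ h ∈ (allHarm : Submodule 𝕜 (Smooth 𝕜)), ∀ p, ‖h.1 p - f p‖ ≤ ε := by
  obtain ⟨n, hn⟩ := (conv_approxId f f.continuous hε).exists
  obtain ⟨h, hh, e⟩ := conv_mem (approxId_mem n) f.continuous
  exact ⟨h, hh, fun p => by rw [e]; exact hn p⟩

/-- The sums of harmonics are dense in `L²`. -/
theorem dense_allHarm : ((allHarm.map toL2 : Submodule 𝕜 (Lp 𝕜 2 vol))).topologicalClosure = ⊤ := by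
  rw [← Submodule.dense_iff_topologicalClosure_eq_top]
  have hd := ContinuousMap.toLp_denseRange 𝕜 vol (p := 2) 𝕜 (by norm_num)
  have hsub : Set.range (ContinuousMap.toLp (E := 𝕜) 2 vol 𝕜)
      ⊆ closure ((allHarm.map toL2 : Submodule 𝕜 (Lp 𝕜 2 vol)) : Set (Lp 𝕜 2 vol)) := by
    rintro _ ⟨f, rfl⟩
    rw [Metric.mem_closure_iff]
    intro ε hε
    obtain ⟨h, hh, hb⟩ := exists_harmonic_near_continuous f (half_pos hε)
    refine ⟨toL2 h, ⟨h, hh, rfl⟩, ?_⟩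
    rw [dist_comm, dist_eq_norm]
    have := Lp.norm_le_of_ae_bound (f := toL2 h - ContinuousMap.toLp (E := 𝕜) 2 vol 𝕜 f) (p := 2)
      (half_pos hε).le (by
        filter_upwards [coeFn_toL2 h, ContinuousMap.coeFn_toLp (p := 2) (𝕜 := 𝕜) vol f,
          Lp.coeFn_sub (toL2 h) (ContinuousMap.toLp (E := 𝕜) 2 vol 𝕜 f)] with p h1 h2 h3
        rw [h3, Pi.sub_apply, h1, h2]
        exact hb p)
    simp [measureUnivNNReal] at this
    linarith
  exact dense_closure.1 (hd.mono hsub)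

theorem eq_zero_of_inner_tensorHarm {w : Lp 𝕜 2 vol}
    (h : ∀ k l, ∀ f ∈ tensorHarm 𝕜 k l, ⟪toL2 f, w⟫_𝕜 = 0) : w = 0 := by
  have h1 : allHarm.map toL2 ≤ (Submodule.span 𝕜 {w})ᗮ := by
    rw [Submodule.map_le_iff_le_comap, allHarm]
    refine iSup_le fun i f hf => ?_
    rw [Submodule.mem_comap, Submodule.mem_orthogonal_singleton_iff_inner_left]
    exact h i.1 i.2 f hf
  have h2 := Submodule.topologicalClosure_minimal _ h1 (Submodule.isClosed_orthogonal _)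
  rw [dense_allHarm] at h2
  have h3 : w ∈ (Submodule.span 𝕜 {w})ᗮ := h2 trivial
  rw [Submodule.mem_orthogonal_singleton_iff_inner_left] at h3
  exact inner_self_eq_zero.1 h3

/-- The spaces `ℋ_k ⊗ ℋ_ℓ` are the joint eigenspaces of the Laplacians of the two factors. -/
theorem mem_tensorHarm_of_lapSide {k l : ℕ} {f : Smooth 𝕜}
    (hf : lapSide Sum.inl f = (-(eig k : ℝ) : 𝕜) • f)
    (hf' : lapSide Sum.inr f = (-(eig l : ℝ) : 𝕜) • f) : f ∈ tensorHarm 𝕜 k l := by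
  -- the difference of `f` and its orthogonal projection `h` to `ℋ_k ⊗ ℋ_ℓ` is orthogonal to all
  -- harmonics
  let V : Submodule 𝕜 (Lp 𝕜 2 vol) := (tensorHarm 𝕜 k l).map toL2
  have hV : FiniteDimensional 𝕜 V := inferInstance
  obtain ⟨h, hh, e⟩ := V.starProjection_apply_mem (toL2 f)
  have hz : toL2 (f - h) = 0 := by
    refine eq_zero_of_inner_tensorHarm fun k' l' g hg => ?_
    rw [inner_eq_zero_symm]
    by_cases hkl : (k, l) = (k', l')
    · obtain ⟨rfl, rfl⟩ := Prod.mk.inj hkl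
      rw [map_sub, e]
      exact (Submodule.mem_orthogonal' _ _).1 (V.sub_starProjection_mem_orthogonal _) _ ⟨g, hg, rfl⟩
    · refine inner_eq_zero_of_lapSide ?_ ?_ hg hkl
      · rw [map_sub, hf, lapSide_inl_of_mem hh, smul_sub]
      · rw [map_sub, hf', lapSide_inr_of_mem hh, smul_sub]
  have := toL2_injective (hz.trans (map_zero toL2).symm)
  rw [sub_eq_zero.1 this]
  exact hh

/-! ### The operator on smooth functions -/

theorem opT_apply (f : Smooth 𝕜) (p : M) :
    (opT 𝕜 f).1 p = ∫ g : S3, f.1 (p.1 * g, g * p.2) ∂haarS3 := rfl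

theorem vfS_opT (a : Fin 3 ⊕ Fin 3) (f : Smooth 𝕜) : vfS a (opT 𝕜 f) = opT 𝕜 (vfS a f) := by
  apply Subtype.ext
  funext p
  have h := vf_average haarS3 (ρ := fun _ => (1 : 𝕜)) continuous_const (τ := fun g => (g, g))
    (continuous_id.prodMk continuous_id) f a p
  simp only [one_mul] at h
  exact h

theorem lapSide_opT (s : Fin 3 → Fin 3 ⊕ Fin 3) (f : Smooth 𝕜) :
    lapSide s (opT 𝕜 f) = opT 𝕜 (lapSide s f) := by
  simp [lapSide, vfS_opT]

/-- `T` preserves `ℋ_k ⊗ ℋ_ℓ`, which is a joint eigenspace of operators that commute with `T`. -/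
theorem opT_mem {k l : ℕ} {f : Smooth 𝕜} (hf : f ∈ tensorHarm 𝕜 k l) :
    opT 𝕜 f ∈ tensorHarm 𝕜 k l :=
  mem_tensorHarm_of_lapSide (by rw [lapSide_opT, lapSide_inl_of_mem hf, map_smul])
    (by rw [lapSide_opT, lapSide_inr_of_mem hf, map_smul])

theorem integral_translate_outer {E : Type*} [NormedAddCommGroup E] [NormedSpace ℝ E] (a b : S3)
    {f : M → E} (hf : Continuous f) : ∫ q : M, f (q.1 * a, b * q.2) ∂vol = ∫ q, f q ∂vol := by
  have h : MeasurePreserving (fun q : M => (q.1 * a, b * q.2)) vol vol :=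
    (measurePreserving_mul_right haarS3 a).prod (measurePreserving_mul_left haarS3 b)
  have h2 := integral_map (μ := vol) h.measurable.aemeasurable (f := f)
    (by rw [h.map_eq]; exact (integrable_M hf).aestronglyMeasurable)
  rw [h.map_eq] at h2
  exact h2.symm

/-- `T` is symmetric, because Haar measure is invariant under translations and inversion. -/
theorem inner_opT (f h : Smooth 𝕜) :
    ⟪toL2 (opT 𝕜 f), toL2 h⟫_𝕜 = ⟪toL2 f, toL2 (opT 𝕜 h)⟫_𝕜 := by
  have hf := smooth_continuous f
  have hh := smooth_continuous h
  have hcf : Continuous fun p => (starRingEnd 𝕜) (f.1 p) := RCLike.continuous_conj.comp hf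
  rw [inner_toL2_toL2, inner_toL2_toL2, innerL2, innerL2]
  have c1 : Continuous fun r : M × S3 =>
      (starRingEnd 𝕜) (f.1 (r.1.1 * r.2, r.2 * r.1.2)) * h.1 r.1 :=
    (hcf.comp (f := fun r : M × S3 => (r.1.1 * r.2, r.2 * r.1.2)) (by fun_prop)).mul
      (hh.comp continuous_fst)
  have c2 : Continuous fun r : M × S3 =>
      (starRingEnd 𝕜) (f.1 r.1) * h.1 (r.1.1 * r.2, r.2 * r.1.2) :=
    (hcf.comp continuous_fst).mul
      (hh.comp (f := fun r : M × S3 => (r.1.1 * r.2, r.2 * r.1.2)) (by fun_prop))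
  have s1 := integral_integral_swap_of_hasCompactSupport (μ := vol) (ν := haarS3)
    (f := fun p g => (starRingEnd 𝕜) (f.1 (p.1 * g, g * p.2)) * h.1 p) c1
    (HasCompactSupport.of_compactSpace _)
  have s2 := integral_integral_swap_of_hasCompactSupport (μ := vol) (ν := haarS3)
    (f := fun p g => (starRingEnd 𝕜) (f.1 p) * h.1 (p.1 * g, g * p.2)) c2
    (HasCompactSupport.of_compactSpace _)
  have e1 : ∀ p, (starRingEnd 𝕜) ((opT 𝕜 f).1 p) * h.1 p
      = ∫ g, (starRingEnd 𝕜) (f.1 (p.1 * g, g * p.2)) * h.1 p ∂haarS3 := fun p => by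
    rw [opT_apply, ← integral_conj]
    exact (integral_mul_const _ _).symm
  have e2 : ∀ p, (starRingEnd 𝕜) (f.1 p) * (opT 𝕜 h).1 p
      = ∫ g, (starRingEnd 𝕜) (f.1 p) * h.1 (p.1 * g, g * p.2) ∂haarS3 := fun p => by
    rw [opT_apply]
    exact (integral_const_mul _ _).symm
  simp only [e1, e2]
  -- for fixed `g`, substitute `(x, y) ↦ (x g⁻¹, g⁻¹ y)`, and then `g ↦ g⁻¹`
  rw [s1, s2, ← integral_inv_eq_self (μ := haarS3)
    (f := fun g => ∫ p : M, (starRingEnd 𝕜) (f.1 p) * h.1 (p.1 * g, g * p.2) ∂vol)]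
  refine integral_congr_ae (Filter.Eventually.of_forall fun g => ?_)
  have c3 : Continuous fun p : M => (starRingEnd 𝕜) (f.1 p) * h.1 (p.1 * g⁻¹, g⁻¹ * p.2) := by
    fun_prop
  have := integral_translate_outer g g c3
  simp only [mul_inv_cancel_right, inv_mul_cancel_left] at this
  exact this

theorem opT_kerS_of_ne {k l : ℕ} (h : k ≠ l) (a : M) : opT 𝕜 (kerS k l a) = 0 := by
  apply Subtype.ext
  funext p
  rw [opT_apply]
  simp only [kerS_apply]
  rw [integral_ofReal]
  have h2 := integral_chi_mul_chi_of_ne h (a.1⁻¹ * p.1) (p.2 * a.2⁻¹)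
  have e : ∀ g, chi k (a.1⁻¹ * (p.1 * g)) * chi l (a.2⁻¹ * (g * p.2))
      = chi k (a.1⁻¹ * p.1 * g) * chi l (p.2 * a.2⁻¹ * g) := fun g => by
    rw [← mul_assoc, ← mul_assoc, chi_mul_comm l (a.2⁻¹ * g), mul_assoc p.2]
  simp only [e]
  rw [h2]
  simp

theorem opT_kerS_apply (k : ℕ) (a p : M) :
    (opT 𝕜 (kerS k k a)).1 p = ((chi k (a.1⁻¹ * p.1 * a.2 * p.2⁻¹) / (k + 1) : ℝ) : 𝕜) := by
  rw [opT_apply]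
  simp only [kerS_apply]
  rw [integral_ofReal]
  have h2 := integral_chi_mul_chi_self k (a.1⁻¹ * p.1) (p.2 * a.2⁻¹)
  have e : ∀ g, chi k (a.1⁻¹ * (p.1 * g)) * chi k (a.2⁻¹ * (g * p.2))
      = chi k (a.1⁻¹ * p.1 * g) * chi k (p.2 * a.2⁻¹ * g) := fun g => by
    rw [← mul_assoc, ← mul_assoc, chi_mul_comm k (a.2⁻¹ * g), mul_assoc p.2]
  simp only [e]
  rw [h2, mul_inv_rev, inv_inv, mul_assoc _ a.2]

theorem opT_opT_kerS (k : ℕ) (a : M) :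
    opT 𝕜 (opT 𝕜 (kerS k k a)) = (((k : 𝕜) + 1) ^ 2)⁻¹ • kerS k k a := by
  apply Subtype.ext
  funext p
  rw [opT_apply]
  simp only [opT_kerS_apply]
  rw [integral_ofReal, integral_div]
  have h2 := integral_chi_conj k (a.1⁻¹ * p.1) (a.2 * p.2⁻¹)
  have e : ∀ g, chi k (a.1⁻¹ * (p.1 * g) * a.2 * (g * p.2)⁻¹)
      = chi k (a.1⁻¹ * p.1 * g * (a.2 * p.2⁻¹) * g⁻¹) := fun g => by
    congr 1; group
  simp only [e]
  rw [h2, Submodule.coe_smul, Pi.smul_apply, kerS_apply, ← chi_inv k (a.2 * p.2⁻¹), mul_inv_rev,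
    inv_inv, chi_mul_comm k p.2, smul_eq_mul]
  push_cast
  have : (k : 𝕜) + 1 ≠ 0 := Nat.cast_add_one_ne_zero k
  field_simp

/-- `T` vanishes on `ℋ_k ⊗ ℋ_ℓ` for `k ≠ ℓ`. -/
theorem opT_of_mem_of_ne {k l : ℕ} (h : k ≠ l) {f : Smooth 𝕜} (hf : f ∈ tensorHarm 𝕜 k l) :
    opT 𝕜 f = 0 := by
  apply Subtype.ext
  funext p
  rw [reproducing (opT_mem hf), ← inner_opT, opT_kerS_of_ne h]
  simp

/-- `T²` is the scalar `(k+1)⁻²` on `ℋ_k ⊗ ℋ_k`. -/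
theorem opT_opT_of_mem {k : ℕ} {f : Smooth 𝕜} (hf : f ∈ tensorHarm 𝕜 k k) :
    opT 𝕜 (opT 𝕜 f) = (((k : 𝕜) + 1) ^ 2)⁻¹ • f := by
  apply Subtype.ext
  funext p
  rw [reproducing (opT_mem (opT_mem hf)), ← inner_opT, ← inner_opT, opT_opT_kerS, map_smul,
    inner_smul_left, Submodule.coe_smul, Pi.smul_apply, reproducing hf p, smul_eq_mul]
  simp
  ring

/-! ### Orthogonal series in a Hilbert space -/

section OrthogonalSeries

variable {H ι : Type*} [NormedAddCommGroup H] [InnerProductSpace 𝕜 H]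
  {V : ι → Submodule 𝕜 H} [∀ i, (V i).HasOrthogonalProjection]

/-- Bessel's inequality for an orthogonal family of subspaces. -/
theorem sum_norm_sq_starProjection_le
    (hV : OrthogonalFamily 𝕜 (fun i => V i) fun i => (V i).subtypeₗᵢ) (w : H) (s : Finset ι) :
    ∑ i ∈ s, ‖(V i).starProjection w‖ ^ 2 ≤ ‖w‖ ^ 2 := by
  let S : H := ∑ i ∈ s, (V i).starProjection w
  have h1 : ‖S‖ ^ 2 = ∑ i ∈ s, ‖(V i).starProjection w‖ ^ 2 :=
    hV.norm_sum (fun i => ⟨(V i).starProjection w, (V i).starProjection_apply_mem w⟩) s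
  have h2 : RCLike.re ⟪S, w⟫_𝕜 = ∑ i ∈ s, ‖(V i).starProjection w‖ ^ 2 := by
    simp only [S, sum_inner, map_sum]
    refine Finset.sum_congr rfl fun i _ => ?_
    rw [← (V i).starProjection_eq_self_iff.2 ((V i).starProjection_apply_mem w),
      Submodule.inner_starProjection_left_eq_right,
      (V i).starProjection_eq_self_iff.2 ((V i).starProjection_apply_mem w),
      inner_self_eq_norm_sq]
  have h3 := (RCLike.re_le_norm ⟪S, w⟫_𝕜).trans (norm_inner_le_norm S w)
  rw [← h1]
  rw [h2, ← h1] at h3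
  have h4 : ‖S‖ ≤ ‖w‖ := by
    by_contra hlt
    push Not at hlt
    nlinarith [norm_nonneg S, norm_nonneg w]
  exact pow_le_pow_left₀ (norm_nonneg _) h4 2

/-- An orthogonal series that is dominated by the orthogonal expansion of a vector converges. -/
theorem exists_hasSum_of_norm_le [CompleteSpace H]
    (hV : OrthogonalFamily 𝕜 (fun i => V i) fun i => (V i).subtypeₗᵢ) {w : H} {x : ι → H}
    (hx : ∀ i, x i ∈ V i) {K : ℝ} (hK : 0 ≤ K)
    (h : ∀ i, ‖x i‖ ≤ K * ‖(V i).starProjection w‖) :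
    ∃ y, HasSum x y ∧ ‖y‖ ≤ K * ‖w‖ := by
  have hb : ∀ s : Finset ι, ∑ i ∈ s, ‖x i‖ ^ 2 ≤ (K * ‖w‖) ^ 2 := fun s => by
    calc ∑ i ∈ s, ‖x i‖ ^ 2 ≤ ∑ i ∈ s, K ^ 2 * ‖(V i).starProjection w‖ ^ 2 :=
          Finset.sum_le_sum fun i _ => by
            rw [← mul_pow]; exact pow_le_pow_left₀ (norm_nonneg _) (h i) 2
      _ = K ^ 2 * ∑ i ∈ s, ‖(V i).starProjection w‖ ^ 2 := by rw [Finset.mul_sum]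
      _ ≤ K ^ 2 * ‖w‖ ^ 2 :=
          mul_le_mul_of_nonneg_left (sum_norm_sq_starProjection_le hV w s) (sq_nonneg K)
      _ = (K * ‖w‖) ^ 2 := by rw [mul_pow]
  have hs : Summable x := (hV.summable_iff_norm_sq_summable fun i => ⟨x i, hx i⟩).2
    (summable_of_sum_le (fun i => sq_nonneg _) hb)
  refine ⟨_, hs.hasSum, ?_⟩
  refine le_of_tendsto hs.hasSum.norm (Filter.Eventually.of_forall fun s => ?_)
  have h1 : ‖∑ i ∈ s, x i‖ ^ 2 = ∑ i ∈ s, ‖x i‖ ^ 2 := hV.norm_sum (fun i => ⟨x i, hx i⟩) s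
  exact abs_le_of_sq_le_sq' (h1 ▸ hb s) (by positivity) |>.2

theorem starProjection_of_hasSum
    (hV : OrthogonalFamily 𝕜 (fun i => V i) fun i => (V i).subtypeₗᵢ) {x : ι → H}
    (hx : ∀ i, x i ∈ V i) {y : H} (h : HasSum x y) (i : ι) : (V i).starProjection y = x i := by
  have h1 : HasSum (fun j => (V i).starProjection (x j)) ((V i).starProjection y) :=
    (V i).starProjection.hasSum h
  have h2 : HasSum (fun j => (V i).starProjection (x j)) ((V i).starProjection (x i)) :=
    hasSum_single i fun j hj => by
      rw [Submodule.starProjection_apply_eq_zero_iff, Submodule.mem_orthogonal]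
      exact fun v hv => hV.isOrtho hj.symm |>.inner_eq hv (hx j)
  rw [h1.unique h2]
  exact (V i).starProjection_eq_self_iff.2 (hx i)

end OrthogonalSeries

/-! ### The decomposition of `L²` into harmonics -/

/-- The space `ℋ_k ⊗ ℋ_ℓ` as a subspace of `L²`. -/
def harmL2 (i : ℕ × ℕ) : Submodule 𝕜 (Lp 𝕜 2 vol) := (tensorHarm 𝕜 i.1 i.2).map toL2

instance finite_harmL2 (i : ℕ × ℕ) : FiniteDimensional 𝕜 (harmL2 i : Submodule 𝕜 (Lp 𝕜 2 vol)) := by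
  unfold harmL2; infer_instance

theorem orthogonalFamily_harmL2 : OrthogonalFamily 𝕜
    (fun i => (harmL2 i : Submodule 𝕜 (Lp 𝕜 2 vol))) fun i => (harmL2 i).subtypeₗᵢ := by
  refine OrthogonalFamily.of_pairwise fun i j hij => ?_
  refine Submodule.isOrtho_iff_inner_eq.2 ?_
  rintro _ ⟨f, hf, rfl⟩ _ ⟨g, hg, rfl⟩
  exact inner_tensorHarm hf hg hij

/-- The orthogonal projection of `L²` to `ℋ_k ⊗ ℋ_ℓ`. -/
def proj (i : ℕ × ℕ) : Lp 𝕜 2 vol →L[𝕜] Lp 𝕜 2 vol := (harmL2 i).starProjection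

variable (𝕜) in
/-- The inclusion of `ℋ_k ⊗ ℋ_ℓ` in `L²`, as an isomorphism to its image. -/
def harmEquiv (k l : ℕ) :
    tensorHarm 𝕜 k l ≃ₗ[𝕜] (harmL2 (k, l) : Submodule 𝕜 (Lp 𝕜 2 vol)) :=
  Submodule.equivMapOfInjective toL2 toL2_injective (tensorHarm 𝕜 k l)

/-- The orthogonal projection of `L²` to `ℋ_k ⊗ ℋ_ℓ`, with values in smooth functions. -/
def harmProj (k l : ℕ) : Lp 𝕜 2 vol →ₗ[𝕜] tensorHarm 𝕜 k l :=
  (harmEquiv 𝕜 k l).symm.toLinearMap ∘ₗ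
    ((harmL2 (k, l) : Submodule 𝕜 (Lp 𝕜 2 vol)).orthogonalProjectionOnto).toLinearMap

theorem toL2_harmProj (k l : ℕ) (w : Lp 𝕜 2 vol) :
    toL2 (harmProj k l w).1 = proj (k, l) w :=
  congrArg Subtype.val ((harmEquiv 𝕜 k l).apply_symm_apply
    ((harmL2 (k, l) : Submodule 𝕜 (Lp 𝕜 2 vol)).orthogonalProjectionOnto w))

theorem proj_mem (i : ℕ × ℕ) (w : Lp 𝕜 2 vol) : proj i w ∈ harmL2 i :=
  (harmL2 i).starProjection_apply_mem w

theorem toL2_mem_harmL2 {i : ℕ × ℕ} {f : Smooth 𝕜} (hf : f ∈ tensorHarm 𝕜 i.1 i.2) :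
    toL2 f ∈ harmL2 i :=
  Submodule.mem_map_of_mem hf

theorem proj_of_mem {k l : ℕ} {f : Smooth 𝕜} (hf : f ∈ tensorHarm 𝕜 k l) :
    proj (k, l) (toL2 f) = toL2 f :=
  Submodule.starProjection_eq_self_iff.2 (toL2_mem_harmL2 (i := (k, l)) hf)

theorem proj_of_mem_of_ne {i j : ℕ × ℕ} (h : i ≠ j) {f : Smooth 𝕜} (hf : f ∈ tensorHarm 𝕜 i.1 i.2) :
    proj j (toL2 f) = 0 := by
  rw [proj, Submodule.starProjection_apply_eq_zero_iff, Submodule.mem_orthogonal]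
  rintro _ ⟨g, hg, rfl⟩
  exact inner_tensorHarm hg hf h.symm

theorem inner_proj_left (i : ℕ × ℕ) (v w : Lp 𝕜 2 vol) : ⟪proj i v, w⟫_𝕜 = ⟪v, proj i w⟫_𝕜 :=
  Submodule.inner_starProjection_left_eq_right _ _ _

theorem inner_toL2_proj {k l : ℕ} {f : Smooth 𝕜} (hf : f ∈ tensorHarm 𝕜 k l) (w : Lp 𝕜 2 vol) :
    ⟪toL2 f, proj (k, l) w⟫_𝕜 = ⟪toL2 f, w⟫_𝕜 := by
  rw [← inner_proj_left, proj_of_mem hf]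

theorem proj_eq_of_inner {k l : ℕ} {v w : Lp 𝕜 2 vol}
    (h : ∀ f ∈ tensorHarm 𝕜 k l, ⟪toL2 f, v⟫_𝕜 = ⟪toL2 f, w⟫_𝕜) :
    proj (k, l) v = proj (k, l) w := by
  rw [← sub_eq_zero, ← map_sub, proj, Submodule.starProjection_apply_eq_zero_iff,
    Submodule.mem_orthogonal]
  rintro _ ⟨f, hf, rfl⟩
  rw [inner_sub_right, h f hf, sub_self]

/-- An element of `L²` is determined by its harmonic components. -/
theorem ext_proj {v w : Lp 𝕜 2 vol} (h : ∀ k l, proj (k, l) v = proj (k, l) w) : v = w := by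
  rw [← sub_eq_zero]
  refine eq_zero_of_inner_tensorHarm fun k l f hf => ?_
  rw [← inner_toL2_proj hf, map_sub, h, sub_self, inner_zero_right]

theorem hasSum_proj (w : Lp 𝕜 2 vol) : HasSum (fun i => proj i w) w := by
  obtain ⟨y, hy, -⟩ := exists_hasSum_of_norm_le orthogonalFamily_harmL2 (w := w)
    (x := fun i => proj i w) (fun i => proj_mem i w) zero_le_one (fun i => by rw [one_mul]; rfl)
  have : y = w := ext_proj fun k l =>
    starProjection_of_hasSum orthogonalFamily_harmL2 (fun i => proj_mem i w) hy (k, l)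
  rwa [this] at hy

theorem inner_eq_of_proj {a b c d : Lp 𝕜 2 vol} (h : ∀ i, ⟪a, proj i b⟫_𝕜 = ⟪c, proj i d⟫_𝕜) :
    ⟪a, b⟫_𝕜 = ⟪c, d⟫_𝕜 := by
  have h1 := (innerSL 𝕜 a).hasSum (hasSum_proj b)
  have h2 := (innerSL 𝕜 c).hasSum (hasSum_proj d)
  simp only [innerSL_apply_apply, h] at h1 h2
  exact h1.unique h2

/-- On harmonics of bidegree `(k, ℓ)`, a symmetric operator acts on the component of a function
as it acts on harmonics. -/
theorem proj_toL2_of_symmetric {A : Smooth 𝕜 →ₗ[𝕜] Smooth 𝕜}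
    (hA : ∀ f g, ⟪toL2 (A f), toL2 g⟫_𝕜 = ⟪toL2 f, toL2 (A g)⟫_𝕜) {k l : ℕ}
    (hm : ∀ f ∈ tensorHarm 𝕜 k l, A f ∈ tensorHarm 𝕜 k l) (f : Smooth 𝕜) :
    proj (k, l) (toL2 (A f)) = toL2 (A (harmProj k l (toL2 f)).1) := by
  rw [← proj_of_mem (hm _ (harmProj k l (toL2 f)).2)]
  refine proj_eq_of_inner fun h hh => ?_
  rw [← hA, ← hA, toL2_harmProj, inner_toL2_proj (hm _ hh)]

/-! ### Powers of `1 - Δ` -/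

/-- The operator `1 - Δ` on smooth functions. -/
def helm : Smooth 𝕜 →ₗ[𝕜] Smooth 𝕜 := LinearMap.id - (lapSide Sum.inl + lapSide Sum.inr)

/-- The eigenvalue of `1 - Δ` on `ℋ_k ⊗ ℋ_ℓ`. -/
def weight (i : ℕ × ℕ) : ℝ := 1 + (eig i.1 + eig i.2)

theorem one_le_weight (i : ℕ × ℕ) : 1 ≤ weight i := by
  have := eig_nonneg i.1
  have := eig_nonneg i.2
  unfold weight
  linarith

theorem weight_pos (i : ℕ × ℕ) : 0 < weight i := one_pos.trans_le (one_le_weight i)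

theorem lapSides_of_mem {k l : ℕ} {f : Smooth 𝕜} (hf : f ∈ tensorHarm 𝕜 k l) :
    lapSide Sum.inl f + lapSide Sum.inr f = (-((eig k + eig l : ℝ) : 𝕜)) • f := by
  rw [lapSide_inl_of_mem hf, lapSide_inr_of_mem hf, ← add_smul]
  push_cast
  congr 1
  ring

theorem proj_toL2_lapSides (k l : ℕ) (f : Smooth 𝕜) :
    proj (k, l) (toL2 (lapSide Sum.inl f + lapSide Sum.inr f))
      = (-((eig k + eig l : ℝ) : 𝕜)) • proj (k, l) (toL2 f) := by
  have h := proj_toL2_of_symmetric (A := lapSide Sum.inl + lapSide Sum.inr)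
    (k := k) (l := l) (fun f g => by
      simp only [LinearMap.add_apply, map_add, inner_add_left, inner_add_right, inner_lapSide])
    (fun f hf => by
      rw [LinearMap.add_apply, lapSides_of_mem hf]
      exact Submodule.smul_mem _ _ hf) f
  rw [LinearMap.add_apply, LinearMap.add_apply, lapSides_of_mem (harmProj k l (toL2 f)).2, map_smul,
    toL2_harmProj] at h
  exact h

theorem proj_toL2_helm_pow (i : ℕ × ℕ) (m : ℕ) (f : Smooth 𝕜) :
    proj i (toL2 ((helm ^ m) f)) = ((weight i ^ m : ℝ) : 𝕜) • proj i (toL2 f) := by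
  induction m with
  | zero => simp
  | succ m ih =>
    rw [pow_succ', Module.End.mul_apply, helm, LinearMap.sub_apply, LinearMap.id_apply, map_sub,
      map_sub, LinearMap.add_apply, ← helm, proj_toL2_lapSides, ih, smul_smul, ← sub_smul, weight]
    push_cast
    congr 1
    ring

/-- The operator `(1 - Δ)^m` is bounded from the `C^{2m}` norm to the supremum norm. -/
theorem norm_helm_pow_le (m : ℕ) (f : Smooth 𝕜) {B : ℝ}
    (h : ∀ w : List (Fin 3 ⊕ Fin 3), w.length ≤ 2 * m → ∀ p, ‖vfs w f.1 p‖ ≤ B) (p : M) :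
    ‖((helm ^ m) f).1 p‖ ≤ 7 ^ m * B := by
  induction m generalizing f B with
  | zero => simpa [vfs] using h [] (by simp) p
  | succ m ih =>
    rw [pow_succ, Module.End.mul_apply, pow_succ, mul_assoc]
    refine ih (helm f) fun w hw p => ?_
    have e : vfs w (helm f).1 p = vfs w f.1 p - ∑ a, vfs (w ++ [a, a]) f.1 p := by
      have e1 : ∀ a, (vfsS (w ++ [a, a]) f).1 = (vfsS w (vfS a (vfS a f))).1 := fun a => by
        simp [vfs]
      have e2 : helm f = f - ∑ a, vfS a (vfS a f) := by
        simp [helm, lapSide]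
      simp only [← vfsS_coe, e1]
      rw [e2, map_sub, map_sum]
      simp
    rw [e]
    have h1 : ‖∑ a, vfs (w ++ [a, a]) f.1 p‖ ≤ ∑ _a : Fin 3 ⊕ Fin 3, B :=
      norm_sum_le_of_le _ fun a _ => h _ (by simp; omega) p
    have h2 := h w (by omega) p
    have h3 : ∑ _a : Fin 3 ⊕ Fin 3, B = 6 * B := by simp
    calc _ ≤ ‖vfs w f.1 p‖ + ‖∑ a, vfs (w ++ [a, a]) f.1 p‖ := norm_sub_le _ _
      _ ≤ B + 6 * B := add_le_add h2 (h1.trans h3.le)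
      _ = 7 * B := by ring

/-- The order of differentiation that controls `(1 - Δ)^{r/2}`. -/
def order (r : ℝ) : ℕ := ⌈r / 2⌉₊

/-- For smooth `f` the series that defines `(1 - Δ)^{r/2} f` converges, and it is dominated by an
integer power of `1 - Δ`, since the eigenvalues of `1 - Δ` are at least `1`. -/
theorem exists_bessel (r : ℝ) (f : Smooth 𝕜) : ∃ y : Lp 𝕜 2 vol,
    (∀ i, proj i y = ((weight i ^ (r / 2) : ℝ) : 𝕜) • proj i (toL2 f)) ∧
      ‖y‖ ≤ ‖toL2 ((helm ^ order r) f)‖ := by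
  have hmem : ∀ i, ((weight i ^ (r / 2) : ℝ) : 𝕜) • proj i (toL2 f) ∈ harmL2 i := fun i =>
    Submodule.smul_mem _ _ (proj_mem i _)
  obtain ⟨y, hy, hn⟩ := exists_hasSum_of_norm_le orthogonalFamily_harmL2
    (w := toL2 ((helm ^ order r) f)) hmem zero_le_one (fun i => by
      change _ ≤ 1 * ‖proj i _‖
      rw [one_mul, proj_toL2_helm_pow, norm_smul, norm_smul]
      refine mul_le_mul_of_nonneg_right ?_ (norm_nonneg _)
      have h0 := weight_pos i
      rw [RCLike.norm_ofReal, RCLike.norm_ofReal, abs_of_pos (by positivity),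
        abs_of_pos (by positivity), ← Real.rpow_natCast]
      exact Real.rpow_le_rpow_of_exponent_le (one_le_weight i) (Nat.le_ceil _))
  rw [one_mul] at hn
  exact ⟨y, fun i => starProjection_of_hasSum orthogonalFamily_harmL2 hmem hy i, hn⟩

/-- The value of the operator `(1 - Δ)^{r/2}` at a smooth function. -/
def besselFun (r : ℝ) (f : Smooth 𝕜) : Lp 𝕜 2 vol := (exists_bessel r f).choose

theorem proj_besselFun (r : ℝ) (f : Smooth 𝕜) (i : ℕ × ℕ) :
    proj i (besselFun r f) = ((weight i ^ (r / 2) : ℝ) : 𝕜) • proj i (toL2 f) :=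
  (exists_bessel r f).choose_spec.1 i

/-- The operator `(1 - Δ)^{r/2}` from smooth functions to `L²`, defined by its action on the
harmonic components. -/
def besselS (r : ℝ) : Smooth 𝕜 →ₗ[𝕜] Lp 𝕜 2 vol where
  toFun := besselFun r
  map_add' f g := ext_proj fun k l => by
    simp only [map_add, proj_besselFun, smul_add]
  map_smul' c f := ext_proj fun k l => by
    simp only [map_smul, proj_besselFun, RingHom.id_apply]
    exact smul_comm _ _ _

theorem proj_besselS (r : ℝ) (f : Smooth 𝕜) (i : ℕ × ℕ) :
    proj i (besselS r f) = ((weight i ^ (r / 2) : ℝ) : 𝕜) • proj i (toL2 f) :=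
  proj_besselFun r f i

theorem norm_besselS_le (r : ℝ) (f : Smooth 𝕜) :
    ‖besselS r f‖ ≤ ‖toL2 ((helm ^ order r) f)‖ :=
  (exists_bessel r f).choose_spec.2

/-- On an arbitrary eigenfunction of `Δ` the operator `(1 - Δ)^{r/2}` is the expected scalar: the
only harmonic components of the eigenfunction are those with the same eigenvalue. -/
theorem besselS_of_eigen (r : ℝ) {μ : ℝ} {f : Smooth 𝕜}
    (hf : ∀ p, lap f.1 p = -(μ : 𝕜) * f.1 p) :
    besselS r f = (((1 + μ) ^ (r / 2) : ℝ) : 𝕜) • toL2 f := by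
  have h1 : lapSide Sum.inl f + lapSide Sum.inr f = (-(μ : 𝕜)) • f := by
    apply Subtype.ext
    rw [← lap_eq]
    funext p
    exact hf p
  refine ext_proj fun k l => ?_
  have h2 := proj_toL2_lapSides k l f
  rw [h1, map_smul, map_smul] at h2
  rw [proj_besselS, map_smul]
  by_cases h3 : μ = eig k + eig l
  · rw [weight, h3]
  · have h4 : ((eig k + eig l - μ : ℝ) : 𝕜) • proj (k, l) (toL2 f) = 0 := by
      push_cast at h2 ⊢
      rw [sub_smul, sub_eq_zero]
      rw [neg_smul, neg_smul] at h2
      exact (neg_injective h2).symm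
    rcases smul_eq_zero.1 h4 with h5 | h5
    · exact absurd (sub_eq_zero.1 (RCLike.ofReal_eq_zero.1 h5)).symm h3
    · rw [h5, smul_zero, smul_zero]

theorem lap_of_mem {k l : ℕ} {f : Smooth 𝕜} (hf : f ∈ tensorHarm 𝕜 k l) (p : M) :
    lap f.1 p = -((eig k + eig l : ℝ) : 𝕜) * f.1 p := by
  rw [lap_eq, lapSides_of_mem hf]
  rfl

theorem besselS_of_mem (r : ℝ) {k l : ℕ} {f : Smooth 𝕜} (hf : f ∈ tensorHarm 𝕜 k l) :
    besselS r f = ((weight (k, l) ^ (r / 2) : ℝ) : 𝕜) • toL2 f :=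
  besselS_of_eigen r (lap_of_mem hf)

/-- In `L²` pairings the operators `(1 - Δ)^{-r/2}` and `(1 - Δ)^{r/2}` cancel. -/
theorem inner_besselS (r : ℝ) (f g : Smooth 𝕜) :
    ⟪besselS (-r) f, besselS r g⟫_𝕜 = ⟪toL2 f, toL2 g⟫_𝕜 := by
  refine inner_eq_of_proj fun i => ?_
  rw [proj_besselS, inner_smul_right, ← inner_proj_left, proj_besselS, inner_smul_left,
    RCLike.conj_ofReal, ← mul_assoc, ← RCLike.ofReal_mul, ← Real.rpow_add (weight_pos i),
    inner_proj_left]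
  rw [show r / 2 + -r / 2 = 0 by ring]
  simp

/-! ### The Sobolev spaces as copies of `L²` -/

theorem smoothConj_add (f g : Smooth 𝕜) : smoothConj (f + g) = smoothConj f + smoothConj g :=
  Subtype.ext (funext fun _ => map_add _ _ _)

theorem smoothConj_smul (c : 𝕜) (f : Smooth 𝕜) :
    smoothConj (c • f) = (starRingEnd 𝕜) c • smoothConj f :=
  Subtype.ext (funext fun _ => map_mul _ _ _)

theorem vfs_smoothConj (w : List (Fin 3 ⊕ Fin 3)) (f : Smooth 𝕜) :
    vfs w (smoothConj f).1 = fun p => (starRingEnd 𝕜) (vfs w f.1 p) := by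
  induction w with
  | nil => rfl
  | cons a w ih =>
    change vf a (vfs w (smoothConj f).1) = _
    have e : vfs w (smoothConj f).1 = (smoothConj (vfsS w f)).1 := by
      rw [ih, ← vfsS_coe]; rfl
    rw [e, ← vfS_coe, vfS_conj]
    change (fun p => (starRingEnd 𝕜) (vf a (vfsS w f).1 p)) = _
    rw [vfsS_coe]
    rfl

theorem lap_smoothConj {μ : ℝ} {f : Smooth 𝕜} (hf : ∀ p, lap f.1 p = -(μ : 𝕜) * f.1 p) (p : M) :
    lap (smoothConj f).1 p = -(μ : 𝕜) * (smoothConj f).1 p := by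
  have h : lap (smoothConj f).1 p = (starRingEnd 𝕜) (lap f.1 p) := by
    simp only [lap, map_sum]
    exact Finset.sum_congr rfl fun a _ => congrFun (vfs_smoothConj [a, a] f) p
  rw [h, hf, map_mul, map_neg, RCLike.conj_ofReal]
  rfl

theorem opT_smoothConj (f : Smooth 𝕜) : opT 𝕜 (smoothConj f) = smoothConj (opT 𝕜 f) :=
  Subtype.ext (funext fun _ => integral_conj)

/-- The distribution `(1 - Δ)^{-s/2} w`, for `w ∈ L²`. -/
def distOf (s : ℝ) (w : Lp 𝕜 2 vol) : Dist 𝕜 :=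
  ⟨{ toFun := fun φ => ⟪besselS (-s) (smoothConj φ), w⟫_𝕜
     map_add' := fun φ ψ => by rw [smoothConj_add, map_add, inner_add_left]
     map_smul' := fun c φ => by
      rw [smoothConj_smul, map_smul, inner_smul_left, RCLike.conj_conj]; rfl }, by
    refine ⟨2 * order (-s), 7 ^ order (-s) * ‖w‖, by positivity, fun φ B hB => ?_⟩
    have h1 : ‖besselS (-s) (smoothConj φ)‖ ≤ 7 ^ order (-s) * B := by
      refine (norm_besselS_le _ _).trans (norm_toL2_le _ fun p => ?_)
      refine norm_helm_pow_le _ _ (fun v hv q => ?_) p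
      rw [vfs_smoothConj, RCLike.norm_conj]
      exact hB v hv q
    calc ‖⟪besselS (-s) (smoothConj φ), w⟫_𝕜‖ ≤ ‖besselS (-s) (smoothConj φ)‖ * ‖w‖ :=
          norm_inner_le_norm _ _
      _ ≤ 7 ^ order (-s) * B * ‖w‖ := mul_le_mul_of_nonneg_right h1 (norm_nonneg _)
      _ = 7 ^ order (-s) * ‖w‖ * B := by ring⟩

theorem distOf_apply (s : ℝ) (w : Lp 𝕜 2 vol) (φ : Smooth 𝕜) :
    (distOf s w).1 φ = ⟪besselS (-s) (smoothConj φ), w⟫_𝕜 := rfl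

/-- The pair of the distribution `(1 - Δ)^{-s/2} w` and `w` is an element of `H^s`. -/
theorem distOf_mem (s : ℝ) (w : Lp 𝕜 2 vol) :
    ((distOf s w, w) : Dist 𝕜 × Lp 𝕜 2 vol) ∈ (sobGraph 𝕜 s).carrier := by
  intro μ φ hμ hφ
  change (((1 + μ) ^ (s / 2) : ℝ) : 𝕜) * (distOf s w).1 φ = ∫ p, w p * φ.1 p ∂vol
  have h0 : 0 < 1 + μ := by linarith
  rw [distOf_apply, integral_mul_smooth, besselS_of_eigen _ (lap_smoothConj hφ), inner_smul_left,
    RCLike.conj_ofReal, ← mul_assoc, ← RCLike.ofReal_mul, ← Real.rpow_add h0]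
  rw [show s / 2 + -s / 2 = 0 by ring]
  simp

theorem Sob.spec {s : ℝ} (u : Sob 𝕜 s) {μ : ℝ} (hμ : 0 ≤ μ) {φ : Smooth 𝕜}
    (hφ : ∀ p, lap φ.1 p = -(μ : 𝕜) * φ.1 p) :
    (((1 + μ) ^ (s / 2) : ℝ) : 𝕜) * (Sob.dist u).1 φ = ⟪toL2 (smoothConj φ), Sob.bessel u⟫_𝕜 := by
  rw [← integral_mul_smooth]
  exact u.2 μ φ hμ hφ

/-- A distribution that vanishes on harmonics vanishes. -/
theorem dist_eq_zero {d : Dist 𝕜} (h : ∀ k l, ∀ f ∈ tensorHarm 𝕜 k l, d.1 f = 0) : d = 0 := by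
  have h1 : (allHarm : Submodule 𝕜 (Smooth 𝕜)) ≤ LinearMap.ker d.1 :=
    iSup_le fun i f hf => h i.1 i.2 f hf
  apply Subtype.ext
  apply LinearMap.ext
  intro φ
  obtain ⟨N, C, hC, hd⟩ := d.2
  change d.1 φ = 0
  rw [← norm_eq_zero]
  refine le_antisymm (le_of_forall_pos_le_add fun ε hε => ?_) (norm_nonneg _)
  obtain ⟨f, hf, hb⟩ := exists_harmonic_near φ N (ε := ε / (C + 1)) (by positivity)
  have h2 := hd (φ - f) _ hb
  rw [map_sub, h1 hf, sub_zero] at h2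
  rw [zero_add]
  refine h2.trans ?_
  rw [← mul_div_assoc, div_le_iff₀ (by positivity)]
  nlinarith

theorem bessel_injective (s : ℝ) : Function.Injective (Sob.bessel : Sob 𝕜 s →ₗ[𝕜] Lp 𝕜 2 vol) := by
  rw [← LinearMap.ker_eq_bot, LinearMap.ker_eq_bot']
  intro u hu
  have hd : Sob.dist u = 0 := dist_eq_zero fun k l f hf => by
    have h := Sob.spec u (add_nonneg (eig_nonneg k) (eig_nonneg l)) (lap_of_mem hf)
    rw [hu, inner_zero_right] at h
    rcases mul_eq_zero.1 h with h | h
    · have h0 : 0 < 1 + (eig k + eig l) := weight_pos (k, l)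
      rw [RCLike.ofReal_eq_zero] at h
      exact absurd h (by positivity)
    · exact h
  exact Subtype.ext (Prod.ext hd hu)

theorem bessel_surjective (s : ℝ) :
    Function.Surjective (Sob.bessel : Sob 𝕜 s →ₗ[𝕜] Lp 𝕜 2 vol) := fun w =>
  ⟨(⟨((distOf s w, w) : Dist 𝕜 × Lp 𝕜 2 vol), distOf_mem s w⟩ : sobGraph 𝕜 s), rfl⟩

variable (𝕜) in
/-- The isomorphism `(1 - Δ)^{s/2}` from `H^s` to `L²`. -/
def besselE (s : ℝ) : Sob 𝕜 s ≃ₗ[𝕜] Lp 𝕜 2 vol :=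
  LinearEquiv.ofBijective Sob.bessel ⟨bessel_injective s, bessel_surjective s⟩

theorem bessel_symm {s : ℝ} (w : Lp 𝕜 2 vol) : Sob.bessel ((besselE 𝕜 s).symm w) = w :=
  (besselE 𝕜 s).apply_symm_apply w

theorem dist_eq_distOf {s : ℝ} (u : Sob 𝕜 s) : Sob.dist u = distOf s (Sob.bessel u) := by
  let v : Sob 𝕜 s :=
    (⟨((distOf s (Sob.bessel u), Sob.bessel u) : Dist 𝕜 × Lp 𝕜 2 vol), distOf_mem s _⟩ :
      sobGraph 𝕜 s)
  have h : u = v := bessel_injective s rfl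
  exact congrArg Sob.dist h

theorem isometry_bessel (s : ℝ) : Isometry (Sob.bessel : Sob 𝕜 s →ₗ[𝕜] Lp 𝕜 2 vol) :=
  AddMonoidHomClass.isometry_of_norm _ fun _ => rfl

theorem isInducing_bessel (s : ℝ) :
    Topology.IsInducing (Sob.bessel : Sob 𝕜 s →ₗ[𝕜] Lp 𝕜 2 vol) :=
  (isometry_bessel s).isUniformInducing.isInducing

variable (𝕜) in
/-- The inclusion of `C^∞` in `H^s`. -/
def incl (s : ℝ) : Smooth 𝕜 →ₗ[𝕜] Sob 𝕜 s := (besselE 𝕜 s).symm.toLinearMap ∘ₗ besselS s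

theorem bessel_incl (s : ℝ) (f : Smooth 𝕜) : Sob.bessel (incl 𝕜 s f) = besselS s f :=
  bessel_symm _

theorem isInclusion_incl (s : ℝ) : IsInclusion (incl 𝕜 s) := by
  intro f φ
  rw [dist_eq_distOf, bessel_incl, distOf_apply, inner_besselS, inner_toL2_toL2, innerL2]
  refine integral_congr_ae (Filter.Eventually.of_forall fun p => ?_)
  simp [smoothConj, mul_comm]

/-- The closure in `H^s` of a sum of spaces `ℋ_k ⊗ ℋ_ℓ` is determined by the vanishing of the
remaining harmonic components. -/
theorem mem_topologicalClosure_iff {s : ℝ} {U : Submodule 𝕜 (Sob 𝕜 s)} {S : ℕ → ℕ → Prop}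
    (h1 : ∀ k l, S k l → (tensorHarm 𝕜 k l).map (incl 𝕜 s) ≤ U)
    (h2 : ∀ k l, ¬S k l → ∀ u ∈ U, proj (k, l) (Sob.bessel u) = 0) (u : Sob 𝕜 s) :
    u ∈ U.topologicalClosure ↔ ∀ k l, ¬S k l → proj (k, l) (Sob.bessel u) = 0 := by
  have hc := (isometry_bessel (𝕜 := 𝕜) s).continuous
  constructor
  · intro hu k l hkl
    have hcl : IsClosed {u : Sob 𝕜 s | proj (k, l) (Sob.bessel u) = 0} :=
      isClosed_eq ((proj (k, l)).continuous.comp hc) continuous_const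
    exact closure_minimal (fun v hv => h2 k l hkl v hv) hcl hu
  · intro hu
    change u ∈ closure (U : Set (Sob 𝕜 s))
    rw [(isInducing_bessel s).closure_eq_preimage_closure_image, Set.mem_preimage]
    refine mem_closure_of_tendsto (hasSum_proj (Sob.bessel u))
      (Filter.Eventually.of_forall fun t => ?_)
    have hmem : ∑ i ∈ t, proj i (Sob.bessel u) ∈ U.map Sob.bessel := by
      refine Submodule.sum_mem _ fun i _ => ?_
      by_cases hi : S i.1 i.2
      · have h0 := weight_pos i
        refine ⟨incl 𝕜 s (((weight i ^ (s / 2) : ℝ) : 𝕜)⁻¹ •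
          (harmProj i.1 i.2 (Sob.bessel u)).1), h1 _ _ hi ⟨_, Submodule.smul_mem _ _
            (harmProj i.1 i.2 (Sob.bessel u)).2, rfl⟩, ?_⟩
        rw [map_smul, map_smul, bessel_incl, besselS_of_mem _ (harmProj i.1 i.2 _).2,
          toL2_harmProj, smul_smul, inv_mul_cancel₀, one_smul]
        rw [Ne, RCLike.ofReal_eq_zero]
        positivity
      · rw [show proj i (Sob.bessel u) = 0 from hu i.1 i.2 hi]
        exact Submodule.zero_mem _
    exact hmem

/-! ### The reflections -/

variable (𝕜) in
/-- The reflection `R_k = (k+1) T` of `ℋ_k ⊗ ℋ_k`. -/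
def reflection (k : ℕ) : tensorHarm 𝕜 k k →ₗ[𝕜] tensorHarm 𝕜 k k :=
  ((k : 𝕜) + 1) • (opT 𝕜).restrict fun _ hf => opT_mem hf

theorem reflection_coe (k : ℕ) (f : tensorHarm 𝕜 k k) :
    (reflection 𝕜 k f).1 = ((k : 𝕜) + 1) • opT 𝕜 f.1 := rfl

theorem reflection_reflection (k : ℕ) (f : tensorHarm 𝕜 k k) :
    reflection 𝕜 k (reflection 𝕜 k f) = f := by
  apply Subtype.ext
  have h : (k : 𝕜) + 1 ≠ 0 := Nat.cast_add_one_ne_zero k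
  rw [reflection_coe, reflection_coe, map_smul, opT_opT_of_mem f.2, smul_smul, smul_smul]
  rw [show ((k : 𝕜) + 1) * ((k : 𝕜) + 1) * (((k : 𝕜) + 1) ^ 2)⁻¹ = 1 by field_simp, one_smul]

theorem inner_reflection (k : ℕ) (f h : tensorHarm 𝕜 k k) :
    ⟪toL2 (reflection 𝕜 k f).1, toL2 h.1⟫_𝕜 = ⟪toL2 f.1, toL2 (reflection 𝕜 k h).1⟫_𝕜 := by
  rw [reflection_coe, reflection_coe, map_smul, map_smul, inner_smul_left, inner_smul_right,
    inner_opT]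
  simp

theorem norm_reflection (k : ℕ) (f : tensorHarm 𝕜 k k) :
    ‖toL2 (reflection 𝕜 k f).1‖ = ‖toL2 f.1‖ := by
  rw [@norm_eq_sqrt_re_inner 𝕜, @norm_eq_sqrt_re_inner 𝕜 _ _ _ _ (toL2 f.1), inner_reflection,
    reflection_reflection]

/-- Bounded coefficients define a bounded operator `∑ c_k R_k E_{k,k}`, since the terms of the
series are orthogonal and dominated by the expansion of the argument. -/
theorem exists_reflSum (c : ℕ → ℝ) {K : ℝ} (hK : 0 ≤ K) (hc : ∀ k, |c k| ≤ K) :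
    ∃ B : Lp 𝕜 2 vol →L[𝕜] Lp 𝕜 2 vol, ∀ w,
      HasSum (fun k => (c k : 𝕜) • toL2 (reflection 𝕜 k (harmProj k k w)).1) (B w) := by
  have hV := (orthogonalFamily_harmL2 (𝕜 := 𝕜)).comp (γ := ℕ) (f := fun k => (k, k))
    fun k l h => (Prod.mk.inj h).1
  have h := fun w => exists_hasSum_of_norm_le hV (w := w)
    (x := fun k => (c k : 𝕜) • toL2 (reflection 𝕜 k (harmProj k k w)).1)
    (fun k => Submodule.smul_mem _ _ (toL2_mem_harmL2 (i := (k, k)) (reflection 𝕜 k _).2)) hK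
    (fun k => by
      rw [norm_smul, norm_reflection, toL2_harmProj, RCLike.norm_ofReal]
      exact mul_le_mul_of_nonneg_right (hc k) (norm_nonneg _))
  choose B hB hn using h
  refine ⟨LinearMap.mkContinuous ⟨⟨B, fun v w => ?_⟩, fun a w => ?_⟩ K hn, hB⟩
  · refine (hB (v + w)).unique ?_
    convert (hB v).add (hB w) using 1
    funext k
    simp only [map_add, Submodule.coe_add, smul_add]
  · refine (hB (a • w)).unique (?_ : HasSum _ (a • B w))
    convert (hB w).const_smul a using 1
    funext k
    simp only [map_smul, Submodule.coe_smul]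
    exact smul_comm _ _ _

variable (𝕜) in
/-- The operator `∑ c_k R_k E_{k,k}` on `L²`, for a bounded sequence `c`. -/
def reflSum (c : ℕ → ℝ) (hc : ∀ k, |c k| ≤ 2) : Lp 𝕜 2 vol →L[𝕜] Lp 𝕜 2 vol :=
  (exists_reflSum c zero_le_two hc).choose

section ReflSum

variable {c : ℕ → ℝ} (hc : ∀ k, |c k| ≤ 2)

theorem hasSum_reflSum (w : Lp 𝕜 2 vol) :
    HasSum (fun k => (c k : 𝕜) • toL2 (reflection 𝕜 k (harmProj k k w)).1) (reflSum 𝕜 c hc w) :=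
  (exists_reflSum c zero_le_two hc).choose_spec w

theorem proj_reflSum (k : ℕ) (w : Lp 𝕜 2 vol) :
    proj (k, k) (reflSum 𝕜 c hc w) = (c k : 𝕜) • toL2 (reflection 𝕜 k (harmProj k k w)).1 := by
  refine ((proj (k, k)).hasSum (hasSum_reflSum hc w)).unique ?_
  convert hasSum_single k fun j hj => ?_ using 1
  · rw [map_smul, proj_of_mem (reflection 𝕜 k _).2]
  · rw [map_smul, proj_of_mem_of_ne (i := (j, j)) (by simpa using hj) (reflection 𝕜 j _).2,
      smul_zero]

theorem proj_reflSum_of_ne {k l : ℕ} (h : k ≠ l) (w : Lp 𝕜 2 vol) :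
    proj (k, l) (reflSum 𝕜 c hc w) = 0 := by
  refine ((proj (k, l)).hasSum (hasSum_reflSum hc w)).unique ?_
  convert hasSum_zero with j
  rw [map_smul, proj_of_mem_of_ne (i := (j, j)) (fun e => h ?_) (reflection 𝕜 j _).2, smul_zero]
  rw [← (Prod.mk.inj e).1, ← (Prod.mk.inj e).2]

theorem inner_reflSum (v w : Lp 𝕜 2 vol) :
    ⟪reflSum 𝕜 c hc v, w⟫_𝕜 = ⟪v, reflSum 𝕜 c hc w⟫_𝕜 := by
  refine inner_eq_of_proj fun i => ?_
  obtain ⟨k, l⟩ := i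
  rw [← inner_proj_left]
  by_cases h : k = l
  · subst h
    rw [proj_reflSum, proj_reflSum, inner_smul_left, inner_smul_right, RCLike.conj_ofReal,
      ← inner_toL2_proj (reflection 𝕜 k _).2, ← toL2_harmProj, inner_reflection, toL2_harmProj,
      inner_proj_left, proj_of_mem (reflection 𝕜 k _).2]
  · rw [proj_reflSum_of_ne hc h, proj_reflSum_of_ne hc h, inner_zero_left, inner_zero_right]

/-- Two such operators with inverse coefficients are inverse to each other on the closure of
`⨁ ℋ_k ⊗ ℋ_k`. -/
theorem reflSum_reflSum {d : ℕ → ℝ} (hd : ∀ k, |d k| ≤ 2) (hcd : ∀ k, c k * d k = 1)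
    {w : Lp 𝕜 2 vol} (hw : ∀ k l, k ≠ l → proj (k, l) w = 0) :
    reflSum 𝕜 c hc (reflSum 𝕜 d hd w) = w := by
  refine ext_proj fun k l => ?_
  by_cases h : k = l
  · subst h
    have e : harmProj k k (reflSum 𝕜 d hd w) = (d k : 𝕜) • reflection 𝕜 k (harmProj k k w) := by
      apply Subtype.ext
      apply toL2_injective
      rw [toL2_harmProj, proj_reflSum]
      rfl
    rw [proj_reflSum, e, map_smul, reflection_reflection, Submodule.coe_smul, map_smul, smul_smul,
      ← RCLike.ofReal_mul, hcd, RCLike.ofReal_one, one_smul, toL2_harmProj]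
  · rw [proj_reflSum_of_ne hc h, hw k l h]

end ReflSum

/-! ### The operator between Sobolev spaces -/

/-- The coefficients of `T`, conjugated by `(1 - Δ)^{s/2}` on the right and by
`(1 - Δ)^{(s+1)/2}` on the left. They are bounded since `(1 - Δ)^{1/2}` is comparable to `k + 1` on
`ℋ_k ⊗ ℋ_k`, and this is where the gain of one derivative comes from. -/
def gain (k : ℕ) : ℝ := weight (k, k) ^ (1 / 2 : ℝ) / (k + 1)

theorem gain_pos (k : ℕ) : 0 < gain k :=
  div_pos (Real.rpow_pos_of_pos (weight_pos _) _) (by positivity)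

theorem gain_le (k : ℕ) : |gain k| ≤ 2 := by
  rw [abs_of_pos (gain_pos k), gain, div_le_iff₀ (by positivity), ← Real.sqrt_eq_rpow,
    Real.sqrt_le_left (by positivity), weight, eig]
  nlinarith [Nat.cast_nonneg (α := ℝ) k]

theorem gain_inv_le (k : ℕ) : |(gain k)⁻¹| ≤ 2 := by
  rw [abs_of_pos (inv_pos.2 (gain_pos k)), gain, inv_div, ← Real.sqrt_eq_rpow,
    div_le_iff₀ (Real.sqrt_pos.2 (weight_pos _)), ← div_le_iff₀' two_pos]
  refine Real.le_sqrt_of_sq_le ?_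
  rw [weight, eig]
  nlinarith [Nat.cast_nonneg (α := ℝ) k]

variable (𝕜) in
/-- The operator on `L²` that corresponds to `T : H^s → H^{s+1}`; it does not depend on `s`. -/
def opL2 : Lp 𝕜 2 vol →L[𝕜] Lp 𝕜 2 vol := reflSum 𝕜 gain gain_le

theorem harmProj_besselS (s : ℝ) (k l : ℕ) (f : Smooth 𝕜) : harmProj k l (besselS s f)
    = ((weight (k, l) ^ (s / 2) : ℝ) : 𝕜) • harmProj k l (toL2 f) := by
  apply Subtype.ext
  apply toL2_injective
  rw [toL2_harmProj, proj_besselS, Submodule.coe_smul, map_smul, toL2_harmProj]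

theorem opL2_besselS (s : ℝ) (f : Smooth 𝕜) :
    opL2 𝕜 (besselS s f) = besselS (s + 1) (opT 𝕜 f) := by
  refine ext_proj fun k l => ?_
  rw [proj_besselS, proj_toL2_of_symmetric inner_opT fun f hf => opT_mem hf]
  by_cases h : k = l
  · subst h
    have hk : (k : 𝕜) + 1 ≠ 0 := Nat.cast_add_one_ne_zero k
    rw [opL2, proj_reflSum, harmProj_besselS, map_smul, Submodule.coe_smul, reflection_coe,
      map_smul, map_smul, smul_smul, smul_smul, gain, show (s + 1) / 2 = 1 / 2 + s / 2 by ring,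
      Real.rpow_add (weight_pos _)]
    congr 1
    push_cast
    field_simp
  · rw [opL2, proj_reflSum_of_ne _ h, opT_of_mem_of_ne h (harmProj k l _).2, map_zero, smul_zero]

theorem opL2_eq_zero_iff (w : Lp 𝕜 2 vol) : opL2 𝕜 w = 0 ↔ ∀ k, proj (k, k) w = 0 := by
  constructor
  · intro h k
    have h1 := proj_reflSum gain_le k w
    rw [← opL2, h, map_zero] at h1
    have h2 := (smul_eq_zero.1 h1.symm).resolve_left (by
      rw [RCLike.ofReal_eq_zero]; exact (gain_pos k).ne')
    rw [← norm_eq_zero, norm_reflection, norm_eq_zero, toL2_harmProj] at h2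
    exact h2
  · intro h
    have h0 : ∀ k, harmProj k k w = 0 := fun k => by
      apply Subtype.ext
      apply toL2_injective
      rw [toL2_harmProj, h]
      exact (map_zero toL2).symm
    refine (hasSum_reflSum gain_le w).unique ?_
    convert hasSum_zero with k
    rw [h0, map_zero, Submodule.coe_zero, map_zero, smul_zero]

variable (𝕜) in
/-- The operator `T` from `H^s` to `H^{s+1}`. -/
def opSob (s : ℝ) : Sob 𝕜 s →L[𝕜] Sob 𝕜 (s + 1) :=
  LinearMap.mkContinuous
    ((besselE 𝕜 (s + 1)).symm.toLinearMap ∘ₗ (opL2 𝕜).toLinearMap ∘ₗ Sob.bessel) ‖opL2 𝕜‖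
    fun u => by
      change ‖Sob.bessel ((besselE 𝕜 (s + 1)).symm (opL2 𝕜 (Sob.bessel u)))‖ ≤ _
      rw [bessel_symm]
      exact (opL2 𝕜).le_opNorm _

theorem bessel_opSob (s : ℝ) (u : Sob 𝕜 s) : Sob.bessel (opSob 𝕜 s u) = opL2 𝕜 (Sob.bessel u) :=
  bessel_symm _

/-- The weak form of `T u`: the operator `opL2` is symmetric, and `(1 - Δ)^{-(s+1)/2}` followed by
`opL2` is `(1 - Δ)^{-s/2}` after `T` on smooth functions. -/
theorem isWeakT_opSob (s : ℝ) : IsWeakT (opSob 𝕜 s) := by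
  intro u φ
  rw [dist_eq_distOf, dist_eq_distOf, bessel_opSob, distOf_apply, distOf_apply, opL2,
    ← inner_reflSum, ← opL2, opL2_besselS, opT_smoothConj]
  rw [show -(s + 1) + 1 = -s by ring]

theorem opSob_incl (s : ℝ) (f : Smooth 𝕜) :
    opSob 𝕜 s (incl 𝕜 s f) = incl 𝕜 (s + 1) (opT 𝕜 f) := by
  apply bessel_injective
  rw [bessel_opSob, bessel_incl, bessel_incl, opL2_besselS]

theorem proj_bessel_incl_of_ne {s : ℝ} {k l k' l' : ℕ} (h : (k, l) ≠ (k', l')) {f : Smooth 𝕜}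
    (hf : f ∈ tensorHarm 𝕜 k l) : proj (k', l') (Sob.bessel (incl 𝕜 s f)) = 0 := by
  rw [bessel_incl, proj_besselS, proj_of_mem_of_ne (i := (k, l)) h hf, smul_zero]

theorem ker_opSob (s : ℝ) : (opSob 𝕜 s).ker = (⨆ (k : ℕ) (l : ℕ) (_ : k ≠ l),
    (tensorHarm 𝕜 k l).map (incl 𝕜 s)).topologicalClosure := by
  ext u
  rw [mem_topologicalClosure_iff (S := fun k l => k ≠ l)]
  · have h1 : u ∈ (opSob 𝕜 s).ker ↔ opL2 𝕜 (Sob.bessel u) = 0 := by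
      rw [← bessel_opSob]
      exact ((bessel_injective (s + 1)).eq_iff' (map_zero _)).symm
    rw [h1, opL2_eq_zero_iff]
    constructor
    · intro h k l hkl
      rw [← not_not.1 hkl]
      exact h k
    · exact fun h k => h k k (by simp)
  · exact fun k l h => le_iSup_of_le k (le_iSup_of_le l (le_iSup_of_le h le_rfl))
  · intro k l hkl u hu
    have h2 : (⨆ (k : ℕ) (l : ℕ) (_ : k ≠ l), (tensorHarm 𝕜 k l).map (incl 𝕜 s))
        ≤ LinearMap.ker ((proj (k, l)).toLinearMap ∘ₗ Sob.bessel) := by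
      refine iSup_le fun k' => iSup_le fun l' => iSup_le fun h' => ?_
      rintro _ ⟨f, hf, rfl⟩
      refine proj_bessel_incl_of_ne (fun e => hkl fun h3 => h' ?_) hf
      rw [(Prod.mk.inj e).1, (Prod.mk.inj e).2, h3]
    exact h2 hu

theorem range_opSob (s : ℝ) : (opSob 𝕜 s).range
    = (⨆ k : ℕ, (tensorHarm 𝕜 k k).map (incl 𝕜 (s + 1))).topologicalClosure := by
  ext u
  rw [mem_topologicalClosure_iff (S := fun k l => k = l)]
  · constructor
    · rintro ⟨v, rfl⟩ k l hkl
      change proj (k, l) (Sob.bessel (opSob 𝕜 s v)) = 0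
      rw [bessel_opSob, opL2, proj_reflSum_of_ne _ hkl]
    · intro h
      refine ⟨(besselE 𝕜 s).symm (reflSum 𝕜 (fun k => (gain k)⁻¹) gain_inv_le (Sob.bessel u)),
        bessel_injective _ ?_⟩
      change Sob.bessel (opSob 𝕜 s _) = _
      rw [bessel_opSob, bessel_symm]
      exact reflSum_reflSum _ _ (fun k => mul_inv_cancel₀ (gain_pos k).ne') h
  · rintro k l rfl
    exact le_iSup (fun k => (tensorHarm 𝕜 k k).map (incl 𝕜 (s + 1))) k
  · intro k l hkl u hu
    have h2 : (⨆ k : ℕ, (tensorHarm 𝕜 k k).map (incl 𝕜 (s + 1)))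
        ≤ LinearMap.ker ((proj (k, l)).toLinearMap ∘ₗ Sob.bessel) := by
      refine iSup_le fun k' => ?_
      rintro _ ⟨f, hf, rfl⟩
      refine proj_bessel_incl_of_ne (fun e => hkl ?_) hf
      rw [← (Prod.mk.inj e).1, ← (Prod.mk.inj e).2]
    exact h2 hu

variable (𝕜) in
/-- The orthogonal projection of `H^s` to `ℋ_k ⊗ ℋ_ℓ`. -/
def sobProj (s : ℝ) (k l : ℕ) : Sob 𝕜 s →ₗ[𝕜] tensorHarm 𝕜 k l :=
  ((weight (k, l) ^ (s / 2) : ℝ) : 𝕜)⁻¹ • harmProj k l ∘ₗ Sob.bessel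

theorem ofReal_weight_rpow_ne_zero (i : ℕ × ℕ) (r : ℝ) : ((weight i ^ r : ℝ) : 𝕜) ≠ 0 := by
  have h0 := weight_pos i
  rw [Ne, RCLike.ofReal_eq_zero]
  positivity

theorem bessel_incl_sobProj (s : ℝ) (k l : ℕ) (u : Sob 𝕜 s) :
    Sob.bessel (incl 𝕜 s (sobProj 𝕜 s k l u).1) = proj (k, l) (Sob.bessel u) := by
  rw [bessel_incl, besselS_of_mem _ (sobProj 𝕜 s k l u).2, sobProj, LinearMap.smul_apply,
    Submodule.coe_smul, map_smul, smul_smul, mul_inv_cancel₀ (ofReal_weight_rpow_ne_zero _ _),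
    one_smul, LinearMap.comp_apply, toL2_harmProj]

theorem inner_incl_sub_sobProj (s : ℝ) (k l : ℕ) (u : Sob 𝕜 s) (h : tensorHarm 𝕜 k l) :
    inner 𝕜 (incl 𝕜 s h.1) (u - incl 𝕜 s (sobProj 𝕜 s k l u).1) = 0 := by
  change ⟪Sob.bessel (incl 𝕜 s h.1), Sob.bessel (u - incl 𝕜 s (sobProj 𝕜 s k l u).1)⟫_𝕜 = 0
  rw [map_sub, bessel_incl_sobProj, bessel_incl, besselS_of_mem _ h.2, inner_smul_left,
    inner_sub_right, inner_toL2_proj h.2, sub_self, mul_zero]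

theorem hasSum_opSob (s : ℝ) (u : Sob 𝕜 s) :
    HasSum (fun k : ℕ => ((k : 𝕜) + 1)⁻¹ • incl 𝕜 (s + 1) (reflection 𝕜 k (sobProj 𝕜 s k k u)).1)
      (opSob 𝕜 s u) := by
  refine ((isInducing_bessel (s + 1)).hasSum_iff (g := Sob.bessel) _ _).1 ?_
  rw [bessel_opSob, opL2]
  convert hasSum_reflSum gain_le (Sob.bessel u) using 1
  funext k
  have h := ofReal_weight_rpow_ne_zero (𝕜 := 𝕜) (k, k) (s / 2)
  rw [Function.comp_apply, map_smul, bessel_incl, besselS_of_mem _ (reflection 𝕜 k _).2, sobProj,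
    LinearMap.smul_apply, map_smul, Submodule.coe_smul, map_smul, LinearMap.comp_apply, smul_smul,
    smul_smul, gain, show (s + 1) / 2 = 1 / 2 + s / 2 by ring, Real.rpow_add (weight_pos _)]
  congr 1
  have hk : (k : 𝕜) + 1 ≠ 0 := Nat.cast_add_one_ne_zero k
  push_cast
  field_simp

end XiTransform

end

theorem theorem2 (𝕜 : Type*) [RCLike 𝕜] :
    -- the inclusions of `C^∞` in the Sobolev spaces
    ∃ ι : (s : ℝ) → XiTransform.Smooth 𝕜 →ₗ[𝕜] XiTransform.Sob 𝕜 s,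
    (∀ s, XiTransform.IsInclusion (ι s)) ∧
    -- the reflections `R_k` of `ℋ_k ⊗ ℋ_k`
    ∃ R : (k : ℕ) → XiTransform.tensorHarm 𝕜 k k →ₗ[𝕜] XiTransform.tensorHarm 𝕜 k k,
    (∀ k f, R k (R k f) = f) ∧
    (∀ k f h, XiTransform.innerL2 (R k f).1 h.1 = XiTransform.innerL2 f.1 (R k h).1) ∧
    ∀ s : ℝ,
      -- the bounded operator `T : H^s → H^{s+1}`
      ∃ T : XiTransform.Sob 𝕜 s →L[𝕜] XiTransform.Sob 𝕜 (s + 1),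
      XiTransform.IsWeakT T ∧
      (∀ f, T (ι s f) = ι (s + 1) (XiTransform.opT 𝕜 f)) ∧
      T.ker = (⨆ (k : ℕ) (l : ℕ) (_ : k ≠ l),
        (XiTransform.tensorHarm 𝕜 k l).map (ι s)).topologicalClosure ∧
      T.range = (⨆ k : ℕ,
        (XiTransform.tensorHarm 𝕜 k k).map (ι (s + 1))).topologicalClosure ∧
      -- the orthogonal projections `E_{k,l}` of `H^s` onto `ℋ_k ⊗ ℋ_l`
      ∃ E : (k l : ℕ) → XiTransform.Sob 𝕜 s →ₗ[𝕜] XiTransform.tensorHarm 𝕜 k l,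
      (∀ k l u, ∀ h : XiTransform.tensorHarm 𝕜 k l,
        inner 𝕜 (ι s h.1) (u - ι s (E k l u).1) = 0) ∧
      ∀ u, HasSum (fun k : ℕ => ((k : 𝕜) + 1)⁻¹ • ι (s + 1) (R k (E k k u)).1) (T u) := by
  refine ⟨XiTransform.incl 𝕜, XiTransform.isInclusion_incl, XiTransform.reflection 𝕜,
    XiTransform.reflection_reflection, fun k f h => ?_, fun s => ⟨XiTransform.opSob 𝕜 s,
      XiTransform.isWeakT_opSob s, XiTransform.opSob_incl s, XiTransform.ker_opSob s,
      XiTransform.range_opSob s, XiTransform.sobProj 𝕜 s,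
      XiTransform.inner_incl_sub_sobProj s, XiTransform.hasSum_opSob s⟩⟩
  rw [← XiTransform.inner_toL2_toL2, ← XiTransform.inner_toL2_toL2, XiTransform.inner_reflection]
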